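/- **Setting.** Let $a\colon\mathbb R\to[\delta,M]$ be a $C^1$ function with $\delta>0$ and $|a'|\le M$, let $v_0\colon\mathbb R\to\mathbb R$ be $1$-periodic (a function on the torus) with $|v_0(x)-v_0(y)|\le M|x-y|^\mu$ for some $\mu\in(0,1]$, and set $b=a(v_0)$. For $c>0$, $Q^b_t(x,y)$ denotes the fundamental solution of $\partial_t-b(x)\partial_x^2+c$ on $\mathbb R$, i.e. the continuous kernel on $t>0$, $x,y\in\mathbb R$, integrable in $y$, that is a classical solution in $(t,x)$ for every $y$ and such that for every bounded continuous $f$ the function $\int Q^b_t(x,y)f(y)\,dy$ is a classical solution, bounded on bounded time intervals, which converges to $f(x_0)$ as $(t,x)\to(0^+,x_0)$, for every $x_0$. For $\lambda>0$ let $Z^\lambda_t(x)=e^{-ct}(4\pi\lambda t)^{-1/2}e^{-x^2/(4\lambda t)}$. For $\zeta\in\mathbb R$ and $\beta_1,\beta_2\in[0,1]$, a family $A=\{A_t\}_{t>0}\subset C(\mathbb R\times\mathbb R)$ is in the class $\mathsf G^{(\zeta)}_{\beta_1,\beta_2}$ if, with $\mathsf G_t^{(\rho,\zeta)}(x)=t^{(\zeta-1)/2}e^{-\rho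 x^2/t}$, there are constants $C,\gamma,\rho>0$ such that $$|A_t(x,y)|\le Ce^{-\gamma t}\,\mathsf G^{(\rho,\zeta)}_t(x-y)$$ for all $t>0$ and $x,y\in\mathbb R$, and for all $\kappa_1\in[0,\beta_1)$ and $\kappa_2\in[0,\beta_2)$ there are such constants (which may depend on $\kappa_1,\kappa_2$) with $$|A_t(x,y)-A_t(x',y)|\le Ce^{-\gamma t}|x-x'|^{\kappa_1}\big\{\mathsf G_t^{(\rho,\zeta-\kappa_1)}(x-y)+\mathsf G_t^{(\rho,\zeta-\kappa_1)}(x'-y)\big\},$$ $$|A_t(x,y)-A_t(x,y')|\le Ce^{-\gamma t}|y-y'|^{\kappa_2}\big\{\mathsf G_t^{(\rho,\zeta-\kappa_2)}(x-y)+\mathsf G_t^{(\rho,\zeta-\kappa_2)}(x-y')\big\}.$$ **Proposition.** There are functions $Y^{k,\lambda}_t\colon\mathbb R\to\mathbb R$ ($k\in\{0,1,2\}$, $\lambda>0$, $t>0$), depending on $c>0$ but not on $a,v_0$, and there is a constant $c_0>0$ depending only on $\mu,\delta,M$, such that the following holds. 1. For every $c>0$ and $k\in\{0,1,2\}$, the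 kernels $Y^{k,\lambda}_t(x-y)$ belong to $\mathsf G^{(1-k)}_{1,1}$ with constants uniform over $\lambda$ in each compact subset of $(0,\infty)$; $Y^{k,\lambda}_t$ is odd when $k$ is even and even when $k$ is odd. 2. Let $c>c_0$. Then $Q^b$ exists. If $v_0\in C^\alpha$ with $\alpha\in(0,1]$ (Hölder continuous with exponent $\alpha$), then for every $k\in\{0,1,2\}$ both $$\partial_x^kQ^b_t(x,y)-(\partial^kZ_t)^{b(y)}(x-y)\quad\text{and}\quad\partial_x^kQ^b_t(x,y)-(\partial^kZ_t)^{b(x)}(x-y)$$ belong to $\mathsf G^{(\alpha-k)}_{\alpha,\alpha}$. 3. Let $c>c_0$. If $a$ and $v_0$ are $C^2$, then for every $k\in\{0,1,2\}$ $$\partial_x^kQ^b_t(x,y)-(\partial^kZ_t)^{b(x)}(x-y)-b'(x)\,Y^{k,b(x)}_t(x-y)$$ belongs to $\mathsf G^{(2-k)}_{1,1}$. -/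

import Mathlib

open Set Filter Topology MeasureTheory
open scoped NNReal BoundedContinuousFunction

noncomputable section

/-- The heat kernel `Z^λ_t(x) = e^{-ct} (4πλt)^{-1/2} exp(-x²/(4λt))` on the real line, that is the
fundamental solution of `∂_t - λ ∂_x² + c` with constant coefficient `λ > 0`. -/
def heatKernel (c lam t x : ℝ) : ℝ :=
  Real.exp (-c * t) * ((Real.sqrt (4 * Real.pi * lam * t))⁻¹ * Real.exp (-x ^ 2 / (4 * lam * t)))

/-- `u` is a classical solution on `(0,∞) × ℝ` of `∂_t u = b(x) ∂_x² u - c u`: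
it is `C²` in `x` with `∂_x² u` continuous in `(t,x)`, and it satisfies the equation pointwise. -/
structure IsClassicalSolution (b : ℝ → ℝ) (c : ℝ) (u : ℝ → ℝ → ℝ) : Prop where
  contDiff : ∀ t > 0, ContDiff ℝ 2 (u t)
  continuousOn : ContinuousOn (fun p : ℝ × ℝ => iteratedDeriv 2 (u p.1) p.2) (Ioi 0 ×ˢ univ)
  equation : ∀ t > 0, ∀ x : ℝ,
    HasDerivAt (fun s => u s x) (b x * iteratedDeriv 2 (u t) x - c * u t x) t

/-- `Q = Q_t(x,y)`, for `t > 0`, is the fundamental solution of `∂_t - b(x) ∂_x² + c`: it is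
continuous, it solves the equation in `(t,x)` for every `y`, and for every bounded continuous `f`
the function `u(t,x) = ∫ Q_t(x,y) f(y) dy` is a solution of the Cauchy problem with initial value
`f`, bounded on bounded time intervals. (The last clause makes `Q` unique: the pointwise limit at
`t = 0` alone would not exclude adding `∂_x Z_t(x) φ(y)`, for instance.) -/
structure IsFundamentalSolution (b : ℝ → ℝ) (c : ℝ) (Q : ℝ → ℝ → ℝ → ℝ) : Prop where
  continuousOn : ContinuousOn (fun p : ℝ × ℝ × ℝ => Q p.1 p.2.1 p.2.2) (Ioi 0 ×ˢ univ)
  solution : ∀ y : ℝ, IsClassicalSolution b c (fun t x => Q t x y)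
  integrable : ∀ t > 0, ∀ x : ℝ, Integrable (fun y => Q t x y)
  cauchy_solution : ∀ f : ℝ →ᵇ ℝ, IsClassicalSolution b c (fun t x => ∫ y, Q t x y * f y)
  cauchy_bounded : ∀ f : ℝ →ᵇ ℝ, ∀ T > 0, ∃ C : ℝ, ∀ t ∈ Ioc 0 T, ∀ x : ℝ,
    |∫ y, Q t x y * f y| ≤ C
  cauchy_initial : ∀ f : ℝ →ᵇ ℝ, ∀ x : ℝ,
    Tendsto (fun p : ℝ × ℝ => ∫ y, Q p.1 p.2 y * f y) (𝓝[>] 0 ×ˢ 𝓝 x) (𝓝 (f x))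

/-- The Gaussian kernel `G_t^{(c,ζ)}(x) = t^{(ζ-1)/2} exp(-c x²/t)`. -/
def gaussKernel (c ζ t x : ℝ) : ℝ :=
  t ^ ((ζ - 1) / 2) * Real.exp (-c * (x ^ 2 / t))

/-- The kernels `A i = {A i t}_{t>0}`, `i ∈ S`, belong to the class `G^{(ζ)}_{β₁,β₂}`, with an
exponentially decreasing factor `e^{-γt}`, and with constants that are uniform over `i ∈ S`. -/
structure MemGaussClassOn {ι : Type*} (S : Set ι) (ζ β₁ β₂ : ℝ)
    (A : ι → ℝ → ℝ → ℝ → ℝ) : Prop where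
  continuous : ∀ i ∈ S, ∀ t > 0, Continuous (fun p : ℝ × ℝ => A i t p.1 p.2)
  bound : ∃ C > 0, ∃ γ > 0, ∃ c > 0, ∀ i ∈ S, ∀ t > 0, ∀ x y : ℝ,
    |A i t x y| ≤ C * Real.exp (-γ * t) * gaussKernel c ζ t (x - y)
  holder_left : ∀ κ ∈ Ico 0 β₁, ∃ C > 0, ∃ γ > 0, ∃ c > 0,
    ∀ i ∈ S, ∀ t > 0, ∀ x x' y : ℝ,
      |A i t x y - A i t x' y| ≤ C * Real.exp (-γ * t) * |x - x'| ^ κ *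
        (gaussKernel c (ζ - κ) t (x - y) + gaussKernel c (ζ - κ) t (x' - y))
  holder_right : ∀ κ ∈ Ico 0 β₂, ∃ C > 0, ∃ γ > 0, ∃ c > 0,
    ∀ i ∈ S, ∀ t > 0, ∀ x y y' : ℝ,
      |A i t x y - A i t x y'| ≤ C * Real.exp (-γ * t) * |y - y'| ^ κ *
        (gaussKernel c (ζ - κ) t (x - y) + gaussKernel c (ζ - κ) t (x - y'))

/-- A single kernel `{A_t}_{t>0}` belongs to the class `G^{(ζ)}_{β₁,β₂}`. -/
def MemGaussClass (ζ β₁ β₂ : ℝ) (A : ℝ → ℝ → ℝ → ℝ) : Prop :=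
  MemGaussClassOn (univ : Set Unit) ζ β₁ β₂ (fun _ => A)

end

/-! The proof is Levi's parametrix method, arranged so that second space derivatives are read off
from time derivatives and the exponential growth of the bounds is fixed by `μ`, `δ`, `M` alone. The
killing term contributes only the factor `e^{-ct}`: the analysis concerns `∂_t - b ∂_x²` with bounds
of growth `e^{mt}`, and `c > m` turns growth into decay.

Construction. Let `Z^λ` be the heat kernel without killing. The parametrix is `P_t(x,y) =
Z^{b(y)}_t(x-y) + B(y) W^{b(y)}_t(x-y)`, where `(∂_t - λ ∂_w²) W^λ = w ∂_w² Z^λ`. One takes `B = 0`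
for Hölder data and `B = b'` for `C²` data; in the latter case `W` removes the linear Taylor term of
`b` at `y`. The defect `K = b ∂_x² P - ∂_t P` then has size `t^{ν/2-1}` times a Gaussian, with `ν =
α` or `ν = 2`. If `Φ = K + K * Φ`, then `Q = P + P * Φ` is the fundamental solution and `∂_x^k Q -
∂_x^k P` is better than `∂_x^k Z` by the factor `t^{ν/2}` (`exists_fundamentalSolution`). It remains
to compare `P` with kernels frozen at `x`: the mean value theorem in `λ` handles the Hölder case
(`Fam.kreg_sub`), and a second order expansion handles the `C²` case, producing `Y = ∂^k W - w ∂_λ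
∂^k Z` (`kreg_expansion`, `yker_eq`).

Second derivatives. The integral `∂_x² P * Φ` does not converge absolutely. Convolutions are
therefore written over the rescaled time `σ ∈ (0,1)`, where `t ∂_t` distributes over the two factors
(`hasTimeDeriv_conv`), so that `t ∂_t Φ` obeys the same bounds as `Φ`. An integration by parts in
`σ` then expresses `∂_x² (P * Φ)` by convergent integrals (`Parametrix.hasDerivAt_conv`). In the
remainder, Hölder regularity in `x` comes from the left factor `P` and regularity in `y` from `Φ`.

Uniformity. Gaussians of variance `8Mt` compose exactly, so iterating the Volterra operator costs
only scalar time integrals. For `m` large the operator contracts in suitable weights of exponent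
`t^{θ-1}`, with one `m` for all `θ` in `(0,1]` (`exists_goodW`). Thus the `μ`-Hölder bound fixes
`m`, while `α` and the norm in `C^α` enter only multiplicative constants. The second order expansion
is first obtained with a growth depending on `C²` norms; it is needed only for `t ≤ 1`, since for `t
≥ 1` the first order bound is good enough (`KReg.glue`). Uniqueness, by the maximum principle,
identifies the two constructions with any given fundamental solution. -/

noncomputable section

/-! ### Gaussian densities and their derivatives -/

/-- The centred Gaussian density of variance `u`. -/
def gk (u x : ℝ) : ℝ := (√(2 * Real.pi * u))⁻¹ * Real.exp (-x ^ 2 / (2 * u))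

/-- The spatial derivatives of the Gaussian density. -/
def gkD (n : ℕ) (u x : ℝ) : ℝ := iteratedDeriv n (gk u) x

lemma gk_nonneg (u x : ℝ) : 0 ≤ gk u x := by unfold gk; positivity

lemma gk_pos {u : ℝ} (hu : 0 < u) (x : ℝ) : 0 < gk u x := by unfold gk; positivity

lemma gk_neg (u x : ℝ) : gk u (-x) = gk u x := by simp [gk]

lemma gk_sub_comm (u x y : ℝ) : gk u (x - y) = gk u (y - x) := by rw [← gk_neg, neg_sub]

lemma gk_le {u : ℝ} (hu : 0 < u) (x : ℝ) : gk u x ≤ (√(2 * Real.pi * u))⁻¹ := by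
  unfold gk
  have : Real.exp (-x ^ 2 / (2 * u)) ≤ 1 := by
    rw [Real.exp_le_one_iff]
    exact div_nonpos_of_nonpos_of_nonneg (by nlinarith [sq_nonneg x]) (by positivity)
  exact mul_le_of_le_one_right (by positivity) this

lemma heatKernel_eq (c lam t x : ℝ) :
    heatKernel c lam t x = Real.exp (-c * t) * gk (2 * lam * t) x := by
  unfold heatKernel gk
  have e1 : 2 * Real.pi * (2 * lam * t) = 4 * Real.pi * lam * t := by ring
  have e2 : 2 * (2 * lam * t) = 4 * lam * t := by ring
  rw [e1, e2]

lemma contDiff_gk (u : ℝ) {n : WithTop ℕ∞} : ContDiff ℝ n (gk u) := by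
  unfold gk
  fun_prop

lemma gkD_zero (u x : ℝ) : gkD 0 u x = gk u x := by simp [gkD]

lemma hasDerivAt_gkD (n : ℕ) (u x : ℝ) : HasDerivAt (gkD n u) (gkD (n + 1) u x) x := by
  have h : Differentiable ℝ (iteratedDeriv n (gk u)) :=
    (contDiff_gk u (n := (n + 1 : ℕ))).differentiable_iteratedDeriv n (by exact_mod_cast n.lt_succ_self)
  have := (h x).hasDerivAt
  unfold gkD
  rw [iteratedDeriv_succ]
  exact this

lemma gkD_one {u : ℝ} (hu : u ≠ 0) (x : ℝ) : u * gkD 1 u x = -(x * gkD 0 u x) := by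
  have h1 : HasDerivAt (gk u) (-(x / u) * gk u x) x := by
    unfold gk
    have := (((hasDerivAt_pow 2 x).neg.div_const (2 * u)).exp.const_mul (√(2 * Real.pi * u))⁻¹)
    refine this.congr_deriv ?_
    simp only [Pi.neg_apply]
    field_simp
    ring
  have h2 := hasDerivAt_gkD 0 u x
  have e : gkD 0 u = gk u := by funext z; exact gkD_zero u z
  rw [e] at h2
  rw [h2.unique h1, gkD_zero]
  field_simp

/-- The Hermite recurrence, by repeated differentiation of `u ∂g = -x g`. It trades a factor `x` for
derivatives, which is how powers of the space variable are eliminated later. -/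
lemma gkD_rec {u : ℝ} (hu : u ≠ 0) (n : ℕ) (x : ℝ) :
    u * gkD (n + 2) u x = -(x * gkD (n + 1) u x + (n + 1) * gkD n u x) := by
  induction n generalizing x with
  | zero =>
    have h1 := (hasDerivAt_gkD 1 u x).const_mul u
    have h2 := ((hasDerivAt_id x).mul (hasDerivAt_gkD 0 u x)).neg
    have e : (fun y => u * gkD 1 u y) = -(id * gkD 0 u) := by
      funext y; simpa using gkD_one hu y
    rw [e] at h1
    have := h1.unique h2
    simp only [id] at this
    push_cast
    linarith
  | succ n ih =>
    have h1 := (hasDerivAt_gkD (n + 2) u x).const_mul u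
    have h2 := (((hasDerivAt_id x).mul (hasDerivAt_gkD (n + 1) u x)).add
      ((hasDerivAt_gkD n u x).const_mul ((n : ℝ) + 1))).neg
    have e : (fun y => u * gkD (n + 2) u y)
        = -(id * gkD (n + 1) u + fun y => ((n : ℝ) + 1) * gkD n u y) := by
      funext y; simpa using ih y
    rw [e] at h1
    have := h1.unique h2
    simp only [id] at this
    push_cast
    linarith

lemma hasDerivAt_gk_var {u : ℝ} (hu : 0 < u) (x : ℝ) :
    HasDerivAt (fun v => gk v x) (gkD 2 u x / 2) u := by
  have h0 := gkD_one hu.ne' x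
  have h1 := gkD_rec hu.ne' 0 x
  have e : gkD 2 u x = (x ^ 2 / u ^ 2 - 1 / u) * gk u x := by
    rw [gkD_zero] at *
    have e1 : gkD 1 u x = -(x * gk u x) / u := by rw [eq_div_iff hu.ne']; linarith
    have e2 : gkD 2 u x = -(x * gkD 1 u x + gk u x) / u := by
      rw [eq_div_iff hu.ne']; simp at h1; linarith
    rw [e2, e1]; field_simp; ring
  rw [e]
  unfold gk
  have hp : 0 < 2 * Real.pi * u := by positivity
  have d1 : HasDerivAt (fun v : ℝ => (√(2 * Real.pi * v))⁻¹)
      (-(1 / (2 * u)) * (√(2 * Real.pi * u))⁻¹) u := by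
    have := (((hasDerivAt_id u).const_mul (2 * Real.pi)).sqrt hp.ne').inv
      (by simpa using (Real.sqrt_pos.2 hp).ne')
    refine this.congr_deriv ?_
    simp only [id]
    rw [Real.sq_sqrt hp.le]
    have := (Real.sqrt_pos.2 hp).ne'
    field_simp
  have d2 : HasDerivAt (fun v : ℝ => Real.exp (-x ^ 2 / (2 * v)))
      ((x ^ 2 / (2 * u ^ 2)) * Real.exp (-x ^ 2 / (2 * u))) u := by
    have := ((hasDerivAt_const u (-x ^ 2)).div ((hasDerivAt_id u).const_mul 2)
      (by simpa using hu.ne')).exp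
    refine this.congr_deriv ?_
    simp only [id, Pi.div_apply]
    field_simp
    ring
  refine (d1.mul d2).congr_deriv ?_
  field_simp
  ring

/-- The heat equation `∂_u = ½ ∂_x²` passes to all spatial derivatives through the Hermite
recurrence, so no exchange of derivatives is needed. -/
lemma hasDerivAt_gkD_var (n : ℕ) {u : ℝ} (hu : 0 < u) (x : ℝ) :
    HasDerivAt (fun v => gkD n v x) (gkD (n + 2) u x / 2) u := by
  induction n using Nat.strong_induction_on with
  | _ n ih =>
    match n with
    | 0 =>
      simp only [gkD_zero]
      exact hasDerivAt_gk_var hu x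
    | 1 =>
      have h := (((ih 0 (by norm_num)).const_mul x).neg).div (hasDerivAt_id u) hu.ne'
      have e : (fun v => gkD 1 v x) =ᶠ[𝓝 u] (-(fun v => x * gkD 0 v x)) / id := by
        filter_upwards [lt_mem_nhds hu] with v hv
        have := gkD_one hv.ne' x
        simp only [Pi.div_apply, Pi.neg_apply, id]
        rw [eq_div_iff hv.ne']; linarith
      refine (h.congr_of_eventuallyEq e).congr_deriv ?_
      have h1 := gkD_one hu.ne' x
      have h3 := gkD_rec hu.ne' 1 x
      have h2 := gkD_rec hu.ne' 0 x
      simp only [id, Pi.neg_apply]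
      norm_num at *
      field_simp
      linear_combination 2 * h1 - u * h3
    | (n + 2) =>
      have h := (((((ih (n + 1) (by omega)).const_mul x).add
        ((ih n (by omega)).const_mul ((n : ℝ) + 1))).neg).div (hasDerivAt_id u) hu.ne')
      have e : (fun v => gkD (n + 2) v x) =ᶠ[𝓝 u]
          (-((fun v => x * gkD (n + 1) v x) + fun v => ((n : ℝ) + 1) * gkD n v x)) / id := by
        filter_upwards [lt_mem_nhds hu] with v hv
        have := gkD_rec hv.ne' n x
        simp only [Pi.div_apply, Pi.neg_apply, Pi.add_apply, id]
        rw [eq_div_iff hv.ne']; linarith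
      refine (h.congr_of_eventuallyEq e).congr_deriv ?_
      have h1 := gkD_rec hu.ne' n x
      have h2 := gkD_rec hu.ne' (n + 2) x
      simp only [id, Pi.neg_apply, Pi.add_apply]
      push_cast at *
      field_simp
      linear_combination 2 * h1 - u * h2

lemma continuousOn_gkD (n : ℕ) :
    ContinuousOn (fun p : ℝ × ℝ => gkD n p.1 p.2) (Ioi 0 ×ˢ univ) := by
  induction n using Nat.strong_induction_on with
  | _ n ih =>
    match n with
    | 0 =>
      simp only [gkD_zero, gk]
      refine ContinuousOn.mul (ContinuousOn.inv₀ (by fun_prop) ?_)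
        (Real.continuous_exp.comp_continuousOn (ContinuousOn.div (by fun_prop) (by fun_prop) ?_))
      · rintro ⟨u, x⟩ ⟨hu, -⟩
        have : 0 < 2 * Real.pi * u := mul_pos (by positivity) hu
        exact (Real.sqrt_pos.2 this).ne'
      · rintro ⟨u, x⟩ ⟨hu, -⟩
        exact mul_ne_zero two_ne_zero (ne_of_gt hu)
    | 1 =>
      refine (((continuousOn_snd.mul (ih 0 (by norm_num))).neg).div continuousOn_fst ?_).congr ?_
      · rintro ⟨u, x⟩ ⟨hu, -⟩; exact ne_of_gt hu
      · rintro ⟨u, x⟩ ⟨hu, -⟩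
        have hu' : u ≠ 0 := ne_of_gt hu
        have := gkD_one hu' x
        simp only [Pi.neg_apply, Pi.mul_apply, Pi.div_apply]
        rw [eq_div_iff hu']; linarith
    | (n + 2) =>
      refine (((continuousOn_snd.mul (ih (n + 1) (by omega))).add
        ((ih n (by omega)).const_smul ((n : ℝ) + 1))).neg.div continuousOn_fst ?_).congr ?_
      · rintro ⟨u, x⟩ ⟨hu, -⟩; exact ne_of_gt hu
      · rintro ⟨u, x⟩ ⟨hu, -⟩
        have hu' : u ≠ 0 := ne_of_gt hu
        have := gkD_rec hu' n x
        simp only [Pi.neg_apply, Pi.mul_apply, Pi.div_apply, Pi.add_apply, Pi.smul_apply, smul_eq_mul]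
        rw [eq_div_iff hu']; linarith

lemma gkD_neg (n : ℕ) {u : ℝ} (hu : u ≠ 0) (x : ℝ) : gkD n u (-x) = (-1) ^ n * gkD n u x := by
  induction n using Nat.strong_induction_on with
  | _ n ih =>
    match n with
    | 0 => simp [gkD_zero, gk_neg]
    | 1 =>
      have h1 := gkD_one hu x
      have h2 := gkD_one hu (-x)
      rw [ih 0 (by norm_num)] at h2
      apply mul_left_cancel₀ hu
      linear_combination h2 + h1
    | (n + 2) =>
      have h1 := gkD_rec hu n x
      have h2 := gkD_rec hu n (-x)
      rw [ih (n + 1) (by omega), ih n (by omega)] at h2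
      apply mul_left_cancel₀ hu
      rw [h2]
      linear_combination (-(-1 : ℝ) ^ (n+2)) * h1

lemma integral_gk {u : ℝ} (hu : 0 < u) : ∫ x, gk u x = 1 := by
  unfold gk
  rw [integral_const_mul]
  have e : (fun x : ℝ => Real.exp (-x ^ 2 / (2 * u)))
      = fun x => Real.exp (-(1 / (2 * u)) * x ^ 2) := by
    funext x; congr 1; field_simp
  rw [e, integral_gaussian]
  have h : Real.pi / (1 / (2 * u)) = 2 * Real.pi * u := by field_simp
  rw [h]
  exact inv_mul_cancel₀ (Real.sqrt_pos.2 (by positivity)).ne'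

lemma integrable_gk {u : ℝ} (hu : 0 < u) : Integrable (gk u) := by
  by_contra h
  have := integral_undef h
  rw [integral_gk hu] at this
  norm_num at this

lemma integrable_gk_sub {u : ℝ} (hu : 0 < u) (x : ℝ) : Integrable (fun z => gk u (x - z)) :=
  (integrable_gk hu).comp_sub_left x

lemma integral_gk_sub {u : ℝ} (hu : 0 < u) (x : ℝ) : ∫ z, gk u (x - z) = 1 := by
  rw [integral_sub_left_eq_self (gk u) volume x, integral_gk hu]

/-- Completing the square in `z` leaves a probability density in `z`. The resulting semigroup
identity is exact, which lets iterated compositions keep the same variance constant. -/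
lemma gk_mul_gk {u v : ℝ} (hu : 0 < u) (hv : 0 < v) (x y z : ℝ) :
    gk u (x - z) * gk v (z - y)
      = gk (u + v) (x - y) * gk (u * v / (u + v)) ((v * x + u * y) / (u + v) - z) := by
  unfold gk
  rw [mul_mul_mul_comm, mul_mul_mul_comm (√(2 * Real.pi * (u + v)))⁻¹, ← mul_inv, ← mul_inv,
    ← Real.exp_add, ← Real.exp_add, ← Real.sqrt_mul (by positivity), ← Real.sqrt_mul (by positivity)]
  have e : 2 * Real.pi * u * (2 * Real.pi * v)
      = 2 * Real.pi * (u + v) * (2 * Real.pi * (u * v / (u + v))) := by field_simp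
  rw [e]
  congr 2
  field_simp
  ring

lemma integrable_gk_mul_gk {u v : ℝ} (hu : 0 < u) (hv : 0 < v) (x y : ℝ) :
    Integrable (fun z => gk u (x - z) * gk v (z - y)) := by
  simp_rw [gk_mul_gk hu hv]
  exact (integrable_gk_sub (by positivity) _).const_mul _

lemma integral_gk_mul_gk {u v : ℝ} (hu : 0 < u) (hv : 0 < v) (x y : ℝ) :
    ∫ z, gk u (x - z) * gk v (z - y) = gk (u + v) (x - y) := by
  simp_rw [gk_mul_gk hu hv]
  rw [integral_const_mul, integral_gk_sub (by positivity), mul_one]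

lemma one_add_pow_le_exp {r : ℝ} (hr : 0 ≤ r) (n : ℕ) : (1 + r) ^ n ≤ Real.exp (n * r) := by
  rw [Real.exp_nat_mul]
  exact pow_le_pow_left₀ (by positivity) (by linarith [Real.add_one_le_exp r]) n

/-- The recurrence gives by induction the polynomial factor `(1 + |x|/√u)^n`. It is replaced by an
exponential so that it can be absorbed together with the exponential weights. -/
lemma abs_gkD_le (n : ℕ) : ∃ C : ℝ, 0 ≤ C ∧ ∀ u > 0, ∀ x : ℝ,
    |gkD n u x| ≤ C * ((√u)⁻¹ ^ n * (Real.exp (n * (|x| / √u)) * gk u x)) := by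
  suffices H : ∃ C : ℝ, 0 ≤ C ∧ ∀ u > 0, ∀ x : ℝ,
      |gkD n u x| ≤ C * ((√u)⁻¹ ^ n * ((1 + |x| / √u) ^ n * gk u x)) by
    obtain ⟨C, hC, h⟩ := H
    refine ⟨C, hC, fun u hu x => (h u hu x).trans ?_⟩
    gcongr
    · exact gk_nonneg u x
    · exact one_add_pow_le_exp (by positivity) n
  induction n using Nat.strong_induction_on with
  | _ n ih =>
    match n with
    | 0 => exact ⟨1, by norm_num, fun u hu x => by simp [gkD_zero, abs_of_nonneg (gk_nonneg u x)]⟩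
    | 1 =>
      refine ⟨1, by norm_num, fun u hu x => ?_⟩
      have h := gkD_one hu.ne' x
      have hs : 0 < √u := Real.sqrt_pos.2 hu
      have e : gkD 1 u x = -((√u)⁻¹ * ((x / √u) * gk u x)) := by
        rw [gkD_zero] at h
        have h2 : √u * √u = u := Real.mul_self_sqrt hu.le
        field_simp
        rw [sq, h2, mul_comm, h]
      rw [e, abs_neg, abs_mul, abs_mul, abs_of_nonneg (gk_nonneg u x), abs_of_pos (inv_pos.2 hs),
        abs_div, abs_of_pos hs, one_mul, pow_one, pow_one]
      have := gk_nonneg u x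
      gcongr
      linarith
    | (n + 2) =>
      obtain ⟨C1, hC1, h1⟩ := ih (n + 1) (by omega)
      obtain ⟨C0, hC0, h0⟩ := ih n (by omega)
      refine ⟨C1 + (n + 1) * C0, by positivity, fun u hu x => ?_⟩
      have h := gkD_rec hu.ne' n x
      have hs : 0 < √u := Real.sqrt_pos.2 hu
      have h2 : √u * √u = u := Real.mul_self_sqrt hu.le
      set s := (√u)⁻¹ with hsdef
      have hs' : 0 < s := inv_pos.2 hs
      set r := |x| / √u with hr
      have hr0 : 0 ≤ r := by positivity
      have e : gkD (n + 2) u x = -(s * ((x / √u) * gkD (n + 1) u x) + (n + 1) * (s ^ 2 * gkD n u x)) := by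
        rw [hsdef]
        field_simp
        rw [sq, h2, mul_comm, h]
      have b1 := h1 u hu x
      have b0 := h0 u hu x
      rw [e, abs_neg]
      have hg := gk_nonneg u x
      calc _ ≤ s * (r * |gkD (n + 1) u x|) + (n + 1) * (s ^ 2 * |gkD n u x|) := by
            refine (abs_add_le _ _).trans (le_of_eq ?_)
            rw [abs_mul, abs_mul, abs_mul, abs_mul, abs_div, abs_of_pos hs, abs_of_pos hs',
              abs_of_nonneg (by positivity : (0 : ℝ) ≤ s ^ 2),
              abs_of_nonneg (by positivity : (0 : ℝ) ≤ (n : ℝ) + 1)]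
        _ ≤ s * ((1 + r) * (C1 * (s ^ (n + 1) * ((1 + r) ^ (n + 1) * gk u x))))
            + (n + 1) * (s ^ 2 * (C0 * (s ^ n * ((1 + r) ^ n * gk u x)))) := by
            gcongr
            linarith
        _ ≤ s * ((1 + r) * (C1 * (s ^ (n + 1) * ((1 + r) ^ (n + 1) * gk u x))))
            + (n + 1) * (s ^ 2 * (C0 * (s ^ n * ((1 + r) ^ (n + 2) * gk u x)))) := by
            gcongr
            · linarith
            · omega
        _ = _ := by ring

/-- Gaussian bound of the derivatives, uniform over a compact set of diffusivities, over
perturbations of size `√t` of the space variable, and with room for an exponential weight. -/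
lemma gkD_bound {δ M : ℝ} (hδ : 0 < δ) (hM : 0 < M) (n : ℕ) (q : ℝ) :
    ∃ C : ℝ, 0 ≤ C ∧ ∀ t > 0, ∀ lam ∈ Icc δ M, ∀ w ξ : ℝ, |ξ - w| ≤ √t →
      Real.exp (q * (|w| / √t)) * |gkD n (2 * lam * t) ξ|
        ≤ C * (t ^ (-(n : ℝ) / 2) * gk (8 * M * t) w) := by
  obtain ⟨C0, hC0, h0⟩ := abs_gkD_le n
  set p : ℝ := q + n / √(2 * δ) with hp
  refine ⟨C0 * ((√(2 * δ))⁻¹ ^ n * (Real.exp (n / √(2 * δ) + 1 / (4 * M) + 4 * M * p ^ 2)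
    * (√(8 * M) / √(2 * δ)))), by positivity, ?_⟩
  intro t ht lam hlam w ξ hξ
  have hlam0 : 0 < lam := lt_of_lt_of_le hδ hlam.1
  set s := √t with hsd
  have hs : 0 < s := Real.sqrt_pos.2 ht
  have hss : s * s = t := Real.mul_self_sqrt ht.le
  have hu : 0 < 2 * lam * t := by positivity
  set d := √(2 * δ) with hd
  have hd0 : 0 < d := Real.sqrt_pos.2 (by positivity)
  have hsu : d * s ≤ √(2 * lam * t) := by
    rw [hd, hsd, ← Real.sqrt_mul (by positivity)]
    apply Real.sqrt_le_sqrt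
    have := hlam.1
    gcongr
  have hds : 0 < d * s := by positivity
  set r := |w| / s with hr
  have hr0 : 0 ≤ r := by positivity
  have hwr : |w| = r * s := by rw [hr]; field_simp
  have hξ1 : |ξ| ≤ (r + 1) * s := by
    have : |ξ| ≤ |ξ - w| + |w| := by simpa using abs_add_le (ξ - w) w
    rw [add_mul, ← hwr]; linarith
  -- Moving the argument by at most `√t` halves the Gaussian exponent, from `ξ²/(4Mt)` to `w²/(8Mt)`
  -- up to a constant. A second halving, in `key`, pays for the exponential factors. What remains,
  -- `w²/(16Mt)`, is the exponent of variance `8Mt`.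
  have hw2 : w ^ 2 ≤ 2 * ξ ^ 2 + 2 * t := by
    have h1 : (ξ - w) ^ 2 ≤ t := by
      rw [← sq_abs, ← hss, ← sq]; exact pow_le_pow_left₀ (abs_nonneg _) hξ 2
    nlinarith [sq_nonneg (2 * ξ - w)]
  have hw2' : w ^ 2 = r ^ 2 * t := by rw [← sq_abs, hwr, ← hss]; ring
  have b := h0 _ hu ξ
  have e1 : (√(2 * lam * t))⁻¹ ≤ d⁻¹ * s⁻¹ := by
    rw [← mul_inv]; exact inv_anti₀ hds hsu
  have e2 : |ξ| / √(2 * lam * t) ≤ (r + 1) / d := by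
    calc |ξ| / √(2 * lam * t) ≤ ((r + 1) * s) / (d * s) := by gcongr
      _ = _ := by field_simp
  have e3 : gk (2 * lam * t) ξ ≤ d⁻¹ * s⁻¹ * ((√(2 * Real.pi))⁻¹
      * Real.exp (1 / (4 * M) - r ^ 2 / (8 * M))) := by
    unfold gk
    have f1 : (√(2 * Real.pi * (2 * lam * t)))⁻¹ = (√(2 * lam * t))⁻¹ * (√(2 * Real.pi))⁻¹ := by
      rw [Real.sqrt_mul (by positivity), mul_inv, mul_comm]
    rw [f1, mul_assoc]
    gcongr
    have f2 : -ξ ^ 2 / (2 * (2 * lam * t)) ≤ -ξ ^ 2 / (4 * M * t) := by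
      rw [neg_div, neg_div, neg_le_neg_iff]
      have := hlam.2
      apply div_le_div_of_nonneg_left (sq_nonneg _) (by positivity)
      nlinarith
    refine f2.trans ?_
    have f3 : -ξ ^ 2 ≤ t - r ^ 2 * t / 2 := by rw [← hw2']; linarith
    calc -ξ ^ 2 / (4 * M * t) ≤ (t - r ^ 2 * t / 2) / (4 * M * t) := by gcongr
      _ = _ := by field_simp; ring
  have e4 : gk (8 * M * t) w
      = (√(8 * M))⁻¹ * s⁻¹ * ((√(2 * Real.pi))⁻¹ * Real.exp (-(r ^ 2 / (16 * M)))) := by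
    unfold gk
    have f1 : √(2 * Real.pi * (8 * M * t)) = √(2 * Real.pi) * (√(8 * M) * s) := by
      rw [Real.sqrt_mul (by positivity) (8 * M * t), Real.sqrt_mul (by positivity) t]
    rw [f1, hw2', mul_inv, mul_inv]
    have : -(r ^ 2 * t) / (2 * (8 * M * t)) = -(r ^ 2 / (16 * M)) := by field_simp; ring
    rw [this]; ring
  have e5 : t ^ (-(n : ℝ) / 2) = s⁻¹ ^ n := by
    rw [hsd, Real.sqrt_eq_rpow, ← Real.rpow_neg ht.le, ← Real.rpow_natCast, ← Real.rpow_mul ht.le]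
    congr 1; ring
  have key : Real.exp (q * r) * (Real.exp (n * ((r + 1) / d)) * Real.exp (1 / (4 * M) - r ^ 2 / (8 * M)))
      ≤ Real.exp (n / d + 1 / (4 * M) + 4 * M * p ^ 2) * Real.exp (-(r ^ 2 / (16 * M))) := by
    rw [← Real.exp_add, ← Real.exp_add, ← Real.exp_add]
    apply Real.exp_le_exp.2
    have f : p * r ≤ 4 * M * p ^ 2 + r ^ 2 / (16 * M) := by
      have : 4 * M * p ^ 2 + r ^ 2 / (16 * M) - p * r = (8 * M * p - r) ^ 2 / (16 * M) := by
        field_simp; ring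
      have h2 : 0 ≤ (8 * M * p - r) ^ 2 / (16 * M) := by positivity
      linarith
    have g : n * ((r + 1) / d) + q * r = p * r + n / d := by rw [hp]; field_simp; ring
    have g2 : r ^ 2 / (8 * M) = r ^ 2 / (16 * M) + r ^ 2 / (16 * M) := by field_simp; ring
    linarith
  calc Real.exp (q * r) * |gkD n (2 * lam * t) ξ|
      ≤ Real.exp (q * r) * (C0 * ((d⁻¹ * s⁻¹) ^ n * (Real.exp (n * ((r + 1) / d))
        * (d⁻¹ * s⁻¹ * ((√(2 * Real.pi))⁻¹ * Real.exp (1 / (4 * M) - r ^ 2 / (8 * M))))))) := by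
        refine mul_le_mul_of_nonneg_left (b.trans ?_) (Real.exp_pos _).le
        have := gk_nonneg (2 * lam * t) ξ
        gcongr
    _ = C0 * ((d⁻¹ * s⁻¹) ^ n * (d⁻¹ * s⁻¹ * (√(2 * Real.pi))⁻¹)) * (Real.exp (q * r)
        * (Real.exp (n * ((r + 1) / d)) * Real.exp (1 / (4 * M) - r ^ 2 / (8 * M)))) := by ring
    _ ≤ C0 * ((d⁻¹ * s⁻¹) ^ n * (d⁻¹ * s⁻¹ * (√(2 * Real.pi))⁻¹)) * (
        Real.exp (n / d + 1 / (4 * M) + 4 * M * p ^ 2) * Real.exp (-(r ^ 2 / (16 * M)))) := by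
        gcongr
    _ = _ := by
        rw [e4, e5]
        have : √(8 * M) * (√(8 * M))⁻¹ = 1 :=
          mul_inv_cancel₀ (Real.sqrt_pos.2 (by positivity)).ne'
        rw [mul_pow, div_eq_mul_inv (√(8 * M))]
        linear_combination (-(C0 * (d⁻¹ ^ n * s⁻¹ ^ n * (d⁻¹ * s⁻¹ * (√(2 * Real.pi))⁻¹)) * (
          Real.exp (n / d + 1 / (4 * M) + 4 * M * p ^ 2)
            * Real.exp (-(r ^ 2 / (16 * M)))))) * this

/-! ### Heat kernel derivatives graded by parabolic degree -/

/-- The generators `λ^i t^j ∂^n Z` of the spaces of heat kernel derivatives. -/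
def famGen (i j n : ℕ) : ℝ → ℝ → ℝ → ℝ := fun lam t w => lam ^ i * t ^ j * gkD n (2 * lam * t) w

/-- The span of the functions `λ^i t^j ∂^n Z` of parabolic degree `n - 2 j = d`. -/
def Fam (d : ℝ) : Submodule ℝ (ℝ → ℝ → ℝ → ℝ) :=
  Submodule.span ℝ {H | ∃ i j n : ℕ, (n : ℝ) - 2 * j = d ∧ H = famGen i j n}

lemma famGen_mem {d : ℝ} (i j n : ℕ) (h : (n : ℝ) - 2 * j = d) : famGen i j n ∈ Fam d :=
  Submodule.subset_span ⟨i, j, n, h, rfl⟩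

lemma hasDerivAt_famGen_space (i j n : ℕ) (lam t w : ℝ) :
    HasDerivAt (famGen i j n lam t) (famGen i j (n + 1) lam t w) w :=
  (hasDerivAt_gkD n (2 * lam * t) w).const_mul _

lemma hasDerivAt_famGen_lam (i j n : ℕ) {lam t : ℝ} (hl : 0 < lam) (ht : 0 < t) (w : ℝ) :
    HasDerivAt (fun l => famGen i j n l t w)
      (i * famGen (i - 1) j n lam t w + famGen i (j + 1) (n + 2) lam t w) lam := by
  have h1 := (hasDerivAt_gkD_var n (u := 2 * lam * t) (by positivity) w).comp lam
    (((hasDerivAt_id lam).const_mul 2).mul_const t)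
  have h2 := ((hasDerivAt_pow i lam).mul_const (t ^ j)).mul h1
  refine h2.congr_deriv ?_
  simp only [famGen, Function.comp, id]
  ring

lemma hasDerivAt_famGen_time (i j n : ℕ) {lam t : ℝ} (hl : 0 < lam) (ht : 0 < t) (w : ℝ) :
    HasDerivAt (fun s => famGen i j n lam s w)
      ((j * famGen i j n lam t w + famGen (i + 1) (j + 1) (n + 2) lam t w) / t) t := by
  have h1 := (hasDerivAt_gkD_var n (u := 2 * lam * t) (by positivity) w).comp t
    ((hasDerivAt_id t).const_mul (2 * lam))
  have h2 := ((hasDerivAt_pow j t).const_mul (lam ^ i)).mul h1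
  refine h2.congr_deriv ?_
  simp only [famGen, Function.comp]
  rcases j with _ | j
  · simp; field_simp; ring
  · simp; field_simp; ring

lemma Fam.exists_deriv_space {d : ℝ} {H : ℝ → ℝ → ℝ → ℝ} (hH : H ∈ Fam d) :
    ∃ H' ∈ Fam (d + 1), ∀ lam t w, HasDerivAt (H lam t) (H' lam t w) w := by
  induction hH using Submodule.span_induction with
  | mem H h =>
    obtain ⟨i, j, n, hd, rfl⟩ := h
    exact ⟨famGen i j (n + 1), famGen_mem _ _ _ (by push_cast; linarith),
      fun lam t w => hasDerivAt_famGen_space i j n lam t w⟩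
  | zero => exact ⟨0, Submodule.zero_mem _, fun lam t w => hasDerivAt_const _ _⟩
  | add f g _ _ hf hg =>
    obtain ⟨f', hf', h1⟩ := hf
    obtain ⟨g', hg', h2⟩ := hg
    exact ⟨f' + g', Submodule.add_mem _ hf' hg', fun lam t w => (h1 lam t w).add (h2 lam t w)⟩
  | smul a f _ hf =>
    obtain ⟨f', hf', h1⟩ := hf
    exact ⟨a • f', Submodule.smul_mem _ a hf', fun lam t w => (h1 lam t w).const_smul a⟩

/-- By the heat equation `∂_λ` acts as `t ∂_w²`, of parabolic degree zero, so differentiating in the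
diffusivity costs no power of `t`. Replacing `b(y)` by `b(x)` therefore gains the full Hölder
factor. -/
lemma Fam.exists_deriv_lam {d : ℝ} {H : ℝ → ℝ → ℝ → ℝ} (hH : H ∈ Fam d) :
    ∃ H' ∈ Fam d, ∀ lam > 0, ∀ t > 0, ∀ w,
      HasDerivAt (fun l => H l t w) (H' lam t w) lam := by
  induction hH using Submodule.span_induction with
  | mem H h =>
    obtain ⟨i, j, n, hd, rfl⟩ := h
    exact ⟨(i : ℝ) • famGen (i - 1) j n + famGen i (j + 1) (n + 2), Submodule.add_mem _
      (Submodule.smul_mem _ _ (famGen_mem _ _ _ hd)) (famGen_mem _ _ _ (by push_cast; linarith)),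
      fun lam hl t ht w => hasDerivAt_famGen_lam i j n hl ht w⟩
  | zero => exact ⟨0, Submodule.zero_mem _, fun lam _ t _ w => hasDerivAt_const _ _⟩
  | add f g _ _ hf hg =>
    obtain ⟨f', hf', h1⟩ := hf
    obtain ⟨g', hg', h2⟩ := hg
    exact ⟨f' + g', Submodule.add_mem _ hf' hg',
      fun lam hl t ht w => (h1 lam hl t ht w).add (h2 lam hl t ht w)⟩
  | smul a f _ hf =>
    obtain ⟨f', hf', h1⟩ := hf
    exact ⟨a • f', Submodule.smul_mem _ a hf', fun lam hl t ht w => (h1 lam hl t ht w).const_smul a⟩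

lemma Fam.continuousOn {d : ℝ} {H : ℝ → ℝ → ℝ → ℝ} (hH : H ∈ Fam d) :
    ContinuousOn (fun p : ℝ × ℝ × ℝ => H p.1 p.2.1 p.2.2) (Ioi 0 ×ˢ Ioi 0 ×ˢ univ) := by
  induction hH using Submodule.span_induction with
  | mem H h =>
    obtain ⟨i, j, n, hd, rfl⟩ := h
    refine ContinuousOn.mul (by fun_prop) ?_
    refine (continuousOn_gkD n).comp (f := fun p : ℝ × ℝ × ℝ => (2 * p.1 * p.2.1, p.2.2))
      (by fun_prop) ?_
    rintro ⟨l, t, w⟩ ⟨hl, ht, -⟩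
    exact ⟨mul_pos (mul_pos two_pos (mem_Ioi.1 hl)) (mem_Ioi.1 ht), mem_univ _⟩
  | zero => exact continuousOn_const
  | add f g _ _ hf hg => exact hf.add hg
  | smul a f _ hf => exact hf.const_smul a

lemma Fam.bound {δ M d : ℝ} (hδ : 0 < δ) (hM : 0 < M) {H : ℝ → ℝ → ℝ → ℝ} (hH : H ∈ Fam d)
    (q : ℝ) : ∃ C : ℝ, 0 ≤ C ∧ ∀ t > 0, ∀ lam ∈ Icc δ M, ∀ w ξ : ℝ, |ξ - w| ≤ √t →
      Real.exp (q * (|w| / √t)) * |H lam t ξ| ≤ C * (t ^ (-d / 2) * gk (8 * M * t) w) := by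
  induction hH using Submodule.span_induction with
  | mem H h =>
    obtain ⟨i, j, n, hd, rfl⟩ := h
    obtain ⟨C, hC, hb⟩ := gkD_bound hδ hM n q
    refine ⟨M ^ i * C, by positivity, fun t ht lam hl w ξ hξ => ?_⟩
    have := hb t ht lam hl w ξ hξ
    have hl0 : 0 < lam := hδ.trans_le hl.1
    have e : t ^ (-d / 2) = t ^ j * t ^ (-(n : ℝ) / 2) := by
      rw [← Real.rpow_natCast, ← Real.rpow_add ht]
      congr 1; linarith
    unfold famGen
    rw [abs_mul, abs_of_nonneg (by positivity : 0 ≤ lam ^ i * t ^ j), e]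
    calc _ = lam ^ i * t ^ j * (Real.exp (q * (|w| / √t)) * |gkD n (2 * lam * t) ξ|) := by ring
      _ ≤ M ^ i * t ^ j * (C * (t ^ (-(n : ℝ) / 2) * gk (8 * M * t) w)) := by
        have := hl.2
        gcongr
      _ = _ := by ring
  | zero => exact ⟨0, le_rfl, fun t ht lam hl w ξ hξ => by simp⟩
  | add f g _ _ hf hg =>
    obtain ⟨C1, hC1, h1⟩ := hf
    obtain ⟨C2, hC2, h2⟩ := hg
    refine ⟨C1 + C2, by positivity, fun t ht lam hl w ξ hξ => ?_⟩
    have b1 := h1 t ht lam hl w ξ hξ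
    have b2 := h2 t ht lam hl w ξ hξ
    have b3 := mul_le_mul_of_nonneg_left (abs_add_le (f lam t ξ) (g lam t ξ))
      (Real.exp_pos (q * (|w| / √t))).le
    simp only [Pi.add_apply]
    linarith
  | smul a f _ hf =>
    obtain ⟨C1, hC1, h1⟩ := hf
    refine ⟨|a| * C1, by positivity, fun t ht lam hl w ξ hξ => ?_⟩
    have b1 := mul_le_mul_of_nonneg_left (h1 t ht lam hl w ξ hξ) (abs_nonneg a)
    simp only [Pi.smul_apply, smul_eq_mul, abs_mul]
    linarith

/-- The mean value theorem is applied in `λ` at fixed `w`, then in `w` along a segment of length at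
most `√t`. On such a segment `Fam.bound` holds with the Gaussian and the weight at the endpoint `w`.
-/
lemma Fam.diff_bound {δ M d : ℝ} (hδ : 0 < δ) (hM : 0 < M) {H : ℝ → ℝ → ℝ → ℝ} (hH : H ∈ Fam d)
    (q : ℝ) : ∃ C : ℝ, 0 ≤ C ∧ ∀ t > 0, ∀ lam ∈ Icc δ M, ∀ lam' ∈ Icc δ M, ∀ w w' : ℝ,
      |w' - w| ≤ √t → Real.exp (q * (|w| / √t)) * |H lam t w - H lam' t w'|
        ≤ C * ((|lam - lam'| + |w - w'| / √t) * (t ^ (-d / 2) * gk (8 * M * t) w)) := by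
  obtain ⟨Hw, hHw, dw⟩ := Fam.exists_deriv_space hH
  obtain ⟨Hl, hHl, dl⟩ := Fam.exists_deriv_lam hH
  obtain ⟨C1, hC1, b1⟩ := Fam.bound hδ hM hHw q
  obtain ⟨C2, hC2, b2⟩ := Fam.bound hδ hM hHl q
  refine ⟨C1 + C2, by positivity, fun t ht lam hl lam' hl' w w' hw => ?_⟩
  have hs : 0 < √t := Real.sqrt_pos.2 ht
  set E := Real.exp (q * (|w| / √t)) with hE
  have hE0 : 0 < E := Real.exp_pos _
  set g := t ^ (-d / 2) * gk (8 * M * t) w with hg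
  have hg0 : 0 ≤ g := mul_nonneg (by positivity) (gk_nonneg _ _)
  have e1 : t ^ (-(d + 1) / 2) = t ^ (-d / 2) * (√t)⁻¹ := by
    rw [Real.sqrt_eq_rpow, ← Real.rpow_neg ht.le, ← Real.rpow_add ht]; congr 1; ring
  have A : E * |H lam t w - H lam' t w| ≤ C2 * (|lam - lam'| * g) := by
    have := (convex_Icc δ M).norm_image_sub_le_of_norm_hasDerivWithin_le
      (f := fun l => H l t w) (f' := fun l => Hl l t w) (C := E⁻¹ * (C2 * g))
      (fun l h => (dl l (hδ.trans_le h.1) t ht w).hasDerivWithinAt)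
      (fun l h => by
        rw [Real.norm_eq_abs, inv_mul_eq_div, le_div_iff₀ hE0, mul_comm]
        exact b2 t ht l h w w (by simp [hs.le])) hl' hl
    simp only [Real.norm_eq_abs] at this
    calc _ ≤ E * (E⁻¹ * (C2 * g) * |lam - lam'|) := by gcongr
      _ = _ := by field_simp
  have B : E * |H lam' t w - H lam' t w'| ≤ C1 * (|w - w'| / √t * g) := by
    have := (convex_uIcc w w').norm_image_sub_le_of_norm_hasDerivWithin_le
      (f := fun v => H lam' t v) (f' := fun v => Hw lam' t v) (C := E⁻¹ * (C1 * ((√t)⁻¹ * g)))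
      (fun v h => (dw lam' t v).hasDerivWithinAt)
      (fun v h => by
        rw [Real.norm_eq_abs, inv_mul_eq_div, le_div_iff₀ hE0, mul_comm]
        have h3 : |v - w| ≤ √t := (abs_sub_left_of_mem_uIcc h).trans hw
        refine (b1 t ht lam' hl' w v h3).trans (le_of_eq ?_)
        rw [e1, hg]; ring) right_mem_uIcc left_mem_uIcc
    simp only [Real.norm_eq_abs] at this
    calc _ ≤ E * (E⁻¹ * (C1 * ((√t)⁻¹ * g)) * |w - w'|) := by gcongr
      _ = _ := by field_simp
  have T := abs_sub_le (H lam t w) (H lam' t w) (H lam' t w')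
  have n1 : 0 ≤ C1 * (|lam - lam'| * g) := by positivity
  have n2 : 0 ≤ C2 * (|w - w'| / √t * g) := by positivity
  calc E * |H lam t w - H lam' t w'|
      ≤ E * (|H lam t w - H lam' t w| + |H lam' t w - H lam' t w'|) := by gcongr
    _ ≤ C2 * (|lam - lam'| * g) + C1 * (|w - w'| / √t * g) := by rw [mul_add]; gcongr
    _ ≤ (C1 + C2) * ((|lam - lam'| + |w - w'| / √t) * g) := by linarith

/-! ### Gaussian bounds, weights and coefficients -/

/-- Gaussian bound with parameter `L`, time weight `t^{θ-1}` and growth `e^{mt}`. -/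
def KBd (L θ m : ℝ) (f : ℝ → ℝ → ℝ → ℝ) : Prop :=
  ∃ C : ℝ, 0 ≤ C ∧ ∀ t > 0, ∀ x y, |f t x y|
    ≤ C * (t ^ (θ - 1) * Real.exp (m * t) * gk (L * t) (x - y))

/-- Gaussian Hölder bound of exponent `κ` in the first space variable. -/
def KHx (L θ m κ : ℝ) (f : ℝ → ℝ → ℝ → ℝ) : Prop :=
  ∃ C : ℝ, 0 ≤ C ∧ ∀ t > 0, ∀ x x' y, |f t x y - f t x' y|
    ≤ C * (|x - x'| ^ κ * (t ^ (θ - 1 - κ / 2) * Real.exp (m * t)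
      * (gk (L * t) (x - y) + gk (L * t) (x' - y))))

/-- The kernel with exchanged space variables. -/
def kswap (f : ℝ → ℝ → ℝ → ℝ) : ℝ → ℝ → ℝ → ℝ := fun t x y => f t y x

/-- Gaussian Hölder bound of exponent `κ` in the second space variable. -/
def KHy (L θ m κ : ℝ) (f : ℝ → ℝ → ℝ → ℝ) : Prop := KHx L θ m κ (kswap f)

/-- Joint continuity of a kernel at positive times. -/
def KC (f : ℝ → ℝ → ℝ → ℝ) : Prop :=
  ContinuousOn (fun p : ℝ × ℝ × ℝ => f p.1 p.2.1 p.2.2) (Ioi 0 ×ˢ univ)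

/-- Gaussian decay with arbitrary exponential weights, and local Hölder continuity. -/
def Wk (L θ m κ : ℝ) (f : ℝ → ℝ → ℝ → ℝ) : Prop :=
  ∀ q : ℝ, ∃ C : ℝ, 0 ≤ C ∧ ∀ t > 0, ∀ x y,
    Real.exp (q * (|x - y| / √t)) * |f t x y|
        ≤ C * (t ^ (θ - 1) * Real.exp (m * t) * gk (L * t) (x - y)) ∧
      ∀ x', |x' - x| ≤ √t → Real.exp (q * (|x - y| / √t)) * |f t x y - f t x' y|
        ≤ C * ((|x - x'| / √t) ^ κ * (t ^ (θ - 1) * Real.exp (m * t) * gk (L * t) (x - y)))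

/-- Coefficients of parabolic size `t^p` which are locally Hölder continuous. -/
def Coef (p m κ : ℝ) (A : ℝ → ℝ → ℝ → ℝ) : Prop :=
  ∃ q : ℝ, 0 ≤ q ∧ ∃ C : ℝ, 0 ≤ C ∧ ∀ t > 0, ∀ x y,
    |A t x y| ≤ C * (t ^ p * Real.exp (m * t) * Real.exp (q * (|x - y| / √t))) ∧
      ∀ x', |x' - x| ≤ √t → |A t x y - A t x' y|
        ≤ C * ((|x - x'| / √t) ^ κ * (t ^ p * Real.exp (m * t) * Real.exp (q * (|x - y| / √t))))

lemma rpow_le_exp {t p : ℝ} (ht : 0 < t) (hp : 0 ≤ p) :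
    t ^ p ≤ Real.exp (p * p) * Real.exp t := by
  rcases eq_or_lt_of_le hp with rfl | hp
  · simpa using ht.le
  rw [← Real.exp_add, Real.rpow_def_of_pos ht]
  apply Real.exp_le_exp.2
  have h := Real.log_le_sub_one_of_pos (show 0 < t / (p + 1) by positivity)
  have h2 := Real.log_le_sub_one_of_pos (show 0 < p + 1 by positivity)
  rw [Real.log_div ht.ne' (by positivity)] at h
  have h3 : Real.log t ≤ t / (p + 1) - 1 + p := by linarith
  have h4 : Real.log t * p ≤ (t / (p + 1) - 1 + p) * p := by gcongr
  have h5 : t / (p + 1) * p ≤ t := by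
    rw [div_mul_eq_mul_div, div_le_iff₀ (by positivity)]; nlinarith
  nlinarith

lemma rpow_le_exp_of_le_one {t p : ℝ} (ht : 0 < t) (hp : 0 ≤ p) (hp1 : p ≤ 1) :
    t ^ p ≤ Real.exp t := by
  have h1 : t ^ p ≤ 1 + t := by
    rcases le_total t 1 with h | h
    · have := Real.rpow_le_one ht.le h hp; linarith
    · have := Real.rpow_le_rpow_of_exponent_le h hp1
      rw [Real.rpow_one] at this; linarith
  linarith [Real.add_one_le_exp t]

lemma rpow_le_one_exp {r p : ℝ} (hr : 0 ≤ r) (hp : 0 ≤ p) (hp1 : p ≤ 1) :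
    r ^ p ≤ Real.exp r := by
  rcases eq_or_lt_of_le hr with rfl | hr
  · rw [Real.exp_zero]; exact Real.zero_rpow_le_one p
  · exact rpow_le_exp_of_le_one hr hp hp1

lemma div_sqrt_rpow {t r κ : ℝ} (ht : 0 < t) (hr : 0 ≤ r) :
    (r / √t) ^ κ = r ^ κ * t ^ (-κ / 2) := by
  rw [Real.div_rpow hr (Real.sqrt_nonneg t), Real.sqrt_eq_rpow, ← Real.rpow_mul ht.le, div_eq_mul_inv,
    ← Real.rpow_neg ht.le]
  congr 2; ring

lemma rpow_eq_mul_div_sqrt {t r κ : ℝ} (ht : 0 < t) (hr : 0 ≤ r) :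
    r ^ κ = t ^ (κ / 2) * (r / √t) ^ κ := by
  rw [div_sqrt_rpow ht hr, mul_left_comm, ← Real.rpow_add ht]
  simp [neg_div]

lemma Wk.kbd {L θ m κ : ℝ} {f : ℝ → ℝ → ℝ → ℝ} (h : Wk L θ m κ f) : KBd L θ m f := by
  obtain ⟨C, hC, hb⟩ := h 0
  exact ⟨C, hC, fun t ht x y => by simpa using (hb t ht x y).1⟩

/-- Within distance `√t` the local bound applies, and a smaller exponent is weaker because the ratio
is at most one. Beyond `√t` the factor `(|x - x'|/√t)^κ'` is at least one and the two size bounds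
suffice. -/
lemma Wk.khx {L θ m κ κ' : ℝ} {f : ℝ → ℝ → ℝ → ℝ} (h : Wk L θ m κ f) (h0 : 0 ≤ κ') (h1 : κ' ≤ κ) :
    KHx L θ m κ' f := by
  obtain ⟨C, hC, hb⟩ := h 0
  refine ⟨C, hC, fun t ht x x' y => ?_⟩
  have hs : 0 < √t := Real.sqrt_pos.2 ht
  have e : |x - x'| ^ κ' * (t ^ (θ - 1 - κ' / 2) * Real.exp (m * t)
      * (gk (L * t) (x - y) + gk (L * t) (x' - y)))
      = (|x - x'| / √t) ^ κ' * (t ^ (θ - 1) * Real.exp (m * t)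
      * (gk (L * t) (x - y) + gk (L * t) (x' - y))) := by
    rw [div_sqrt_rpow ht (abs_nonneg _), sub_eq_add_neg (θ - 1), Real.rpow_add ht, neg_div]; ring
  rw [e]
  have g1 := gk_nonneg (L * t) (x - y)
  have g2 := gk_nonneg (L * t) (x' - y)
  rcases le_total |x' - x| (√t) with hx | hx
  · have b := (hb t ht x y).2 x' hx
    simp only [zero_mul, Real.exp_zero, one_mul] at b
    refine b.trans ?_
    have hr : |x - x'| / √t ≤ 1 := by rw [div_le_one hs, abs_sub_comm]; exact hx
    have : (|x - x'| / √t) ^ κ ≤ (|x - x'| / √t) ^ κ' :=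
      Real.rpow_le_rpow_of_exponent_ge' (by positivity) hr h0 h1
    gcongr
    linarith
  · have b1 := (hb t ht x y).1
    have b2 := (hb t ht x' y).1
    simp only [zero_mul, Real.exp_zero, one_mul] at b1 b2
    have hr : 1 ≤ |x - x'| / √t := by rw [le_div_iff₀ hs, abs_sub_comm, one_mul]; exact hx
    have hr' : 1 ≤ (|x - x'| / √t) ^ κ' := Real.one_le_rpow hr h0
    calc |f t x y - f t x' y| ≤ |f t x y| + |f t x' y| := abs_sub _ _
      _ ≤ C * (1 * (t ^ (θ - 1) * Real.exp (m * t) * (gk (L * t) (x - y) + gk (L * t) (x' - y)))) := by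
        linarith
      _ ≤ _ := by gcongr

/-- The freedom of the weight is spent here: the kernel bound at `q + q'` absorbs the growth
`e^{q'|x-y|/√t}` of the coefficient. Moving the coefficient bound from `x` to `x'` costs `e^{q'}`.
-/
lemma Wk.mul {L θ m κ p m' : ℝ} {f A : ℝ → ℝ → ℝ → ℝ} (hf : Wk L θ m κ f) (hA : Coef p m' κ A) :
    Wk L (θ + p) (m + m') κ (fun t x y => A t x y * f t x y) := by
  intro q
  obtain ⟨q', hq', D, hD, hA⟩ := hA
  obtain ⟨C, hC, hb⟩ := hf (q + q')
  refine ⟨D * C + D * (1 + Real.exp q') * C, by positivity, fun t ht x y => ?_⟩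
  have hs : 0 < √t := Real.sqrt_pos.2 ht
  obtain ⟨a1, a2⟩ := hA t ht x y
  obtain ⟨f1, f2⟩ := hb t ht x y
  have g1 := gk_nonneg (L * t) (x - y)
  set r := |x - y| / √t with hr
  have e : t ^ (θ + p - 1) * Real.exp ((m + m') * t) * gk (L * t) (x - y)
      = t ^ p * Real.exp (m' * t) * (t ^ (θ - 1) * Real.exp (m * t) * gk (L * t) (x - y)) := by
    rw [show θ + p - 1 = p + (θ - 1) by ring, Real.rpow_add ht, add_mul, Real.exp_add]; ring
  rw [e]
  set a := t ^ p * Real.exp (m' * t) with ha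
  set g := t ^ (θ - 1) * Real.exp (m * t) * gk (L * t) (x - y) with hg
  have ha0 : 0 < a := by positivity
  have hg0 : 0 ≤ g := by positivity
  have hE : Real.exp ((q + q') * r) = Real.exp (q * r) * Real.exp (q' * r) := by
    rw [← Real.exp_add]; ring_nf
  rw [hE] at f1 f2
  set E := Real.exp (q * r)
  set E' := Real.exp (q' * r)
  have hE0 : 0 < E := Real.exp_pos _
  have hE'0 : 0 < E' := Real.exp_pos _
  have n1 : 0 ≤ D * C * (a * g) := by positivity
  refine ⟨?_, fun x' hx => ?_⟩
  · calc E * |A t x y * f t x y| = E * (|A t x y| * |f t x y|) := by rw [abs_mul]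
      _ ≤ E * (D * (a * E') * |f t x y|) := by gcongr
      _ = D * a * (E * E' * |f t x y|) := by ring
      _ ≤ D * a * (C * g) := by gcongr
      _ = D * C * (a * g) := by ring
      _ ≤ _ := by
        have : 0 ≤ D * (1 + Real.exp q') * C * (a * g) := by positivity
        linarith
  · have f2 := f2 x' hx
    have a2 := a2 x' hx
    obtain ⟨a3, -⟩ := hA t ht x' y
    set ρ := (|x - x'| / √t) ^ κ
    have hρ : 0 ≤ ρ := by positivity
    have h3 : |x' - y| / √t ≤ r + 1 := by
      rw [hr, div_add_one hs.ne']
      gcongr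
      have := abs_add_le (x' - x) (x - y)
      simp at this; linarith
    have a3' : |A t x' y| ≤ D * (a * (Real.exp q' * E')) := by
      refine a3.trans ?_
      gcongr
      rw [← Real.exp_add]
      apply Real.exp_le_exp.2
      nlinarith
    calc E * |A t x y * f t x y - A t x' y * f t x' y|
        = E * |(A t x y - A t x' y) * f t x y + A t x' y * (f t x y - f t x' y)| := by ring_nf
      _ ≤ E * (|A t x y - A t x' y| * |f t x y| + |A t x' y| * |f t x y - f t x' y|) := by
        gcongr
        exact (abs_add_le _ _).trans (by rw [abs_mul, abs_mul])
      _ ≤ E * (D * (ρ * (a * E')) * |f t x y| + D * (a * (Real.exp q' * E')) * |f t x y - f t x' y|) := by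
        gcongr
      _ = D * ρ * a * (E * E' * |f t x y|) + D * a * Real.exp q' * (E * E' * |f t x y - f t x' y|) := by
        ring
      _ ≤ D * ρ * a * (C * g) + D * a * Real.exp q' * (C * (ρ * g)) := by gcongr
      _ ≤ _ := by
        have : 0 ≤ D * C * (a * g) * ρ := by positivity
        linarith

lemma Coef.mul {p m κ p' m' : ℝ} {A B : ℝ → ℝ → ℝ → ℝ} (hA : Coef p m κ A) (hB : Coef p' m' κ B) :
    Coef (p + p') (m + m') κ (fun t x y => A t x y * B t x y) := by
  obtain ⟨q, hq, C, hC, hA⟩ := hA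
  obtain ⟨q', hq', D, hD, hB⟩ := hB
  refine ⟨q + q', by positivity, C * D + C * Real.exp q * D, by positivity, fun t ht x y => ?_⟩
  have hs : 0 < √t := Real.sqrt_pos.2 ht
  obtain ⟨a1, a2⟩ := hA t ht x y
  obtain ⟨b1, b2⟩ := hB t ht x y
  set r := |x - y| / √t with hr
  have e : t ^ (p + p') * Real.exp ((m + m') * t) * Real.exp ((q + q') * r)
      = (t ^ p * Real.exp (m * t) * Real.exp (q * r))
        * (t ^ p' * Real.exp (m' * t) * Real.exp (q' * r)) := by
    rw [Real.rpow_add ht, add_mul, Real.exp_add, add_mul, Real.exp_add]; ring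
  rw [e]
  set a := t ^ p * Real.exp (m * t) * Real.exp (q * r) with ha
  set b := t ^ p' * Real.exp (m' * t) * Real.exp (q' * r)
  have ha0 : 0 < a := by positivity
  have hb0 : 0 < b := by positivity
  refine ⟨?_, fun x' hx => ?_⟩
  · rw [abs_mul]
    calc _ ≤ C * a * (D * b) := by gcongr
      _ ≤ _ := by
        have : 0 ≤ C * Real.exp q * D * (a * b) := by positivity
        linarith
  · obtain ⟨a3, -⟩ := hA t ht x' y
    have a2 := a2 x' hx
    have b2 := b2 x' hx
    set ρ := (|x - x'| / √t) ^ κ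
    have hρ : 0 ≤ ρ := by positivity
    have h3 : |x' - y| / √t ≤ r + 1 := by
      rw [hr, div_add_one hs.ne']
      gcongr
      have := abs_add_le (x' - x) (x - y)
      simp at this; linarith
    have a3' : |A t x' y| ≤ C * (Real.exp q * a) := by
      refine a3.trans ?_
      rw [ha, show Real.exp q * (t ^ p * Real.exp (m * t) * Real.exp (q * r))
        = t ^ p * Real.exp (m * t) * (Real.exp q * Real.exp (q * r)) by ring]
      gcongr
      rw [← Real.exp_add]
      apply Real.exp_le_exp.2
      nlinarith
    calc |A t x y * B t x y - A t x' y * B t x' y|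
        = |(A t x y - A t x' y) * B t x y + A t x' y * (B t x y - B t x' y)| := by ring_nf
      _ ≤ |A t x y - A t x' y| * |B t x y| + |A t x' y| * |B t x y - B t x' y| :=
        (abs_add_le _ _).trans (by rw [abs_mul, abs_mul])
      _ ≤ C * (ρ * a) * (D * b) + C * (Real.exp q * a) * (D * (ρ * b)) := by gcongr
      _ = _ := by ring

/-- A bounded Hölder function of the space variable, as a coefficient. -/
lemma coef_of_holder {κ C : ℝ} {β : ℝ → ℝ → ℝ} (hκ : 0 ≤ κ) (hκ1 : κ ≤ 1)
    (hb : ∀ x y, |β x y| ≤ C) (hβ : ∀ x x' y, |β x y - β x' y| ≤ C * |x - x'| ^ κ) :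
    Coef 0 1 κ (fun _ x y => β x y) := by
  have hC : 0 ≤ C := (abs_nonneg _).trans (hb 0 0)
  refine ⟨0, le_rfl, C, hC, fun t ht x y => ⟨?_, fun x' hx => ?_⟩⟩
  · simp only [Real.rpow_zero, one_mul, zero_mul, Real.exp_zero, mul_one]
    refine (hb x y).trans (le_mul_of_one_le_right hC (Real.one_le_exp ht.le))
  · simp only [Real.rpow_zero, one_mul, zero_mul, Real.exp_zero, mul_one]
    refine (hβ x x' y).trans ?_
    rw [rpow_eq_mul_div_sqrt ht (abs_nonneg _), mul_comm (t ^ (κ / 2))]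
    gcongr
    exact rpow_le_exp_of_le_one ht (by linarith) (by linarith)

/-- A coefficient which vanishes on the diagonal to Hölder order `α`. -/
lemma coef_of_diag {α C : ℝ} {A : ℝ → ℝ → ℝ} (hα : 0 ≤ α) (hα1 : α ≤ 1) (hC : 0 ≤ C)
    (hb : ∀ x y, |A x y| ≤ C * |x - y| ^ α)
    (hA : ∀ x x' y, |A x y - A x' y| ≤ C * |x - x'| ^ α) :
    Coef (α / 2) 0 α (fun _ x y => A x y) := by
  refine ⟨1, zero_le_one, C, hC, fun t ht x y => ⟨?_, fun x' hx => ?_⟩⟩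
  · refine (hb x y).trans ?_
    -- Writing `|x-y|^α = t^{α/2} (|x-y|/√t)^α` converts vanishing on the diagonal into a power of
    -- `t`; the second factor goes into the exponential weight.
    rw [rpow_eq_mul_div_sqrt ht (abs_nonneg _), zero_mul, Real.exp_zero, mul_one, one_mul]
    gcongr
    exact rpow_le_one_exp (by positivity) hα hα1
  · refine (hA x x' y).trans ?_
    rw [rpow_eq_mul_div_sqrt ht (abs_nonneg _), zero_mul, Real.exp_zero, mul_one, one_mul,
      mul_left_comm, mul_comm (t ^ (α / 2)) (Real.exp _), ← mul_assoc, ← mul_assoc]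
    have h1 : 1 ≤ Real.exp (|x - y| / √t) := Real.one_le_exp (by positivity)
    have h0 : 0 ≤ C * (|x - x'| / √t) ^ α * t ^ (α / 2) := by positivity
    nlinarith

/-- A coefficient which vanishes on the diagonal to second order. -/
lemma coef_of_diag_two {C : ℝ} {A : ℝ → ℝ → ℝ} (hC : 0 ≤ C)
    (hb : ∀ x y, |A x y| ≤ C * |x - y| ^ 2)
    (hA : ∀ x x' y, |A x y - A x' y| ≤ C * (|x - x'| * (|x - y| + |x - x'|))) :
    Coef 1 0 1 (fun _ x y => A x y) := by
  refine ⟨2, zero_le_two, 2 * C, by positivity, fun t ht x y => ?_⟩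
  have hs : 0 < √t := Real.sqrt_pos.2 ht
  have hss : √t * √t = t := Real.mul_self_sqrt ht.le
  have e1 : |x - y| = √t * (|x - y| / √t) := by field_simp
  set r := |x - y| / √t with hr
  have hr0 : 0 ≤ r := by positivity
  have h1 : 1 + r ≤ Real.exp r := by linarith [Real.add_one_le_exp r]
  have h2 : Real.exp (2 * r) = Real.exp r * Real.exp r := by rw [← Real.exp_add]; ring_nf
  have h3 : (1 + r) * (1 + r) ≤ Real.exp (2 * r) := by rw [h2]; gcongr
  rw [Real.rpow_one, zero_mul, Real.exp_zero, mul_one]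
  refine ⟨?_, fun x' hx => ?_⟩
  · refine (hb x y).trans ?_
    rw [e1, mul_pow, sq (√t), hss]
    have : r ^ 2 ≤ Real.exp (2 * r) := by nlinarith
    have h5 : C * (t * r ^ 2) ≤ C * (t * Real.exp (2 * r)) := by gcongr
    have : 0 ≤ C * (t * Real.exp (2 * r)) := by positivity
    linarith
  · refine (hA x x' y).trans ?_
    rw [Real.rpow_one]
    have e2 : |x - x'| = √t * (|x - x'| / √t) := by field_simp
    have hρ1 : |x - x'| / √t ≤ 1 := by rw [div_le_one hs, abs_sub_comm]; exact hx
    rw [e1]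
    set ρ := |x - x'| / √t
    have hρ0 : 0 ≤ ρ := by positivity
    rw [e2]
    calc C * (√t * ρ * (√t * r + √t * ρ)) = C * (ρ * (√t * √t * (r + ρ))) := by ring
      _ ≤ C * (ρ * (√t * √t * Real.exp (2 * r))) := by
        gcongr; nlinarith
      _ ≤ _ := by
        rw [hss]
        have : 0 ≤ C * (ρ * (t * Real.exp (2 * r))) := by positivity
        linarith

/-! ### Weighted bounds for frozen and averaged heat kernels -/

/-- Averages of functions in `Fam d`, with Hölder continuous coefficients, are Gaussian kernels. -/
lemma Fam.wk_integral {δ M d : ℝ} (hδ : 0 < δ) (hM : 0 < M) {H : ℝ → ℝ → ℝ → ℝ} (hH : H ∈ Fam d)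
    {φ : ℝ → ℝ} (hφ : Continuous φ) (hφ1 : ∀ s ∈ Icc (0 : ℝ) 1, |φ s| ≤ 1)
    {β : ℝ → ℝ → ℝ → ℝ} (hβ : ∀ x y, Continuous (fun s => β s x y))
    (hβm : ∀ s ∈ Icc (0 : ℝ) 1, ∀ x y, β s x y ∈ Icc δ M) {κ Cb : ℝ} (hκ : 0 ≤ κ) (hκ1 : κ ≤ 1)
    (hCb : 0 ≤ Cb)
    (hβh : ∀ s ∈ Icc (0 : ℝ) 1, ∀ x x' y, |β s x y - β s x' y| ≤ Cb * |x - x'| ^ κ) (ε : ℝ)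
    (hε : |ε| = 1) :
    Wk (8 * M) (1 - d / 2) 1 κ
      (fun t x y => ∫ s in (0 : ℝ)..1, φ s * H (β s x y) t (ε * (x - y))) := by
  intro q
  obtain ⟨C1, hC1, b1⟩ := Fam.bound hδ hM hH q
  obtain ⟨C2, hC2, b2⟩ := Fam.diff_bound hδ hM hH q
  refine ⟨C1 + C2 * (Cb + 1), by positivity, fun t ht x y => ?_⟩
  have hs : 0 < √t := Real.sqrt_pos.2 ht
  have ew : |ε * (x - y)| = |x - y| := by rw [abs_mul, hε, one_mul]
  have eg : gk (8 * M * t) (ε * (x - y)) = gk (8 * M * t) (x - y) := by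
    unfold gk; rw [← sq_abs, ew, sq_abs]
  have ed : (1 - d / 2 - 1) = -d / 2 := by ring
  rw [ed, one_mul]
  have hexp : 1 ≤ Real.exp t := Real.one_le_exp ht.le
  set g := t ^ (-d / 2) * gk (8 * M * t) (x - y) with hg
  have hg0 : 0 ≤ g := mul_nonneg (by positivity) (gk_nonneg _ _)
  have eg2 : t ^ (-d / 2) * Real.exp t * gk (8 * M * t) (x - y) = Real.exp t * g := by
    rw [hg]; ring
  rw [eg2]
  set E := Real.exp (q * (|x - y| / √t)) with hE
  have hE0 : 0 < E := Real.exp_pos _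
  refine ⟨?_, fun x' hx => ?_⟩
  · have : |∫ s in (0 : ℝ)..1, φ s * H (β s x y) t (ε * (x - y))| ≤ E⁻¹ * (C1 * g) * |1 - 0| := by
      rw [← Real.norm_eq_abs]
      refine intervalIntegral.norm_integral_le_of_norm_le_const fun s hs' => ?_
      rw [uIoc_of_le zero_le_one] at hs'
      have hs1 : s ∈ Icc (0 : ℝ) 1 := ⟨hs'.1.le, hs'.2⟩
      have := b1 t ht _ (hβm s hs1 x y) (ε * (x - y)) (ε * (x - y)) (by simp)
      rw [ew, eg] at this
      rw [Real.norm_eq_abs, abs_mul, inv_mul_eq_div, le_div_iff₀ hE0]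
      calc _ ≤ 1 * |H (β s x y) t (ε * (x - y))| * E := by
            gcongr; exact hφ1 s hs1
        _ ≤ _ := by rw [one_mul, mul_comm]; exact this
    calc _ ≤ E * (E⁻¹ * (C1 * g) * |1 - 0|) := by gcongr
      _ = C1 * (1 * g) := by field_simp; simp
      _ ≤ C1 * (Real.exp t * g) := by gcongr
      _ ≤ _ := by
        have : 0 ≤ C2 * (Cb + 1) * (Real.exp t * g) := by positivity
        linarith
  · set ρ := (|x - x'| / √t) ^ κ with hρ
    have hρ0 : 0 ≤ ρ := by positivity
    have hint : ∀ z, IntervalIntegrable (fun s => φ s * H (β s z y) t (ε * (z - y))) volume 0 1 := by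
      intro z
      apply ContinuousOn.intervalIntegrable
      refine hφ.continuousOn.mul ?_
      refine (Fam.continuousOn hH).comp (f := fun s => (β s z y, t, ε * (z - y)))
        (Continuous.continuousOn (by have := hβ z y; fun_prop)) ?_
      intro s hs'
      rw [uIcc_of_le zero_le_one] at hs'
      exact ⟨hδ.trans_le (hβm s hs' z y).1, ht, mem_univ _⟩
    rw [← intervalIntegral.integral_sub (hint x) (hint x')]
    have : |∫ s in (0 : ℝ)..1, (φ s * H (β s x y) t (ε * (x - y))
        - φ s * H (β s x' y) t (ε * (x' - y)))|
        ≤ E⁻¹ * (C2 * ((Cb + 1) * (ρ * (Real.exp t * g)))) * |1 - 0| := by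
      rw [← Real.norm_eq_abs]
      refine intervalIntegral.norm_integral_le_of_norm_le_const fun s hs' => ?_
      rw [uIoc_of_le zero_le_one] at hs'
      have hs1 : s ∈ Icc (0 : ℝ) 1 := ⟨hs'.1.le, hs'.2⟩
      have ex : ε * (x' - y) - ε * (x - y) = ε * (x' - x) := by ring
      have := b2 t ht _ (hβm s hs1 x y) _ (hβm s hs1 x' y) (ε * (x - y)) (ε * (x' - y))
        (by rw [ex, abs_mul, hε, one_mul]; exact hx)
      rw [ew, eg, abs_sub_comm (ε * (x - y)), ex, abs_mul, hε, one_mul] at this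
      rw [Real.norm_eq_abs, ← mul_sub, abs_mul, inv_mul_eq_div, le_div_iff₀ hE0]
      -- The oscillation of the diffusivity carries a factor `t^{κ/2}`, which is absorbed into
      -- `e^t`. This is why the conclusion has growth rate `1`.
      have hh : |β s x y - β s x' y| ≤ Cb * (ρ * Real.exp t) := by
        refine (hβh s hs1 x x' y).trans ?_
        rw [rpow_eq_mul_div_sqrt ht (abs_nonneg _), mul_comm (t ^ (κ / 2))]
        gcongr
        exact rpow_le_exp_of_le_one ht (by linarith) (by linarith)
      have hr : |x - x'| / √t ≤ 1 := by rw [div_le_one hs, abs_sub_comm]; exact hx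
      have hh2 : |x' - x| / √t ≤ ρ * Real.exp t := by
        rw [abs_sub_comm]
        have : |x - x'| / √t ≤ ρ := by
          have := Real.rpow_le_rpow_of_exponent_ge' (by positivity) hr hκ hκ1
          rwa [Real.rpow_one] at this
        nlinarith
      calc _ ≤ 1 * |H (β s x y) t (ε * (x - y)) - H (β s x' y) t (ε * (x' - y))| * E := by
            gcongr; exact hφ1 s hs1
        _ ≤ C2 * ((|β s x y - β s x' y| + |x' - x| / √t) * g) := by
          rw [one_mul, mul_comm]; exact this
        _ ≤ C2 * ((Cb * (ρ * Real.exp t) + ρ * Real.exp t) * g) := by gcongr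
        _ = _ := by ring
    calc _ ≤ E * (E⁻¹ * (C2 * ((Cb + 1) * (ρ * (Real.exp t * g)))) * |1 - 0|) := by gcongr
      _ = C2 * (Cb + 1) * (ρ * (Real.exp t * g)) := by field_simp; simp
      _ ≤ _ := by
        have : 0 ≤ C1 * (ρ * (Real.exp t * g)) := by positivity
        linarith

lemma Fam.wk {δ M d : ℝ} (hδ : 0 < δ) (hM : 0 < M) {H : ℝ → ℝ → ℝ → ℝ} (hH : H ∈ Fam d)
    {β : ℝ → ℝ → ℝ} (hβm : ∀ x y, β x y ∈ Icc δ M) {κ Cb : ℝ} (hκ : 0 ≤ κ) (hκ1 : κ ≤ 1)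
    (hCb : 0 ≤ Cb) (hβh : ∀ x x' y, |β x y - β x' y| ≤ Cb * |x - x'| ^ κ) (ε : ℝ) (hε : |ε| = 1) :
    Wk (8 * M) (1 - d / 2) 1 κ (fun t x y => H (β x y) t (ε * (x - y))) := by
  have := Fam.wk_integral hδ hM hH (φ := fun _ => 1) continuous_const (by simp)
    (β := fun _ => β) (fun _ _ => continuous_const) (fun _ _ => hβm) hκ hκ1 hCb
    (fun _ _ => hβh) ε hε
  simpa using this

/-! ### Spatial composition and differentiation under the integral -/

/-- Local Gaussian domination, in the second space variable. -/
def LGau (k : ℝ → ℝ → ℝ → ℝ) : Prop :=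
  ∀ τ₀ > 0, ∀ x₀ : ℝ, ∃ C ρ : ℝ, 0 < ρ ∧ ∀ τ ∈ Icc (τ₀ / 2) (2 * τ₀), ∀ x, |x - x₀| ≤ 1 →
    ∀ z, |k τ x z| ≤ C * Real.exp (-ρ * (z - x₀) ^ 2)

/-- Local boundedness, uniformly in the first space variable. -/
def LBdd (f : ℝ → ℝ → ℝ → ℝ) : Prop :=
  ∀ s₀ > 0, ∀ y₀ : ℝ, ∃ C : ℝ, ∀ s ∈ Icc (s₀ / 2) (2 * s₀), ∀ y, |y - y₀| ≤ 1 →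
    ∀ z, |f s z y| ≤ C

lemma exists_rpow_mul_exp_le (p m : ℝ) {t₀ : ℝ} (ht₀ : 0 < t₀) :
    ∃ C : ℝ, 0 < C ∧ ∀ t ∈ Icc (t₀ / 2) (2 * t₀), t ^ p * Real.exp (m * t) ≤ C := by
  have hc : ContinuousOn (fun t : ℝ => t ^ p * Real.exp (m * t)) (Icc (t₀ / 2) (2 * t₀)) := by
    refine ContinuousOn.mul (ContinuousOn.rpow_const continuousOn_id ?_) (by fun_prop)
    intro t ht
    left
    exact ne_of_gt (lt_of_lt_of_le (by positivity) ht.1)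
  obtain ⟨C, hC⟩ := isCompact_Icc.exists_bound_of_continuousOn hc
  refine ⟨|C| + 1, by positivity, fun t ht => ?_⟩
  have := hC t ht
  rw [Real.norm_eq_abs] at this
  linarith [le_abs_self (t ^ p * Real.exp (m * t)), le_abs_self C]

lemma exists_gauss_le {L : ℝ} (hL : 0 < L) (p m : ℝ) {t₀ : ℝ} (ht₀ : 0 < t₀) :
    ∃ C ρ : ℝ, 0 < C ∧ 0 < ρ ∧ ∀ t ∈ Icc (t₀ / 2) (2 * t₀), ∀ x x₀ : ℝ, |x - x₀| ≤ 1 → ∀ z,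
      t ^ p * Real.exp (m * t) * gk (L * t) (x - z) ≤ C * Real.exp (-ρ * (z - x₀) ^ 2) := by
  obtain ⟨C, hC, hb⟩ := exists_rpow_mul_exp_le p m ht₀
  refine ⟨C * ((√(2 * Real.pi * (L * (t₀ / 2))))⁻¹ * Real.exp (1 / (4 * L * t₀))),
    1 / (8 * L * t₀), by positivity, by positivity, fun t ht x x₀ hx z => ?_⟩
  have ht0 : 0 < t := lt_of_lt_of_le (by positivity) ht.1
  have h1 : gk (L * t) (x - z) ≤ (√(2 * Real.pi * (L * (t₀ / 2))))⁻¹ * Real.exp (1 / (4 * L * t₀))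
      * Real.exp (-(1 / (8 * L * t₀)) * (z - x₀) ^ 2) := by
    unfold gk
    rw [mul_assoc (√(2 * Real.pi * (L * (t₀ / 2))))⁻¹, ← Real.exp_add]
    have h2 := ht.1
    have h3 := ht.2
    have h4 : -(x - z) ^ 2 / (2 * (L * t)) ≤ 1 / (4 * L * t₀) + -(1 / (8 * L * t₀)) * (z - x₀) ^ 2 := by
      have h5 : (z - x₀) ^ 2 ≤ 2 * (x - z) ^ 2 + 2 := by
        have : (x - x₀) ^ 2 ≤ 1 := by rw [← sq_abs]; nlinarith [abs_nonneg (x - x₀)]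
        nlinarith [sq_nonneg (z - x + (x - x₀)), sq_nonneg ((z - x) - (x - x₀))]
      have h6 : -(x - z) ^ 2 / (2 * (L * t)) ≤ -(x - z) ^ 2 / (4 * L * t₀) := by
        rw [neg_div, neg_div, neg_le_neg_iff]
        exact div_le_div_of_nonneg_left (sq_nonneg _) (by positivity) (by nlinarith)
      have h7 : 1 / (4 * L * t₀) + -(1 / (8 * L * t₀)) * (z - x₀) ^ 2
          = (1 - (z - x₀) ^ 2 / 2) / (4 * L * t₀) := by field_simp; ring
      rw [h7]
      refine h6.trans ?_
      gcongr
      linarith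
    gcongr
  calc _ ≤ C * ((√(2 * Real.pi * (L * (t₀ / 2))))⁻¹ * Real.exp (1 / (4 * L * t₀))
      * Real.exp (-(1 / (8 * L * t₀)) * (z - x₀) ^ 2)) := by
        gcongr
        · exact gk_nonneg _ _
        · exact hb t ht
    _ = _ := by ring

lemma KBd.lgau {L θ m : ℝ} (hL : 0 < L) {f : ℝ → ℝ → ℝ → ℝ} (h : KBd L θ m f) : LGau f := by
  obtain ⟨C, hC, hb⟩ := h
  intro τ₀ hτ₀ x₀
  obtain ⟨D, ρ, hD, hρ, h1⟩ := exists_gauss_le hL (θ - 1) m hτ₀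
  refine ⟨C * D, ρ, hρ, fun τ hτ x hx z => ?_⟩
  have hτ0 : 0 < τ := lt_of_lt_of_le (by positivity) hτ.1
  rw [mul_assoc]
  exact (hb τ hτ0 x z).trans (mul_le_mul_of_nonneg_left (h1 τ hτ x x₀ hx z) hC)

lemma KBd.lbdd {L θ m : ℝ} (hL : 0 < L) {f : ℝ → ℝ → ℝ → ℝ} (h : KBd L θ m f) : LBdd f := by
  obtain ⟨C, hC, hb⟩ := h
  intro τ₀ hτ₀ y₀
  obtain ⟨D, ρ, hD, hρ, h1⟩ := exists_gauss_le hL (θ - 1) m hτ₀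
  refine ⟨C * D, fun τ hτ y hy z => ?_⟩
  have hτ0 : 0 < τ := lt_of_lt_of_le (by positivity) hτ.1
  have h2 := hb τ hτ0 z y
  have h3 := h1 τ hτ y y₀ hy z
  rw [gk_sub_comm] at h2
  have h4 : Real.exp (-ρ * (z - y₀) ^ 2) ≤ 1 := by
    rw [Real.exp_le_one_iff]; nlinarith [sq_nonneg (z - y₀)]
  refine h2.trans ?_
  gcongr
  nlinarith

lemma KBd.div_time {L θ m : ℝ} {f : ℝ → ℝ → ℝ → ℝ} (h : KBd L θ m f) :
    KBd L (θ - 1) m (fun t x y => f t x y / t) := by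
  obtain ⟨C, hC, hb⟩ := h
  refine ⟨C, hC, fun t ht x y => ?_⟩
  rw [abs_div, abs_of_pos ht, div_le_iff₀ ht]
  refine (hb t ht x y).trans (le_of_eq ?_)
  rw [Real.rpow_sub_one ht.ne' (θ - 1)]
  field_simp

lemma KC.div_time {f : ℝ → ℝ → ℝ → ℝ} (h : KC f) : KC (fun t x y => f t x y / t) :=
  ContinuousOn.div h continuousOn_fst (fun _ hp => ne_of_gt hp.1)

/-- Spatial composition of two kernels. -/
def scomp (k f : ℝ → ℝ → ℝ → ℝ) (τ s x y : ℝ) : ℝ := ∫ z, k τ x z * f s z y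

lemma integrable_exp_sq {ρ : ℝ} (hρ : 0 < ρ) (x₀ C : ℝ) :
    Integrable (fun z : ℝ => C * Real.exp (-ρ * (z - x₀) ^ 2)) :=
  ((integrable_exp_neg_mul_sq hρ).comp_sub_right x₀).const_mul C

lemma KC.continuous_right {k : ℝ → ℝ → ℝ → ℝ} (hk : KC k) {τ : ℝ} (hτ : 0 < τ) (x : ℝ) :
    Continuous (fun z => k τ x z) := by
  rw [← continuousOn_univ]
  exact ContinuousOn.comp hk (f := fun z => (τ, x, z)) (by fun_prop)
    (fun z _ => ⟨hτ, mem_univ _⟩)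

lemma KC.continuous_left {k : ℝ → ℝ → ℝ → ℝ} (hk : KC k) {τ : ℝ} (hτ : 0 < τ) (y : ℝ) :
    Continuous (fun z => k τ z y) := by
  rw [← continuousOn_univ]
  exact ContinuousOn.comp hk (f := fun z => (τ, z, y)) (by fun_prop)
    (fun z _ => ⟨hτ, mem_univ _⟩)

lemma KC.continuousAt {k : ℝ → ℝ → ℝ → ℝ} (hk : KC k) {τ : ℝ} (hτ : 0 < τ) (x z : ℝ) :
    ContinuousAt (fun p : ℝ × ℝ × ℝ => k p.1 p.2.1 p.2.2) (τ, x, z) :=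
  ContinuousOn.continuousAt hk ((isOpen_Ioi.prod isOpen_univ).mem_nhds ⟨hτ, mem_univ _⟩)

lemma mem_Icc_half {t : ℝ} (ht : 0 < t) : t ∈ Ioo (t / 2) (2 * t) :=
  ⟨by linarith, by linarith⟩

lemma integrable_scomp {k f : ℝ → ℝ → ℝ → ℝ} (hk : KC k) (hk' : LGau k) (hf : KC f)
    (hf' : LBdd f) {τ s : ℝ} (hτ : 0 < τ) (hs : 0 < s) (x y : ℝ) :
    Integrable (fun z => k τ x z * f s z y) := by
  obtain ⟨C, ρ, hρ, h1⟩ := hk' τ hτ x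
  obtain ⟨D, h2⟩ := hf' s hs y
  refine (integrable_exp_sq hρ x (C * D)).mono'
    ((hk.continuous_right hτ x).mul (hf.continuous_left hs y)).aestronglyMeasurable
    (Eventually.of_forall fun z => ?_)
  have a := h1 τ (Ioo_subset_Icc_self (mem_Icc_half hτ)) x (by simp) z
  have b := h2 s (Ioo_subset_Icc_self (mem_Icc_half hs)) y (by simp) z
  rw [norm_mul, Real.norm_eq_abs, Real.norm_eq_abs]
  calc _ ≤ C * Real.exp (-ρ * (z - x) ^ 2) * D :=
        mul_le_mul a b (abs_nonneg _) ((abs_nonneg _).trans a)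
    _ = _ := by ring

/-- Gaussian domination is asked of the left factor only. The right factor is merely locally
bounded, so that a bounded initial datum can take its place. -/
lemma scomp_continuousOn {k f : ℝ → ℝ → ℝ → ℝ} (hk : KC k) (hk' : LGau k) (hf : KC f)
    (hf' : LBdd f) : ContinuousOn (fun p : ℝ × ℝ × ℝ × ℝ => scomp k f p.1 p.2.1 p.2.2.1 p.2.2.2)
      (Ioi 0 ×ˢ Ioi 0 ×ˢ univ) := by
  rintro ⟨τ, s, x, y⟩ ⟨hτ, hs, -⟩
  apply ContinuousAt.continuousWithinAt
  simp only [mem_Ioi] at hτ hs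
  obtain ⟨C, ρ, hρ, h1⟩ := hk' τ hτ x
  obtain ⟨D, h2⟩ := hf' s hs y
  have hev : ∀ᶠ p : ℝ × ℝ × ℝ × ℝ in 𝓝 (τ, s, x, y), p.1 ∈ Ioo (τ / 2) (2 * τ) ∧
      p.2.1 ∈ Ioo (s / 2) (2 * s) ∧ |p.2.2.1 - x| < 1 ∧ |p.2.2.2 - y| < 1 := by
    refine Filter.Eventually.and ?_ (Filter.Eventually.and ?_ (Filter.Eventually.and ?_ ?_))
    · exact continuousAt_fst.eventually (isOpen_Ioo.mem_nhds (mem_Icc_half hτ))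
    · exact (continuous_fst.comp continuous_snd).continuousAt.eventually
        (isOpen_Ioo.mem_nhds (mem_Icc_half hs))
    · exact ContinuousAt.eventually_lt (by fun_prop) continuousAt_const (by simp)
    · exact ContinuousAt.eventually_lt (by fun_prop) continuousAt_const (by simp)
  refine continuousAt_of_dominated (bound := fun z => C * D * Real.exp (-ρ * (z - x) ^ 2)) ?_ ?_
    (integrable_exp_sq hρ x (C * D)) ?_
  · filter_upwards [hev] with p hp
    exact ((hk.continuous_right (lt_trans (by positivity) hp.1.1) _).mul
      (hf.continuous_left (lt_trans (by positivity) hp.2.1.1) _)).aestronglyMeasurable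
  · filter_upwards [hev] with p hp
    refine Eventually.of_forall fun z => ?_
    have a := h1 p.1 (Ioo_subset_Icc_self hp.1) p.2.2.1 hp.2.2.1.le z
    have b := h2 p.2.1 (Ioo_subset_Icc_self hp.2.1) p.2.2.2 hp.2.2.2.le z
    rw [norm_mul, Real.norm_eq_abs, Real.norm_eq_abs]
    calc _ ≤ C * Real.exp (-ρ * (z - x) ^ 2) * D :=
          mul_le_mul a b (abs_nonneg _) ((abs_nonneg _).trans a)
      _ = _ := by ring
  · refine Eventually.of_forall fun z => ?_
    exact (ContinuousAt.comp (x := (τ, s, x, y)) (f := fun p : ℝ × ℝ × ℝ × ℝ => (p.1, p.2.2.1, z))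
      (hk.continuousAt hτ x z) (by fun_prop)).mul (ContinuousAt.comp (x := (τ, s, x, y))
      (f := fun p : ℝ × ℝ × ℝ × ℝ => (p.2.1, z, p.2.2.2)) (hf.continuousAt hs z y) (by fun_prop))

/-- Differentiation of a spatial composition along an affine curve of times. -/
lemma hasDerivAt_scomp_time {k kd f fd : ℝ → ℝ → ℝ → ℝ} (hk : KC k) (hk' : LGau k) (hkd : KC kd)
    (hkd' : LGau kd) (hf : KC f) (hf' : LBdd f) (hfd : KC fd) (hfd' : LBdd fd)
    (dk : ∀ t > 0, ∀ x z, HasDerivAt (fun s => k s x z) (kd t x z) t)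
    (df : ∀ t > 0, ∀ z y, HasDerivAt (fun s => f s z y) (fd t z y) t)
    (p q p' q' : ℝ) {r : ℝ} (hτ : 0 < p + q * r) (hs : 0 < p' + q' * r) (x y : ℝ) :
    HasDerivAt (fun r => scomp k f (p + q * r) (p' + q' * r) x y)
      (q * scomp kd f (p + q * r) (p' + q' * r) x y
        + q' * scomp k fd (p + q * r) (p' + q' * r) x y) r := by
  obtain ⟨C1, ρ1, hρ1, b1⟩ := hk' _ hτ x
  obtain ⟨C2, ρ2, hρ2, b2⟩ := hkd' _ hτ x
  obtain ⟨D1, b3⟩ := hf' _ hs y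
  obtain ⟨D2, b4⟩ := hfd' _ hs y
  have hS : {r' : ℝ | p + q * r' ∈ Ioo ((p + q * r) / 2) (2 * (p + q * r)) ∧
      p' + q' * r' ∈ Ioo ((p' + q' * r) / 2) (2 * (p' + q' * r))} ∈ 𝓝 r := by
    refine Filter.inter_mem ?_ ?_
    · exact (show ContinuousAt (fun r' => p + q * r') r by fun_prop).preimage_mem_nhds
        (isOpen_Ioo.mem_nhds (mem_Icc_half hτ))
    · exact (show ContinuousAt (fun r' => p' + q' * r') r by fun_prop).preimage_mem_nhds
        (isOpen_Ioo.mem_nhds (mem_Icc_half hs))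
  have key := hasDerivAt_integral_of_dominated_loc_of_deriv_le (μ := (volume : Measure ℝ))
    (F := fun r' z => k (p + q * r') x z * f (p' + q' * r') z y)
    (F' := fun r' z => q * (kd (p + q * r') x z * f (p' + q' * r') z y)
      + q' * (k (p + q * r') x z * fd (p' + q' * r') z y))
    (bound := fun z => |q| * (C2 * D1) * Real.exp (-ρ2 * (z - x) ^ 2)
      + |q'| * (C1 * D2) * Real.exp (-ρ1 * (z - x) ^ 2)) hS ?_ ?_ ?_ ?_ ?_ ?_
  · refine key.2.congr_deriv ?_
    rw [integral_add, integral_const_mul, integral_const_mul]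
    · rfl
    · exact (integrable_scomp hkd hkd' hf hf' hτ hs x y).const_mul q
    · exact (integrable_scomp hk hk' hfd hfd' hτ hs x y).const_mul q'
  · filter_upwards [hS] with r' hr
    exact ((hk.continuous_right (lt_trans (by positivity) hr.1.1) _).mul
      (hf.continuous_left (lt_trans (by positivity) hr.2.1) _)).aestronglyMeasurable
  · exact integrable_scomp hk hk' hf hf' hτ hs x y
  · exact (((integrable_scomp hkd hkd' hf hf' hτ hs x y).const_mul q).add
      ((integrable_scomp hk hk' hfd hfd' hτ hs x y).const_mul q')).aestronglyMeasurable
  · refine Eventually.of_forall fun z r' hr => ?_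
    have a1 := b1 _ (Ioo_subset_Icc_self hr.1) x (by simp) z
    have a2 := b2 _ (Ioo_subset_Icc_self hr.1) x (by simp) z
    have a3 := b3 _ (Ioo_subset_Icc_self hr.2) y (by simp) z
    have a4 := b4 _ (Ioo_subset_Icc_self hr.2) y (by simp) z
    rw [Real.norm_eq_abs]
    refine (abs_add_le _ _).trans ?_
    rw [abs_mul, abs_mul, abs_mul, abs_mul]
    have m1 := mul_le_mul a2 a3 (abs_nonneg _) ((abs_nonneg _).trans a2)
    have m2 := mul_le_mul a1 a4 (abs_nonneg _) ((abs_nonneg _).trans a1)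
    have n1 := mul_le_mul_of_nonneg_left m1 (abs_nonneg q)
    have n2 := mul_le_mul_of_nonneg_left m2 (abs_nonneg q')
    linarith
  · exact (integrable_exp_sq hρ2 x _).add (integrable_exp_sq hρ1 x _)
  · refine Eventually.of_forall fun z r' hr => ?_
    have e1 := (dk (p + q * r') (lt_trans (by positivity) hr.1.1) x z).comp r'
      (((hasDerivAt_id r').const_mul q).const_add p)
    have e2 := (df (p' + q' * r') (lt_trans (by positivity) hr.2.1) z y).comp r'
      (((hasDerivAt_id r').const_mul q').const_add p')
    refine (e1.mul e2).congr_deriv ?_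
    simp only [Function.comp, id]
    ring

lemma hasDerivAt_scomp_space {k kx f : ℝ → ℝ → ℝ → ℝ} (hk : KC k) (hk' : LGau k) (hkx : KC kx)
    (hkx' : LGau kx) (hf : KC f) (hf' : LBdd f)
    (dk : ∀ t > 0, ∀ x z, HasDerivAt (fun x' => k t x' z) (kx t x z) x)
    {τ s : ℝ} (hτ : 0 < τ) (hs : 0 < s) (x y : ℝ) :
    HasDerivAt (fun x' => scomp k f τ s x' y) (scomp kx f τ s x y) x := by
  obtain ⟨C2, ρ2, hρ2, b2⟩ := hkx' _ hτ x
  obtain ⟨D1, b3⟩ := hf' _ hs y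
  have hS : {x' : ℝ | |x' - x| < 1} ∈ 𝓝 x := by
    refine ContinuousAt.eventually_lt (f := fun x' => |x' - x|) (by fun_prop) continuousAt_const
      (by simp)
  refine (hasDerivAt_integral_of_dominated_loc_of_deriv_le (μ := (volume : Measure ℝ))
    (F := fun x' z => k τ x' z * f s z y)
    (F' := fun x' z => kx τ x' z * f s z y)
    (bound := fun z => C2 * D1 * Real.exp (-ρ2 * (z - x) ^ 2)) hS ?_ ?_ ?_ ?_ ?_ ?_).2
  · exact Eventually.of_forall fun x' => ((hk.continuous_right hτ _).mul
      (hf.continuous_left hs _)).aestronglyMeasurable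
  · exact integrable_scomp hk hk' hf hf' hτ hs x y
  · exact (integrable_scomp hkx hkx' hf hf' hτ hs x y).aestronglyMeasurable
  · refine Eventually.of_forall fun z x' hx => ?_
    have a1 := b2 τ (Ioo_subset_Icc_self (mem_Icc_half hτ)) x' (le_of_lt hx) z
    have a2 := b3 s (Ioo_subset_Icc_self (mem_Icc_half hs)) y (by simp) z
    rw [norm_mul, Real.norm_eq_abs, Real.norm_eq_abs]
    have := mul_le_mul a1 a2 (abs_nonneg _) ((abs_nonneg _).trans a1)
    linarith
  · exact integrable_exp_sq hρ2 x _
  · exact Eventually.of_forall fun z x' _ => (dk τ hτ x' z).mul_const _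

/-- A general bound for spatial compositions. -/
lemma abs_scomp_le {k f : ℝ → ℝ} {g h : ℝ → ℝ} {A B G : ℝ}
    (hk : ∀ z, |k z| ≤ A * g z) (hf : ∀ z, |f z| ≤ B * h z)
    (hi : Integrable (fun z => g z * h z)) (hG : ∫ z, g z * h z = G) :
    |∫ z, k z * f z| ≤ A * B * G := by
  have := norm_integral_le_of_norm_le (hi.const_mul (A * B)) (f := fun z => k z * f z)
    (Eventually.of_forall fun z => by
      rw [norm_mul, Real.norm_eq_abs, Real.norm_eq_abs]
      have := mul_le_mul (hk z) (hf z) (abs_nonneg _) ((abs_nonneg _).trans (hk z))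
      linarith)
  rwa [integral_const_mul, hG, Real.norm_eq_abs] at this

/-! ### Beta integrals and space-time convolution -/

/-- On each half of the interval the factor whose singularity lies in the other half is at most `2`.
-/
lemma beta_le {a b σ : ℝ} (ha : 0 < a) (hb : 0 < b) (hσ : σ ∈ Ioo (0 : ℝ) 1) :
    (1 - σ) ^ (a - 1) * σ ^ (b - 1) ≤ 2 * (1 - σ) ^ (a - 1) + 2 * σ ^ (b - 1) := by
  have aux : ∀ r c : ℝ, 0 < c → 1 / 2 ≤ r → r ≤ 1 → r ^ (c - 1) ≤ 2 := by
    intro r c hc h1 h2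
    rcases le_total 1 c with h | h
    · exact (Real.rpow_le_one (by linarith) h2 (by linarith)).trans (by norm_num)
    · calc r ^ (c - 1) ≤ (1 / 2 : ℝ) ^ (c - 1) :=
            Real.rpow_le_rpow_of_nonpos (by norm_num) h1 (by linarith)
        _ ≤ (1 / 2 : ℝ) ^ (-1 : ℝ) :=
            Real.rpow_le_rpow_of_exponent_ge (by norm_num) (by norm_num) (by linarith)
        _ = 2 := by rw [Real.rpow_neg_one]; norm_num
  have h1 : 0 < σ := hσ.1
  have h2 : 0 < 1 - σ := by linarith [hσ.2]
  have n1 : 0 < (1 - σ) ^ (a - 1) := by positivity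
  have n2 : 0 < σ ^ (b - 1) := by positivity
  rcases le_total σ (1 / 2) with h | h
  · have := aux (1 - σ) a ha (by linarith) (by linarith)
    nlinarith
  · have := aux σ b hb h (by linarith [hσ.2])
    nlinarith

lemma integrableOn_rpow_sub_one {b : ℝ} (hb : 0 < b) :
    IntegrableOn (fun σ : ℝ => σ ^ (b - 1)) (Ioo 0 1) := by
  have := intervalIntegral.intervalIntegrable_rpow' (a := 0) (b := 1) (r := b - 1) (by linarith)
  rw [intervalIntegrable_iff_integrableOn_Ioo_of_le zero_le_one] at this
  exact this

lemma integrableOn_one_sub_rpow_sub_one {a : ℝ} (ha : 0 < a) :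
    IntegrableOn (fun σ : ℝ => (1 - σ) ^ (a - 1)) (Ioo 0 1) := by
  have := (intervalIntegral.intervalIntegrable_rpow' (a := 0) (b := 1) (r := a - 1)
    (by linarith)).comp_sub_left 1
  simp only [sub_zero, sub_self] at this
  rw [← intervalIntegrable_iff_integrableOn_Ioo_of_le zero_le_one]
  exact this.symm

lemma integrableOn_beta {a b : ℝ} (ha : 0 < a) (hb : 0 < b) :
    IntegrableOn (fun σ : ℝ => (1 - σ) ^ (a - 1) * σ ^ (b - 1)) (Ioo 0 1) := by
  refine Integrable.mono' (((integrableOn_one_sub_rpow_sub_one ha).const_mul 2).add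
    ((integrableOn_rpow_sub_one hb).const_mul 2)) ?_ ?_
  · exact ((integrableOn_one_sub_rpow_sub_one ha).aestronglyMeasurable).mul
      (integrableOn_rpow_sub_one hb).aestronglyMeasurable
  · filter_upwards [ae_restrict_mem measurableSet_Ioo] with σ hσ
    have h1 : 0 < σ := hσ.1
    have h2 : 0 < 1 - σ := by linarith [hσ.2]
    rw [Real.norm_eq_abs, abs_of_pos (by positivity)]
    exact beta_le ha hb hσ

/-- Space-time convolution of two kernels. -/
def conv (k f : ℝ → ℝ → ℝ → ℝ) (t x y : ℝ) : ℝ :=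
  t * ∫ σ in Ioo (0 : ℝ) 1, scomp k f (t * (1 - σ)) (t * σ) x y

/-- A continuous kernel with Gaussian bounds. -/
structure GK (L θ m : ℝ) (f : ℝ → ℝ → ℝ → ℝ) : Prop where
  cont : KC f
  bd : KBd L θ m f

lemma mul_one_sub_pos {t σ : ℝ} (ht : 0 < t) (hσ : σ ∈ Ioo (0 : ℝ) 1) : 0 < t * (1 - σ) :=
  mul_pos ht (by linarith [hσ.2])

lemma mul_Ioo_pos {t σ : ℝ} (ht : 0 < t) (hσ : σ ∈ Ioo (0 : ℝ) 1) : 0 < t * σ := mul_pos ht hσ.1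

lemma rpow_scale {t σ : ℝ} (ht : 0 < t) (hσ : σ ∈ Ioo (0 : ℝ) 1) (a b m : ℝ) :
    (t * (1 - σ)) ^ (a - 1) * Real.exp (m * (t * (1 - σ)))
      * ((t * σ) ^ (b - 1) * Real.exp (m * (t * σ)))
      = t ^ (a + b - 2) * Real.exp (m * t) * ((1 - σ) ^ (a - 1) * σ ^ (b - 1)) := by
  have h1 : 0 ≤ 1 - σ := by linarith [hσ.2]
  rw [Real.mul_rpow ht.le h1, Real.mul_rpow ht.le hσ.1.le, mul_mul_mul_comm, ← Real.exp_add,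
    show a + b - 2 = (a - 1) + (b - 1) by ring, Real.rpow_add ht]
  have : m * (t * (1 - σ)) + m * (t * σ) = m * t := by ring
  rw [this]; ring

lemma scale_add (L t σ : ℝ) : L * (t * (1 - σ)) + L * (t * σ) = L * t := by ring

/-- The two times add up to `t`, so the Gaussian factors compose exactly to the one at time `t` with
the same `L`. Only the Beta integrand depends on `σ`. -/
lemma abs_scomp_scale_le {L a b m A B : ℝ} (hL : 0 < L) {k f : ℝ → ℝ → ℝ → ℝ}
    (hk : ∀ t > 0, ∀ x y, |k t x y| ≤ A * (t ^ (a - 1) * Real.exp (m * t) * gk (L * t) (x - y)))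
    (hf : ∀ t > 0, ∀ x y, |f t x y| ≤ B * (t ^ (b - 1) * Real.exp (m * t) * gk (L * t) (x - y)))
    {t σ : ℝ} (ht : 0 < t) (hσ : σ ∈ Ioo (0 : ℝ) 1) (x y : ℝ) :
    |scomp k f (t * (1 - σ)) (t * σ) x y|
      ≤ A * B * (t ^ (a + b - 2) * Real.exp (m * t) * gk (L * t) (x - y))
        * ((1 - σ) ^ (a - 1) * σ ^ (b - 1)) := by
  have h1 := mul_one_sub_pos ht hσ
  have h2 := mul_Ioo_pos ht hσ
  have hi := integrable_gk_mul_gk (mul_pos hL h1) (mul_pos hL h2) x y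
  have hI := integral_gk_mul_gk (mul_pos hL h1) (mul_pos hL h2) x y
  rw [scale_add] at hI
  have := abs_scomp_le (k := fun z => k (t * (1 - σ)) x z) (f := fun z => f (t * σ) z y)
    (A := A * ((t * (1 - σ)) ^ (a - 1) * Real.exp (m * (t * (1 - σ)))))
    (B := B * ((t * σ) ^ (b - 1) * Real.exp (m * (t * σ))))
    (fun z => (hk _ h1 x z).trans_eq (mul_assoc _ _ _).symm)
    (fun z => (hf _ h2 z y).trans_eq (mul_assoc _ _ _).symm) hi hI
  refine this.trans_eq ?_
  rw [mul_mul_mul_comm A, rpow_scale ht hσ]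
  ring

lemma integrableOn_scomp {L a b m : ℝ} (hL : 0 < L) (ha : 0 < a) (hb : 0 < b)
    {k f : ℝ → ℝ → ℝ → ℝ} (hk : GK L a m k) (hf : GK L b m f) {t : ℝ} (ht : 0 < t) (x y : ℝ) :
    IntegrableOn (fun σ => scomp k f (t * (1 - σ)) (t * σ) x y) (Ioo 0 1) := by
  obtain ⟨A, hA, hk1⟩ := hk.bd
  obtain ⟨B, hB, hf1⟩ := hf.bd
  have hc : ContinuousOn (fun σ => scomp k f (t * (1 - σ)) (t * σ) x y) (Ioo 0 1) := by
    refine (scomp_continuousOn hk.cont (hk.bd.lgau hL) hf.cont (hf.bd.lbdd hL)).comp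
      (f := fun σ => (t * (1 - σ), t * σ, x, y)) (by fun_prop) ?_
    intro σ hσ
    exact ⟨mul_one_sub_pos ht hσ, mul_Ioo_pos ht hσ, mem_univ _⟩
  refine Integrable.mono' ((integrableOn_beta ha hb).const_mul
    (A * B * (t ^ (a + b - 2) * Real.exp (m * t) * gk (L * t) (x - y)))) (hc.aestronglyMeasurable measurableSet_Ioo) ?_
  filter_upwards [ae_restrict_mem measurableSet_Ioo] with σ hσ
  exact abs_scomp_scale_le hL hk1 hf1 ht hσ x y

/-- The Beta integral. -/
def betaI (a b : ℝ) : ℝ := ∫ σ in Ioo (0 : ℝ) 1, (1 - σ) ^ (a - 1) * σ ^ (b - 1)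

lemma betaI_nonneg (a b : ℝ) : 0 ≤ betaI a b := by
  refine setIntegral_nonneg measurableSet_Ioo fun σ hσ => ?_
  have h1 : 0 < σ := hσ.1
  have h2 : 0 < 1 - σ := by linarith [hσ.2]
  positivity

lemma abs_time_integral_le {a b D t : ℝ} (ha : 0 < a) (hb : 0 < b) (ht : 0 < t) {S : ℝ → ℝ}
    (hS : ∀ σ ∈ Ioo (0 : ℝ) 1, |S σ| ≤ D * (t ^ (a + b - 2) * ((1 - σ) ^ (a - 1) * σ ^ (b - 1)))) :
    |t * ∫ σ in Ioo (0 : ℝ) 1, S σ| ≤ betaI a b * D * t ^ (a + b - 1) := by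
  have := norm_integral_le_of_norm_le ((integrableOn_beta ha hb).const_mul (D * t ^ (a + b - 2)))
    (f := S) (by
      filter_upwards [ae_restrict_mem measurableSet_Ioo] with σ hσ
      rw [Real.norm_eq_abs]
      exact (hS σ hσ).trans_eq (by ring))
  rw [integral_const_mul, Real.norm_eq_abs] at this
  rw [abs_mul, abs_of_pos ht]
  calc _ ≤ t * (D * t ^ (a + b - 2) * betaI a b) := by gcongr; exact this
    _ = betaI a b * D * (t ^ (a + b - 2) * t) := by ring
    _ = _ := by
      rw [← Real.rpow_add_one ht.ne']
      ring_nf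

lemma KBd.conv {L a b m : ℝ} (hL : 0 < L) (ha : 0 < a) (hb : 0 < b) {k f : ℝ → ℝ → ℝ → ℝ}
    (hk : KBd L a m k) (hf : KBd L b m f) : KBd L (a + b) m (conv k f) := by
  obtain ⟨A, hA, hk1⟩ := hk
  obtain ⟨B, hB, hf1⟩ := hf
  refine ⟨betaI a b * (A * B), mul_nonneg (betaI_nonneg _ _) (by positivity), fun t ht x y => ?_⟩
  have := abs_time_integral_le (D := A * B * (Real.exp (m * t) * gk (L * t) (x - y))) ha hb ht
    (S := fun σ => scomp k f (t * (1 - σ)) (t * σ) x y) (fun σ hσ =>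
      (abs_scomp_scale_le hL hk1 hf1 ht hσ x y).trans_eq (by ring))
  exact this.trans_eq (by ring)

lemma KC.conv {L a b m : ℝ} (hL : 0 < L) (ha : 0 < a) (hb : 0 < b) {k f : ℝ → ℝ → ℝ → ℝ}
    (hk : GK L a m k) (hf : GK L b m f) : KC (conv k f) := by
  obtain ⟨A, hA, hk1⟩ := hk.bd
  obtain ⟨B, hB, hf1⟩ := hf.bd
  rintro ⟨t, x, y⟩ ⟨ht, -⟩
  simp only [mem_Ioi] at ht
  apply ContinuousAt.continuousWithinAt
  refine continuousAt_fst.mul ?_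
  obtain ⟨C, ρ, hC, hρ, hgauss⟩ := exists_gauss_le hL (a + b - 2) m ht
  have hev : ∀ᶠ p : ℝ × ℝ × ℝ in 𝓝 (t, x, y), p.1 ∈ Ioo (t / 2) (2 * t) :=
    continuousAt_fst.eventually (isOpen_Ioo.mem_nhds (mem_Icc_half ht))
  have hsc := scomp_continuousOn hk.cont (hk.bd.lgau hL) hf.cont (hf.bd.lbdd hL)
  refine continuousAt_of_dominated
    (bound := fun σ => A * B * C * ((1 - σ) ^ (a - 1) * σ ^ (b - 1))) ?_ ?_
    ((integrableOn_beta ha hb).const_mul _) ?_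
  · filter_upwards [hev] with p hp
    exact (integrableOn_scomp hL ha hb hk hf (lt_trans (by positivity) hp.1) _ _).aestronglyMeasurable
  · filter_upwards [hev] with p hp
    filter_upwards [ae_restrict_mem measurableSet_Ioo] with σ hσ
    refine (abs_scomp_scale_le hL hk1 hf1 (lt_trans (by positivity) hp.1) hσ _ _).trans ?_
    have h1 := hgauss p.1 (Ioo_subset_Icc_self hp) p.2.1 p.2.1 (by simp) p.2.2
    have h2 : Real.exp (-ρ * (p.2.2 - p.2.1) ^ 2) ≤ 1 := by
      rw [Real.exp_le_one_iff]; nlinarith [sq_nonneg (p.2.2 - p.2.1)]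
    have h3 : 0 < σ := hσ.1
    have h4 : 0 < 1 - σ := by linarith [hσ.2]
    gcongr
    nlinarith
  · filter_upwards [ae_restrict_mem measurableSet_Ioo] with σ hσ
    refine ContinuousAt.comp (x := (t, x, y))
      (f := fun p : ℝ × ℝ × ℝ => (p.1 * (1 - σ), p.1 * σ, p.2.1, p.2.2))
      (hsc.continuousAt ((isOpen_Ioi.prod (isOpen_Ioi.prod isOpen_univ)).mem_nhds
        ⟨mul_one_sub_pos ht hσ, mul_Ioo_pos ht hσ, mem_univ _⟩)) (by fun_prop)

lemma GK.conv {L a b m : ℝ} (hL : 0 < L) (ha : 0 < a) (hb : 0 < b) {k f : ℝ → ℝ → ℝ → ℝ}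
    (hk : GK L a m k) (hf : GK L b m f) : GK L (a + b) m (conv k f) :=
  ⟨KC.conv hL ha hb hk hf, KBd.conv hL ha hb hk.bd hf.bd⟩

/-- `Df` is `t ∂_t f`. -/
def HasTimeDeriv (f Df : ℝ → ℝ → ℝ → ℝ) : Prop :=
  ∀ t > 0, ∀ x y, HasDerivAt (fun s => f s x y) (Df t x y / t) t

/-- On the fixed interval of `σ`, the chain rule factors `1-σ` and `σ` combine with the derivatives
at times `t(1-σ)` and `tσ` to form exactly `t ∂_t` of each factor; the first summand comes from the
prefactor `t`. No endpoint term and no stronger singularity appears. -/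
lemma hasTimeDeriv_conv {L a b m : ℝ} (hL : 0 < L) (ha : 0 < a) (hb : 0 < b)
    {k Dk f Df : ℝ → ℝ → ℝ → ℝ} (hk : GK L a m k) (hDk : GK L a m Dk) (hf : GK L b m f)
    (hDf : GK L b m Df) (dk : HasTimeDeriv k Dk) (df : HasTimeDeriv f Df) :
    HasTimeDeriv (conv k f) (fun t x y => conv k f t x y + conv Dk f t x y + conv k Df t x y) := by
  intro t ht x y
  obtain ⟨A1, hA1, hk1⟩ := hDk.bd
  obtain ⟨B1, hB1, hf1⟩ := hf.bd
  obtain ⟨A2, hA2, hk2⟩ := hk.bd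
  obtain ⟨B2, hB2, hf2⟩ := hDf.bd
  obtain ⟨C, ρ, hC, hρ, hgauss⟩ := exists_gauss_le hL (a + b - 2 - 1) m ht
  have key := hasDerivAt_integral_of_dominated_loc_of_deriv_le
    (μ := volume.restrict (Ioo (0 : ℝ) 1)) (s := Ioo (t / 2) (2 * t))
    (F := fun t' σ => scomp k f (t' * (1 - σ)) (t' * σ) x y)
    (F' := fun t' σ => (scomp Dk f (t' * (1 - σ)) (t' * σ) x y
      + scomp k Df (t' * (1 - σ)) (t' * σ) x y) / t')
    (bound := fun σ => (A1 * B1 + A2 * B2) * C * ((1 - σ) ^ (a - 1) * σ ^ (b - 1)))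
    (isOpen_Ioo.mem_nhds (mem_Icc_half ht)) ?_ ?_ ?_ ?_ ?_ ?_
  · have h2 := (hasDerivAt_id t).mul key.2
    refine h2.congr_deriv ?_
    have i1 := integrableOn_scomp hL ha hb hDk hf ht x y
    have i2 := integrableOn_scomp hL ha hb hk hDf ht x y
    rw [integral_div, integral_add i1 i2]
    simp only [id, _root_.conv]
    field_simp
    ring
  · filter_upwards [isOpen_Ioo.mem_nhds (mem_Icc_half ht)] with t' ht'
    exact (integrableOn_scomp hL ha hb hk hf (lt_trans (by positivity) ht'.1) _ _).aestronglyMeasurable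
  · exact integrableOn_scomp hL ha hb hk hf ht x y
  · exact (((integrableOn_scomp hL ha hb hDk hf ht x y).add
      (integrableOn_scomp hL ha hb hk hDf ht x y)).div_const t).aestronglyMeasurable
  · filter_upwards [ae_restrict_mem measurableSet_Ioo] with σ hσ
    intro t' ht'
    have ht0 : 0 < t' := lt_trans (by positivity) ht'.1
    have e1 := abs_scomp_scale_le hL hk1 hf1 ht0 hσ x y
    have e2 := abs_scomp_scale_le hL hk2 hf2 ht0 hσ x y
    have h1 := hgauss t' (Ioo_subset_Icc_self ht') x x (by simp) y
    have h2 : Real.exp (-ρ * (y - x) ^ 2) ≤ 1 := by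
      rw [Real.exp_le_one_iff]; nlinarith [sq_nonneg (y - x)]
    have h1' : t' ^ (a + b - 2) * Real.exp (m * t') * gk (L * t') (x - y) ≤ C * t' := by
      rw [Real.rpow_sub_one ht0.ne', div_mul_eq_mul_div, div_mul_eq_mul_div, div_le_iff₀ ht0] at h1
      refine h1.trans ?_
      gcongr
      nlinarith
    have h3 : 0 < σ := hσ.1
    have h4 : 0 < 1 - σ := by linarith [hσ.2]
    rw [Real.norm_eq_abs, abs_div, abs_of_pos ht0, div_le_iff₀ ht0]
    have e3 := abs_add_le (scomp Dk f (t' * (1 - σ)) (t' * σ) x y)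
      (scomp k Df (t' * (1 - σ)) (t' * σ) x y)
    calc _ ≤ (A1 * B1 + A2 * B2) * (t' ^ (a + b - 2) * Real.exp (m * t') * gk (L * t') (x - y))
          * ((1 - σ) ^ (a - 1) * σ ^ (b - 1)) := by linarith
      _ ≤ (A1 * B1 + A2 * B2) * (C * t') * ((1 - σ) ^ (a - 1) * σ ^ (b - 1)) := by gcongr
      _ = _ := by ring
  · exact (integrableOn_beta ha hb).const_mul _
  · filter_upwards [ae_restrict_mem measurableSet_Ioo] with σ hσ
    intro t' ht'
    have ht0 : 0 < t' := lt_trans (by positivity) ht'.1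
    have h1 := mul_one_sub_pos ht0 hσ
    have h2 := mul_Ioo_pos ht0 hσ
    have := hasDerivAt_scomp_time hk.cont (hk.bd.lgau hL) hDk.cont.div_time
      (hDk.bd.div_time.lgau hL) hf.cont (hf.bd.lbdd hL) hDf.cont.div_time
      (hDf.bd.div_time.lbdd hL) dk df 0 (1 - σ) 0 σ (r := t') (by linarith) (by linarith) x y
    have hfun : (fun r => scomp k f (r * (1 - σ)) (r * σ) x y)
        = fun r => scomp k f (0 + (1 - σ) * r) (0 + σ * r) x y := by
      funext r; simp only [zero_add, mul_comm]
    rw [hfun]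
    refine this.congr_deriv ?_
    rw [show 0 + (1 - σ) * t' = t' * (1 - σ) by ring, show 0 + σ * t' = t' * σ by ring]
    have e1 : scomp (fun t x y => Dk t x y / t) f (t' * (1 - σ)) (t' * σ) x y
        = scomp Dk f (t' * (1 - σ)) (t' * σ) x y / (t' * (1 - σ)) := by
      unfold scomp; rw [← integral_div]; congr 1; funext z; ring
    have e2 : scomp k (fun t x y => Df t x y / t) (t' * (1 - σ)) (t' * σ) x y
        = scomp k Df (t' * (1 - σ)) (t' * σ) x y / (t' * σ) := by
      unfold scomp; rw [← integral_div]; congr 1; funext z; ring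
    rw [e1, e2]
    have h3 : σ ≠ 0 := hσ.1.ne'
    have h4 : 1 - σ ≠ 0 := by linarith [hσ.2]
    field_simp

lemma hasDerivAt_conv_space {L a a' b m : ℝ} (hL : 0 < L) (ha : 0 < a) (ha' : 0 < a') (hb : 0 < b)
    {k kx f : ℝ → ℝ → ℝ → ℝ} (hk : GK L a m k) (hkx : GK L a' m kx) (hf : GK L b m f)
    (dk : ∀ t > 0, ∀ x z, HasDerivAt (fun x' => k t x' z) (kx t x z) x)
    {t : ℝ} (ht : 0 < t) (x y : ℝ) :
    HasDerivAt (fun x' => conv k f t x' y) (conv kx f t x y) x := by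
  obtain ⟨A, hA, hk1⟩ := hkx.bd
  obtain ⟨B, hB, hf1⟩ := hf.bd
  refine HasDerivAt.const_mul t ?_
  refine (hasDerivAt_integral_of_dominated_loc_of_deriv_le
    (μ := volume.restrict (Ioo (0 : ℝ) 1)) (s := univ)
    (F := fun x' σ => scomp k f (t * (1 - σ)) (t * σ) x' y)
    (F' := fun x' σ => scomp kx f (t * (1 - σ)) (t * σ) x' y)
    (bound := fun σ => A * B * (t ^ (a' + b - 2) * Real.exp (m * t) * (√(2 * Real.pi * (L * t)))⁻¹)
      * ((1 - σ) ^ (a' - 1) * σ ^ (b - 1))) univ_mem ?_ ?_ ?_ ?_ ?_ ?_).2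
  · exact Eventually.of_forall fun x' =>
      (integrableOn_scomp hL ha hb hk hf ht _ _).aestronglyMeasurable
  · exact integrableOn_scomp hL ha hb hk hf ht x y
  · exact (integrableOn_scomp hL ha' hb hkx hf ht x y).aestronglyMeasurable
  · filter_upwards [ae_restrict_mem measurableSet_Ioo] with σ hσ
    intro x' _
    refine (abs_scomp_scale_le hL hk1 hf1 ht hσ x' y).trans ?_
    have h3 : 0 < σ := hσ.1
    have h4 : 0 < 1 - σ := by linarith [hσ.2]
    gcongr
    exact gk_le (by positivity) _
  · exact (integrableOn_beta ha' hb).const_mul _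
  · filter_upwards [ae_restrict_mem measurableSet_Ioo] with σ hσ
    intro x' _
    exact hasDerivAt_scomp_space hk.cont (hk.bd.lgau hL) hkx.cont (hkx.bd.lgau hL) hf.cont
      (hf.bd.lbdd hL) dk (mul_one_sub_pos ht hσ) (mul_Ioo_pos ht hσ) x' y

/-- The increment falls on the left factor and lowers its time exponent to `a - κ/2`, which must
stay positive for the Beta integral to converge. In `KHy.conv` the right factor plays the same role.
-/
lemma KHx.conv {L a b m κ : ℝ} (hL : 0 < L) (ha : 0 < a) (ha' : 0 < a - κ / 2) (hb : 0 < b)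
    {k f : ℝ → ℝ → ℝ → ℝ} (hk : GK L a m k) (hkx : KHx L a m κ k) (hf : GK L b m f) :
    KHx L (a + b) m κ (conv k f) := by
  obtain ⟨A, hA, hk1⟩ := hkx
  obtain ⟨B, hB, hf1⟩ := hf.bd
  refine ⟨betaI (a - κ / 2) b * (A * B), mul_nonneg (betaI_nonneg _ _) (by positivity),
    fun t ht x x' y => ?_⟩
  unfold _root_.conv
  rw [← mul_sub, ← integral_sub (integrableOn_scomp hL ha hb hk hf ht x y)
    (integrableOn_scomp hL ha hb hk hf ht x' y)]
  have := abs_time_integral_le (D := A * B * (|x - x'| ^ κ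
    * (Real.exp (m * t) * (gk (L * t) (x - y) + gk (L * t) (x' - y))))) ha' hb ht
    (S := fun σ => scomp k f (t * (1 - σ)) (t * σ) x y - scomp k f (t * (1 - σ)) (t * σ) x' y) ?_
  · refine this.trans_eq ?_
    rw [show a - κ / 2 + b - 1 = a + b - 1 - κ / 2 by ring]
    ring
  · intro σ hσ
    have h1 := mul_one_sub_pos ht hσ
    have h2 := mul_Ioo_pos ht hσ
    have hi := integrable_gk_mul_gk (mul_pos hL h1) (mul_pos hL h2) x y
    have hI := integral_gk_mul_gk (mul_pos hL h1) (mul_pos hL h2) x y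
    have hi' := integrable_gk_mul_gk (mul_pos hL h1) (mul_pos hL h2) x' y
    have hI' := integral_gk_mul_gk (mul_pos hL h1) (mul_pos hL h2) x' y
    rw [scale_add] at hI hI'
    have hadd := integral_add hi hi'
    rw [hI, hI'] at hadd
    have := abs_scomp_le (k := fun z => k (t * (1 - σ)) x z - k (t * (1 - σ)) x' z)
      (f := fun z => f (t * σ) z y)
      (A := A * (|x - x'| ^ κ * ((t * (1 - σ)) ^ (a - κ / 2 - 1) * Real.exp (m * (t * (1 - σ))))))
      (B := B * ((t * σ) ^ (b - 1) * Real.exp (m * (t * σ))))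
      (g := fun z => gk (L * (t * (1 - σ))) (x - z) + gk (L * (t * (1 - σ))) (x' - z))
      (h := fun z => gk (L * (t * σ)) (z - y))
      (fun z => (hk1 _ h1 x x' z).trans_eq (by
        rw [show a - 1 - κ / 2 = a - κ / 2 - 1 by ring]; ring))
      (fun z => (hf1 _ h2 z y).trans_eq (mul_assoc _ _ _).symm)
      (by simp only [add_mul]; exact hi.add hi')
      (by simp only [add_mul]; exact hadd)
    unfold scomp
    rw [← integral_sub]
    · simp only [← sub_mul]
      refine this.trans_eq ?_
      rw [show a - κ / 2 + b - 2 = (a - κ / 2) + b - 2 by ring]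
      have := rpow_scale ht hσ (a - κ / 2) b m
      linear_combination (A * B * |x - x'| ^ κ * (gk (L * t) (x - y) + gk (L * t) (x' - y))) * this
    · exact integrable_scomp hk.cont (hk.bd.lgau hL) hf.cont (hf.bd.lbdd hL) h1 h2 x y
    · exact integrable_scomp hk.cont (hk.bd.lgau hL) hf.cont (hf.bd.lbdd hL) h1 h2 x' y

lemma KHy.conv {L a b m κ : ℝ} (hL : 0 < L) (ha : 0 < a) (hb : 0 < b) (hb' : 0 < b - κ / 2)
    {k f : ℝ → ℝ → ℝ → ℝ} (hk : GK L a m k) (hf : GK L b m f) (hfy : KHy L b m κ f) :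
    KHy L (a + b) m κ (conv k f) := by
  obtain ⟨A, hA, hk1⟩ := hk.bd
  obtain ⟨B, hB, hf1⟩ := hfy
  refine ⟨betaI a (b - κ / 2) * (A * B), mul_nonneg (betaI_nonneg _ _) (by positivity),
    fun t ht y y' x => ?_⟩
  unfold _root_.conv kswap
  rw [← mul_sub, ← integral_sub (integrableOn_scomp hL ha hb hk hf ht x y)
    (integrableOn_scomp hL ha hb hk hf ht x y')]
  have := abs_time_integral_le (D := A * B * (|y - y'| ^ κ
    * (Real.exp (m * t) * (gk (L * t) (y - x) + gk (L * t) (y' - x))))) ha hb' ht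
    (S := fun σ => scomp k f (t * (1 - σ)) (t * σ) x y - scomp k f (t * (1 - σ)) (t * σ) x y') ?_
  · refine this.trans_eq ?_
    rw [show a + (b - κ / 2) - 1 = a + b - 1 - κ / 2 by ring]
    ring
  · intro σ hσ
    have h1 := mul_one_sub_pos ht hσ
    have h2 := mul_Ioo_pos ht hσ
    have hi := integrable_gk_mul_gk (mul_pos hL h1) (mul_pos hL h2) x y
    have hI := integral_gk_mul_gk (mul_pos hL h1) (mul_pos hL h2) x y
    have hi' := integrable_gk_mul_gk (mul_pos hL h1) (mul_pos hL h2) x y'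
    have hI' := integral_gk_mul_gk (mul_pos hL h1) (mul_pos hL h2) x y'
    rw [scale_add] at hI hI'
    have hadd := integral_add hi hi'
    rw [hI, hI', gk_sub_comm _ x y, gk_sub_comm _ x y'] at hadd
    have := abs_scomp_le (k := fun z => k (t * (1 - σ)) x z)
      (f := fun z => f (t * σ) z y - f (t * σ) z y')
      (A := A * ((t * (1 - σ)) ^ (a - 1) * Real.exp (m * (t * (1 - σ)))))
      (B := B * (|y - y'| ^ κ * ((t * σ) ^ (b - κ / 2 - 1) * Real.exp (m * (t * σ)))))
      (g := fun z => gk (L * (t * (1 - σ))) (x - z))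
      (h := fun z => gk (L * (t * σ)) (z - y) + gk (L * (t * σ)) (z - y'))
      (fun z => (hk1 _ h1 x z).trans_eq (mul_assoc _ _ _).symm)
      (fun z => (hf1 _ h2 y y' z).trans_eq (by
        rw [show b - 1 - κ / 2 = b - κ / 2 - 1 by ring, gk_sub_comm _ y z, gk_sub_comm _ y' z]
        ring))
      (by simp only [mul_add]; exact hi.add hi')
      (by simp only [mul_add]; exact hadd)
    unfold scomp
    rw [← integral_sub]
    · simp only [← mul_sub]
      refine this.trans_eq ?_
      have := rpow_scale ht hσ a (b - κ / 2) m
      linear_combination (A * B * |y - y'| ^ κ * (gk (L * t) (y - x) + gk (L * t) (y' - x))) * this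
    · exact integrable_scomp hk.cont (hk.bd.lgau hL) hf.cont (hf.bd.lbdd hL) h1 h2 x y
    · exact integrable_scomp hk.cont (hk.bd.lgau hL) hf.cont (hf.bd.lbdd hL) h1 h2 x y'

/-! ### Contracting weights for the Volterra operator -/

lemma rpow_sub_one_le_two {r c : ℝ} (hc : 0 < c) (h1 : 1 / 2 ≤ r) (h2 : r ≤ 1) :
    r ^ (c - 1) ≤ 2 := by
  rcases le_total 1 c with h | h
  · exact (Real.rpow_le_one (by linarith) h2 (by linarith)).trans (by norm_num)
  · calc r ^ (c - 1) ≤ (1 / 2 : ℝ) ^ (c - 1) :=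
          Real.rpow_le_rpow_of_nonpos (by norm_num) h1 (by linarith)
      _ ≤ (1 / 2 : ℝ) ^ (-1 : ℝ) :=
          Real.rpow_le_rpow_of_exponent_ge (by norm_num) (by norm_num) (by linarith)
      _ = 2 := by rw [Real.rpow_neg_one]; norm_num

lemma integral_rpow_sub_one {b : ℝ} (hb : 0 < b) : ∫ σ in Ioo (0 : ℝ) 1, σ ^ (b - 1) = 1 / b := by
  rw [← integral_Ioc_eq_integral_Ioo, ← intervalIntegral.integral_of_le zero_le_one,
    integral_rpow (Or.inl (by linarith))]
  simp [hb.ne']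

lemma setIntegral_one_sub (f : ℝ → ℝ) :
    ∫ σ in Ioo (0 : ℝ) 1, f (1 - σ) = ∫ σ in Ioo (0 : ℝ) 1, f σ := by
  rw [← integral_Ioc_eq_integral_Ioo, ← integral_Ioc_eq_integral_Ioo,
    ← intervalIntegral.integral_of_le zero_le_one, ← intervalIntegral.integral_of_le zero_le_one,
    intervalIntegral.integral_comp_sub_left (fun s => f s)]
  simp

/-- Reflecting `σ` and extending the integral to the half-line gives a Gamma integral. The factor
`n^{-a}` is the small parameter when the growth rate is large. -/
lemma integral_rpow_mul_exp_le {a n : ℝ} (ha : 0 < a) (hn : 0 < n) :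
    IntegrableOn (fun σ : ℝ => (1 - σ) ^ (a - 1) * Real.exp (-(n * (1 - σ)))) (Ioo 0 1) ∧
    ∫ σ in Ioo (0 : ℝ) 1, (1 - σ) ^ (a - 1) * Real.exp (-(n * (1 - σ)))
      ≤ n ^ (-a) * Real.Gamma a := by
  constructor
  · refine (integrableOn_one_sub_rpow_sub_one ha).mono' ?_ ?_
    · exact (integrableOn_one_sub_rpow_sub_one ha).aestronglyMeasurable.mul
        (by fun_prop)
    · filter_upwards [ae_restrict_mem measurableSet_Ioo] with σ hσ
      have h2 : 0 < 1 - σ := by linarith [hσ.2]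
      rw [Real.norm_eq_abs, abs_of_pos (by positivity)]
      refine mul_le_of_le_one_right (by positivity) ?_
      rw [Real.exp_le_one_iff]
      have : 0 < n * (1 - σ) := by positivity
      linarith
  · rw [setIntegral_one_sub (fun σ => σ ^ (a - 1) * Real.exp (-(n * σ)))]
    have h := Real.integral_rpow_mul_exp_neg_mul_Ioi ha hn
    rw [one_div, Real.inv_rpow hn.le, ← Real.rpow_neg hn.le] at h
    rw [← h]
    refine setIntegral_mono_set ?_ ?_ ?_
    · by_contra hcon
      have := integral_undef hcon
      rw [this] at h
      have h1 := Real.Gamma_pos_of_pos ha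
      have h2 : 0 < n ^ (-a) := by positivity
      have : 0 < n ^ (-a) * Real.Gamma a := by positivity
      linarith
    · filter_upwards [ae_restrict_mem measurableSet_Ioi] with σ hσ
      have : (0 : ℝ) < σ := hσ
      simp only [Pi.zero_apply]
      positivity
    · exact Ioo_subset_Ioi_self.eventuallyLE

/-- The time part of a Volterra kernel. -/
def volt (A θ t : ℝ) : ℝ := A * (t ^ (θ - 1) * Real.exp t)

lemma volt_mul {A θ₀ θ m t σ : ℝ} (ht : 0 < t) (hσ : σ ∈ Ioo (0 : ℝ) 1) :
    volt A θ₀ (t * (1 - σ)) * ((t * σ) ^ (θ - 1) * Real.exp (m * (t * σ)))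
      = A * (t ^ (θ₀ + θ - 2) * Real.exp (m * t)) * ((1 - σ) ^ (θ₀ - 1) * σ ^ (θ - 1)
        * Real.exp (-((m - 1) * t * (1 - σ)))) := by
  have h1 : 0 ≤ 1 - σ := by linarith [hσ.2]
  unfold volt
  have e : Real.exp (t * (1 - σ)) * Real.exp (m * (t * σ))
      = Real.exp (m * t) * Real.exp (-((m - 1) * t * (1 - σ))) := by
    rw [← Real.exp_add, ← Real.exp_add]; ring_nf
  rw [Real.mul_rpow ht.le h1, Real.mul_rpow ht.le hσ.1.le,
    show θ₀ + θ - 2 = (θ₀ - 1) + (θ - 1) by ring, Real.rpow_add ht]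
  linear_combination (A * t ^ (θ₀ - 1) * (1 - σ) ^ (θ₀ - 1) * t ^ (θ - 1) * σ ^ (θ - 1)) * e

/-- A weight is good if the Volterra operator with kernel `volt A θ` is a contraction for it. -/
structure GoodW (A θ₀ q : ℝ) (w : ℝ → ℝ) : Prop where
  nonneg : ∀ t > 0, 0 ≤ w t
  int : ∀ t > 0, IntegrableOn (fun σ => volt A θ₀ (t * (1 - σ)) * w (t * σ)) (Ioo 0 1)
  le : ∀ t > 0, t * ∫ σ in Ioo (0 : ℝ) 1, volt A θ₀ (t * (1 - σ)) * w (t * σ) ≤ q * w t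

lemma integrableOn_volt {A θ₀ θ m : ℝ} (hθ₀ : 0 < θ₀) (hθ : 0 < θ) (hm : 1 ≤ m)
    {t : ℝ} (ht : 0 < t) :
    IntegrableOn (fun σ => volt A θ₀ (t * (1 - σ)) * ((t * σ) ^ (θ - 1) * Real.exp (m * (t * σ))))
      (Ioo 0 1) := by
  have h : IntegrableOn (fun σ : ℝ => A * (t ^ (θ₀ + θ - 2) * Real.exp (m * t))
      * ((1 - σ) ^ (θ₀ - 1) * σ ^ (θ - 1) * Real.exp (-((m - 1) * t * (1 - σ))))) (Ioo 0 1) := by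
    refine Integrable.const_mul ((integrableOn_beta hθ₀ hθ).mono'
      ((integrableOn_beta hθ₀ hθ).aestronglyMeasurable.mul (by fun_prop)) ?_) _
    filter_upwards [ae_restrict_mem measurableSet_Ioo] with σ hσ
    have h1 : 0 < σ := hσ.1
    have h2 : 0 < 1 - σ := by linarith [hσ.2]
    simp only [Pi.mul_apply]
    rw [Real.norm_eq_abs, abs_of_pos (by positivity)]
    refine mul_le_of_le_one_right (by positivity) ?_
    rw [Real.exp_le_one_iff]
    have : 0 ≤ (m - 1) * t * (1 - σ) := mul_nonneg (mul_nonneg (by linarith) ht.le) h2.le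
    linarith
  exact h.congr_fun (fun σ hσ => (volt_mul ht hσ).symm) measurableSet_Ioo

lemma exists_contraction {A θ₀ q : ℝ} (hA : 0 ≤ A) (hθ₀ : 0 < θ₀) (hθ₁ : θ₀ ≤ 1) (hq : 0 < q) :
    ∃ m : ℝ, 1 ≤ m ∧ ∀ m' ≥ m, ∀ θ, θ₀ ≤ θ →
      GoodW A θ₀ q (fun t => t ^ (θ - 1) * Real.exp (m' * t)) := by
  -- The Gamma term bounds the half `σ ≥ 1/2` of the time integral, the other term the half `σ ≤
  -- 1/2`. Here `n` stands for the growth rate minus the rate `1` of the kernel.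
  have hlim : Tendsto (fun n : ℝ => A * (2 * Real.Gamma θ₀ + 2 / θ₀ * 2 ^ θ₀) * n ^ (-θ₀)) atTop
      (𝓝 (A * (2 * Real.Gamma θ₀ + 2 / θ₀ * 2 ^ θ₀) * 0)) :=
    (tendsto_rpow_neg_atTop hθ₀).const_mul _
  rw [mul_zero] at hlim
  obtain ⟨n₀, hn₀⟩ := (eventually_atTop.1 (hlim.eventually_le_const hq))
  refine ⟨max n₀ 1 + 1, by linarith [le_max_right n₀ 1], fun m' hm' θ hθ => ?_⟩
  have hn : max n₀ 1 ≤ m' - 1 := by linarith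
  have hn1 : 1 ≤ m' - 1 := (le_max_right _ _).trans hn
  have hθpos : 0 < θ := hθ₀.trans_le hθ
  refine ⟨fun t ht => by positivity,
    fun t ht => integrableOn_volt hθ₀ hθpos (by linarith) ht, fun t ht => ?_⟩
  rw [setIntegral_congr_fun measurableSet_Ioo (fun σ hσ => volt_mul ht hσ), integral_const_mul]
  set n := m' - 1 with hndef
  have hn0 : 0 < n := by linarith
  obtain ⟨hi, hI⟩ := integral_rpow_mul_exp_le hθ₀ (mul_pos hn0 ht)
  have hJ : ∫ σ in Ioo (0 : ℝ) 1, (1 - σ) ^ (θ₀ - 1) * σ ^ (θ - 1) * Real.exp (-(n * t * (1 - σ)))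
      ≤ 2 * ((n * t) ^ (-θ₀) * Real.Gamma θ₀) + 2 * Real.exp (-(n * t / 2)) * (1 / θ₀) := by
    rw [← integral_rpow_sub_one hθ₀]
    have hb : IntegrableOn (fun σ : ℝ => 2 * ((1 - σ) ^ (θ₀ - 1) * Real.exp (-(n * t * (1 - σ))))
        + 2 * Real.exp (-(n * t / 2)) * σ ^ (θ₀ - 1)) (Ioo 0 1) :=
      (hi.const_mul 2).add ((integrableOn_rpow_sub_one hθ₀).const_mul _)
    calc _ ≤ ∫ σ in Ioo (0 : ℝ) 1, 2 * ((1 - σ) ^ (θ₀ - 1) * Real.exp (-(n * t * (1 - σ))))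
        + 2 * Real.exp (-(n * t / 2)) * σ ^ (θ₀ - 1) := by
          refine integral_mono_of_nonneg ?_ hb ?_
          · filter_upwards [ae_restrict_mem measurableSet_Ioo] with σ hσ
            have h1 : 0 < σ := hσ.1
            have h2 : 0 < 1 - σ := by linarith [hσ.2]
            simp only [Pi.zero_apply]
            positivity
          · filter_upwards [ae_restrict_mem measurableSet_Ioo] with σ hσ
            have h1 : 0 < σ := hσ.1
            have h2 : 0 < 1 - σ := by linarith [hσ.2]
            have p1 : 0 < (1 - σ) ^ (θ₀ - 1) := by positivity
            have p2 : 0 < σ ^ (θ₀ - 1) := by positivity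
            -- The comparison with `θ₀` makes the bound, and hence the growth rate, independent of
            -- `θ`.
            have p3 : σ ^ (θ - 1) ≤ σ ^ (θ₀ - 1) :=
              Real.rpow_le_rpow_of_exponent_ge h1 hσ.2.le (by linarith)
            rcases le_total σ (1 / 2) with h | h
            · have e1 := rpow_sub_one_le_two hθ₀ (r := 1 - σ) (by linarith) (by linarith)
              have e2 : Real.exp (-(n * t * (1 - σ))) ≤ Real.exp (-(n * t / 2)) := by
                apply Real.exp_le_exp.2
                have : 0 < n * t := by positivity
                nlinarith
              calc (1 - σ) ^ (θ₀ - 1) * σ ^ (θ - 1) * Real.exp (-(n * t * (1 - σ)))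
                  ≤ 2 * σ ^ (θ₀ - 1) * Real.exp (-(n * t / 2)) := by gcongr
                _ ≤ _ := by
                  have : 0 ≤ 2 * ((1 - σ) ^ (θ₀ - 1) * Real.exp (-(n * t * (1 - σ)))) := by positivity
                  linarith
            · have e1 := rpow_sub_one_le_two hθpos h hσ.2.le
              calc (1 - σ) ^ (θ₀ - 1) * σ ^ (θ - 1) * Real.exp (-(n * t * (1 - σ)))
                  ≤ (1 - σ) ^ (θ₀ - 1) * 2 * Real.exp (-(n * t * (1 - σ))) := by gcongr
                _ ≤ _ := by
                  have : 0 ≤ 2 * Real.exp (-(n * t / 2)) * σ ^ (θ₀ - 1) := by positivity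
                  linarith
      _ ≤ _ := by
        rw [integral_add (hi.const_mul 2) ((integrableOn_rpow_sub_one hθ₀).const_mul _),
          integral_const_mul, integral_const_mul]
        gcongr
  have hexp : t ^ θ₀ * Real.exp (-(n * t / 2)) ≤ 2 ^ θ₀ * n ^ (-θ₀) := by
    have h := rpow_le_exp_of_le_one (t := n * t / 2) (by positivity) hθ₀.le hθ₁
    have h2 : (n * t / 2) ^ θ₀ = t ^ θ₀ * (n ^ θ₀ * (2 ^ θ₀)⁻¹) := by
      rw [mul_div_assoc, Real.mul_rpow hn0.le (by positivity), Real.div_rpow ht.le (by norm_num)]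
      ring
    rw [h2] at h
    rw [Real.exp_neg, Real.rpow_neg hn0.le, ← div_eq_mul_inv, ← div_eq_mul_inv,
      div_le_div_iff₀ (Real.exp_pos _) (by positivity)]
    calc t ^ θ₀ * n ^ θ₀ = 2 ^ θ₀ * (t ^ θ₀ * (n ^ θ₀ * (2 ^ θ₀)⁻¹)) := by field_simp
      _ ≤ _ := by gcongr
  have hnq := hn₀ n ((le_max_left _ _).trans hn)
  have e1 : t ^ θ₀ * (n * t) ^ (-θ₀) = n ^ (-θ₀) := by
    rw [Real.mul_rpow hn0.le ht.le, mul_left_comm, ← Real.rpow_add ht]; simp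
  have e2 : t * t ^ (θ₀ + θ - 2) = t ^ θ₀ * t ^ (θ - 1) := by
    rw [← Real.rpow_add ht, mul_comm, ← Real.rpow_add_one ht.ne']; ring_nf
  calc _ = A * (t ^ (θ - 1) * Real.exp (m' * t)) * (t ^ θ₀ * ∫ σ in Ioo (0 : ℝ) 1,
          (1 - σ) ^ (θ₀ - 1) * σ ^ (θ - 1) * Real.exp (-(n * t * (1 - σ)))) := by
        linear_combination (A * Real.exp (m' * t) * ∫ σ in Ioo (0 : ℝ) 1,
          (1 - σ) ^ (θ₀ - 1) * σ ^ (θ - 1) * Real.exp (-(n * t * (1 - σ)))) * e2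
    _ ≤ A * (t ^ (θ - 1) * Real.exp (m' * t)) * (t ^ θ₀ * (2 * ((n * t) ^ (-θ₀) * Real.Gamma θ₀)
          + 2 * Real.exp (-(n * t / 2)) * (1 / θ₀))) := by gcongr
    _ = A * (t ^ (θ - 1) * Real.exp (m' * t)) * (2 * n ^ (-θ₀) * Real.Gamma θ₀
          + 2 / θ₀ * (t ^ θ₀ * Real.exp (-(n * t / 2)))) := by rw [← e1]; ring
    _ ≤ A * (t ^ (θ - 1) * Real.exp (m' * t)) * (2 * n ^ (-θ₀) * Real.Gamma θ₀
          + 2 / θ₀ * (2 ^ θ₀ * n ^ (-θ₀))) := by gcongr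
    _ = (A * (2 * Real.Gamma θ₀ + 2 / θ₀ * 2 ^ θ₀) * n ^ (-θ₀))
          * (t ^ (θ - 1) * Real.exp (m' * t)) := by ring
    _ ≤ _ := by gcongr

/-- A single growth rate must serve every `θ`, since `c₀` may not depend on `α`. For `θ < θ₀` the
uniform contraction estimate no longer covers the weight `w₁ = t^{θ-1} e^{mt}`. But one application
of the operator maps it below a multiple of `w₂ = t^{θ₀-1} e^{(m+1)t}`, on which the operator does
contract. Hence `w₁ + B w₂` is a good weight for `B = 12 A · betaI θ₀ θ`, and `θ` affects only the
comparison constant. -/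
lemma exists_goodW {A θ₀ : ℝ} (hA : 0 ≤ A) (hθ₀ : 0 < θ₀) (hθ₁ : θ₀ ≤ 1) :
    ∃ m : ℝ, 1 ≤ m ∧ ∀ θ : ℝ, 0 < θ → θ ≤ 1 → ∃ (w : ℝ → ℝ) (C : ℝ), 0 ≤ C ∧ GoodW A θ₀ (1 / 6) w ∧
      ∀ t > 0, t ^ (θ - 1) * Real.exp t ≤ w t ∧
        w t ≤ C * (t ^ (θ - 1) * Real.exp (m * t)) := by
  -- Half of the target `1/6` is kept for the image of the singular part `w₁`, which contributes
  -- another `B/12` times `w₂`.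
  obtain ⟨m, hm, H⟩ := exists_contraction hA hθ₀ hθ₁ (q := 1 / 12) (by norm_num)
  refine ⟨m + 2, by linarith, fun θ hθ hθ' => ?_⟩
  rcases le_total θ₀ θ with h | h
  · have G := H m le_rfl θ h
    refine ⟨_, 1, zero_le_one, ⟨G.nonneg, G.int, fun t ht => (G.le t ht).trans ?_⟩, fun t ht => ⟨?_, ?_⟩⟩
    · have := G.nonneg t ht
      linarith
    · gcongr
      nlinarith
    · rw [one_mul]
      gcongr
      linarith
  · set B := 12 * (A * betaI θ₀ θ) with hB
    have hB0 : 0 ≤ B := by have := betaI_nonneg θ₀ θ; positivity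
    have G := H (m + 1) (by linarith) θ₀ le_rfl
    have i1 := fun t (ht : 0 < t) => integrableOn_volt (A := A) hθ₀ hθ hm ht
    refine ⟨fun t => t ^ (θ - 1) * Real.exp (m * t) + B * (t ^ (θ₀ - 1) * Real.exp ((m + 1) * t)),
      1 + B, by positivity, ⟨fun t ht => by positivity, fun t ht => ?_, fun t ht => ?_⟩,
      fun t ht => ⟨?_, ?_⟩⟩
    · have := (i1 t ht).add ((G.int t ht).const_mul B)
      refine this.congr_fun (fun σ _ => ?_) measurableSet_Ioo
      simp only [Pi.add_apply]; ring
    · have e : ∀ σ : ℝ, volt A θ₀ (t * (1 - σ)) * ((t * σ) ^ (θ - 1) * Real.exp (m * (t * σ))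
          + B * ((t * σ) ^ (θ₀ - 1) * Real.exp ((m + 1) * (t * σ))))
          = volt A θ₀ (t * (1 - σ)) * ((t * σ) ^ (θ - 1) * Real.exp (m * (t * σ)))
          + B * (volt A θ₀ (t * (1 - σ)) * ((t * σ) ^ (θ₀ - 1) * Real.exp ((m + 1) * (t * σ)))) :=
        fun σ => by ring
      simp only [e]
      rw [integral_add (i1 t ht) ((G.int t ht).const_mul B), integral_const_mul, mul_add]
      have g := mul_le_mul_of_nonneg_left (G.le t ht) hB0
      have f1 : t * ∫ σ in Ioo (0 : ℝ) 1,
          volt A θ₀ (t * (1 - σ)) * ((t * σ) ^ (θ - 1) * Real.exp (m * (t * σ)))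
          ≤ betaI θ₀ θ * (A * Real.exp (m * t)) * t ^ (θ₀ + θ - 1) := by
        refine (le_abs_self _).trans (abs_time_integral_le hθ₀ hθ ht fun σ hσ => ?_)
        have h1 : 0 < σ := hσ.1
        have h2 : 0 < 1 - σ := by linarith [hσ.2]
        rw [volt_mul ht hσ, abs_of_nonneg (by positivity)]
        have h3 : Real.exp (-((m - 1) * t * (1 - σ))) ≤ 1 := by
          rw [Real.exp_le_one_iff]
          have : 0 ≤ (m - 1) * t * (1 - σ) := mul_nonneg (mul_nonneg (by linarith) ht.le) h2.le
          linarith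
        calc _ ≤ A * (t ^ (θ₀ + θ - 2) * Real.exp (m * t)) * ((1 - σ) ^ (θ₀ - 1) * σ ^ (θ - 1) * 1) := by
              gcongr
          _ = _ := by ring
      have f2 : t ^ (θ₀ + θ - 1) * Real.exp (m * t) ≤ t ^ (θ₀ - 1) * Real.exp ((m + 1) * t) := by
        rw [show θ₀ + θ - 1 = (θ₀ - 1) + θ by ring, Real.rpow_add ht,
          show (m + 1) * t = t + m * t by ring, Real.exp_add, mul_assoc]
        gcongr
        exact rpow_le_exp_of_le_one ht hθ.le hθ'
      have f3 : betaI θ₀ θ * (A * Real.exp (m * t)) * t ^ (θ₀ + θ - 1)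
          ≤ B / 12 * (t ^ (θ₀ - 1) * Real.exp ((m + 1) * t)) := by
        have := mul_le_mul_of_nonneg_left f2 (show 0 ≤ B / 12 by positivity)
        refine le_trans (le_of_eq ?_) this
        rw [hB]; ring
      have f4 : 0 ≤ t ^ (θ - 1) * Real.exp (m * t) := by positivity
      linarith
    · have h1 : t ^ (θ - 1) * Real.exp t ≤ t ^ (θ - 1) * Real.exp (m * t) := by
        gcongr; nlinarith
      have : 0 ≤ B * (t ^ (θ₀ - 1) * Real.exp ((m + 1) * t)) := by positivity
      linarith
    · have h1 : t ^ (θ - 1) * Real.exp (m * t) ≤ t ^ (θ - 1) * Real.exp ((m + 2) * t) := by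
        gcongr; linarith
      have h2 : t ^ (θ₀ - 1) * Real.exp ((m + 1) * t) ≤ t ^ (θ - 1) * Real.exp ((m + 2) * t) := by
        rw [show θ₀ - 1 = (θ - 1) + (θ₀ - θ) by ring, Real.rpow_add ht,
          show (m + 2) * t = t + (m + 1) * t by ring, Real.exp_add, mul_assoc]
        gcongr
        exact rpow_le_exp_of_le_one ht (by linarith) (by linarith)
      have := mul_le_mul_of_nonneg_left h2 hB0
      linarith

/-! ### The Volterra equation -/

/-- The space-time integral operator with kernel `k`. -/
def cop (k : ℝ → ℝ → ℝ → ℝ) (F : ℝ → ℝ → ℝ) (t x : ℝ) : ℝ :=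
  t * ∫ σ in Ioo (0 : ℝ) 1, ∫ z, k (t * (1 - σ)) x z * F (t * σ) z

/-- Space-time functions which the heat semigroup propagates. -/
def Propagated (L : ℝ) (ω : ℝ → ℝ → ℝ) : Prop :=
  ∀ τ > 0, ∀ s > 0, ∀ x, Integrable (fun z => gk (L * τ) (x - z) * ω s z) ∧
    ∫ z, gk (L * τ) (x - z) * ω s z = ω (τ + s) x

lemma propagated_gk {L : ℝ} (hL : 0 < L) (y : ℝ) : Propagated L (fun s z => gk (L * s) (z - y)) := by
  intro τ hτ s hs x
  refine ⟨integrable_gk_mul_gk (mul_pos hL hτ) (mul_pos hL hs) x y, ?_⟩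
  rw [integral_gk_mul_gk (mul_pos hL hτ) (mul_pos hL hs)]
  simp only [mul_add]

lemma Propagated.add {L : ℝ} {ω ω' : ℝ → ℝ → ℝ} (h : Propagated L ω) (h' : Propagated L ω') :
    Propagated L (fun s z => ω s z + ω' s z) := by
  intro τ hτ s hs x
  obtain ⟨i1, e1⟩ := h τ hτ s hs x
  obtain ⟨i2, e2⟩ := h' τ hτ s hs x
  simp only [mul_add]
  exact ⟨i1.add i2, by rw [integral_add i1 i2, e1, e2]⟩

/-- The spatial profile is propagated exactly, so only a scalar Volterra inequality for `w` remains.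
Besides single Gaussians the profile may be a sum of two, which is the form taken by increments in
`y`. -/
lemma abs_cop_le {L A θ₀ q c : ℝ} {w : ℝ → ℝ} (hw : GoodW A θ₀ q w) {ω : ℝ → ℝ → ℝ}
    (hω : Propagated L ω) (hω0 : ∀ t > 0, ∀ x, 0 ≤ ω t x) (hc : 0 ≤ c) {k : ℝ → ℝ → ℝ → ℝ}
    (hk : ∀ t > 0, ∀ x z, |k t x z| ≤ volt A θ₀ t * gk (L * t) (x - z))
    {F : ℝ → ℝ → ℝ} (hF : ∀ t > 0, ∀ z, |F t z| ≤ c * (w t * ω t z)) {t : ℝ} (ht : 0 < t) (x : ℝ) :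
    |cop k F t x| ≤ q * c * (w t * ω t x) := by
  have hb : |∫ σ in Ioo (0 : ℝ) 1, ∫ z, k (t * (1 - σ)) x z * F (t * σ) z|
      ≤ ∫ σ in Ioo (0 : ℝ) 1, (c * ω t x) * (volt A θ₀ (t * (1 - σ)) * w (t * σ)) := by
    rw [← Real.norm_eq_abs]
    refine norm_integral_le_of_norm_le ((hw.int t ht).const_mul _) ?_
    filter_upwards [ae_restrict_mem measurableSet_Ioo] with σ hσ
    have h1 := mul_one_sub_pos ht hσ
    have h2 := mul_Ioo_pos ht hσ
    obtain ⟨i, e⟩ := hω _ h1 _ h2 x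
    rw [show t * (1 - σ) + t * σ = t by ring] at e
    rw [Real.norm_eq_abs]
    refine (abs_scomp_le (g := fun z => gk (L * (t * (1 - σ))) (x - z)) (h := fun z => ω (t * σ) z)
      (A := volt A θ₀ (t * (1 - σ))) (B := c * w (t * σ)) (hk _ h1 x)
      (fun z => (hF _ h2 z).trans_eq (mul_assoc _ _ _).symm) i e).trans_eq (by ring)
  rw [integral_const_mul] at hb
  unfold cop
  rw [abs_mul, abs_of_pos ht]
  have h0 : 0 ≤ c * ω t x := mul_nonneg hc (hω0 t ht x)
  calc _ ≤ t * ((c * ω t x) * ∫ σ in Ioo (0 : ℝ) 1, volt A θ₀ (t * (1 - σ)) * w (t * σ)) := by gcongr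
    _ = (c * ω t x) * (t * ∫ σ in Ioo (0 : ℝ) 1, volt A θ₀ (t * (1 - σ)) * w (t * σ)) := by ring
    _ ≤ (c * ω t x) * (q * w t) := mul_le_mul_of_nonneg_left (hw.le t ht) h0
    _ = _ := by ring

/-- The recursion for the time derivative has three terms, each contracting by `1/6`; together they
give the ratio `1/2`. -/
lemma iter_bound {L A θ₀ c : ℝ} {w : ℝ → ℝ} (hw : GoodW A θ₀ (1 / 6) w) {ω : ℝ → ℝ → ℝ}
    (hω : Propagated L ω) (hω0 : ∀ t > 0, ∀ x, 0 ≤ ω t x) (hc : 0 ≤ c) {K DK : ℝ → ℝ → ℝ → ℝ}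
    (hK : ∀ t > 0, ∀ x z, |K t x z| ≤ volt A θ₀ t * gk (L * t) (x - z))
    (hDK : ∀ t > 0, ∀ x z, |DK t x z| ≤ volt A θ₀ t * gk (L * t) (x - z))
    {g Dg : ℕ → ℝ → ℝ → ℝ} (h0 : ∀ t > 0, ∀ x, |g 0 t x| ≤ c * (w t * ω t x))
    (h0' : ∀ t > 0, ∀ x, |Dg 0 t x| ≤ c * (w t * ω t x))
    (hrec : ∀ n, ∀ t > 0, ∀ x, g (n + 1) t x = cop K (g n) t x)
    (hrec' : ∀ n, ∀ t > 0, ∀ x,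
      Dg (n + 1) t x = cop K (g n) t x + cop DK (g n) t x + cop K (Dg n) t x) (n : ℕ) :
    (∀ t > 0, ∀ x, |g n t x| ≤ c * (1 / 2) ^ n * (w t * ω t x)) ∧
      ∀ t > 0, ∀ x, |Dg n t x| ≤ c * (1 / 2) ^ n * (w t * ω t x) := by
  induction n with
  | zero => simpa using ⟨h0, h0'⟩
  | succ n ih =>
    have hc' : 0 ≤ c * (1 / 2) ^ n := by positivity
    have b1 := fun t ht x => abs_cop_le hw hω hω0 hc' hK ih.1 (t := t) ht x
    have b2 := fun t ht x => abs_cop_le hw hω hω0 hc' hDK ih.1 (t := t) ht x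
    have b3 := fun t ht x => abs_cop_le hw hω hω0 hc' hK ih.2 (t := t) ht x
    refine ⟨fun t ht x => ?_, fun t ht x => ?_⟩
    · rw [hrec n t ht x]
      have := mul_nonneg (hw.nonneg t ht) (hω0 t ht x)
      have h2 : 0 ≤ c * (1 / 2) ^ n * (w t * ω t x) := by positivity
      have := b1 t ht x
      rw [pow_succ]
      linarith
    · rw [hrec' n t ht x]
      have h1 := b1 t ht x
      have h2 := b2 t ht x
      have h3 := b3 t ht x
      have h4 := abs_add_three (cop K (g n) t x) (cop DK (g n) t x) (cop K (Dg n) t x)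
      rw [pow_succ]
      linarith

lemma conv_sub_right {L a b m : ℝ} (hL : 0 < L) (ha : 0 < a) (hb : 0 < b)
    {k f : ℝ → ℝ → ℝ → ℝ} (hk : GK L a m k) (hf : GK L b m f) {t : ℝ} (ht : 0 < t) (x y y' : ℝ) :
    conv k f t x y - conv k f t x y' = cop k (fun s z => f s z y - f s z y') t x := by
  unfold conv cop
  rw [← mul_sub, ← integral_sub (integrableOn_scomp hL ha hb hk hf ht x y)
    (integrableOn_scomp hL ha hb hk hf ht x y')]
  congr 1
  refine setIntegral_congr_fun measurableSet_Ioo fun σ hσ => ?_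
  have h1 := mul_one_sub_pos ht hσ
  have h2 := mul_Ioo_pos ht hσ
  simp only [scomp]
  rw [← integral_sub]
  · simp only [← mul_sub]
  · exact integrable_scomp hk.cont (hk.bd.lgau hL) hf.cont (hf.bd.lbdd hL) h1 h2 x y
  · exact integrable_scomp hk.cont (hk.bd.lgau hL) hf.cont (hf.bd.lbdd hL) h1 h2 x y'

lemma conv_add_right {L a b m : ℝ} (hL : 0 < L) (ha : 0 < a) (hb : 0 < b)
    {k f g : ℝ → ℝ → ℝ → ℝ} (hk : GK L a m k) (hf : GK L b m f) (hg : GK L b m g)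
    {t : ℝ} (ht : 0 < t) (x y : ℝ) :
    conv k (fun t x y => f t x y + g t x y) t x y = conv k f t x y + conv k g t x y := by
  unfold conv
  rw [← mul_add, ← integral_add (integrableOn_scomp hL ha hb hk hf ht x y)
    (integrableOn_scomp hL ha hb hk hg ht x y)]
  congr 1
  refine setIntegral_congr_fun measurableSet_Ioo fun σ hσ => ?_
  have h1 := mul_one_sub_pos ht hσ
  have h2 := mul_Ioo_pos ht hσ
  simp only [scomp, mul_add]
  rw [← integral_add]
  · exact integrable_scomp hk.cont (hk.bd.lgau hL) hf.cont (hf.bd.lbdd hL) h1 h2 x y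
  · exact integrable_scomp hk.cont (hk.bd.lgau hL) hg.cont (hg.bd.lbdd hL) h1 h2 x y

lemma conv_congr_right {k f g : ℝ → ℝ → ℝ → ℝ} (h : ∀ t > 0, ∀ x y, f t x y = g t x y) {t : ℝ}
    (ht : 0 < t) (x y : ℝ) : conv k f t x y = conv k g t x y := by
  unfold conv
  congr 1
  refine setIntegral_congr_fun measurableSet_Ioo fun σ hσ => ?_
  simp only [scomp, h _ (mul_Ioo_pos ht hσ)]

/-- The iterates of the Volterra operator, with their time derivatives. -/
def volterraIter (K DK : ℝ → ℝ → ℝ → ℝ) : ℕ → (ℝ → ℝ → ℝ → ℝ) × (ℝ → ℝ → ℝ → ℝ)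
  | 0 => (K, DK)
  | n + 1 => (conv K (volterraIter K DK n).1,
      fun t x y => conv K (volterraIter K DK n).1 t x y + conv DK (volterraIter K DK n).1 t x y
        + conv K (volterraIter K DK n).2 t x y)

/-- `Φ` solves the Volterra equation `Φ = K + K * Φ` and inherits the regularity of `K`. -/
structure VolterraSol (L θ₀ m : ℝ) (K DK Φ DΦ : ℝ → ℝ → ℝ → ℝ) : Prop where
  gk : GK L θ₀ m Φ
  gk' : GK L θ₀ m DΦ
  deriv : HasTimeDeriv Φ DΦ
  eq : ∀ t > 0, ∀ x y, Φ t x y = K t x y + conv K Φ t x y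
  bd : ∀ θ : ℝ, 0 < θ → θ ≤ 1 → KBd L θ 1 K → KBd L θ 1 DK → KBd L θ m Φ ∧ KBd L θ m DΦ
  hy : ∀ θ κ : ℝ, 0 < θ - κ / 2 → θ - κ / 2 ≤ 1 → KHy L θ 1 κ K → KHy L θ 1 κ DK →
    KHy L θ m κ Φ ∧ KHy L θ m κ DΦ

lemma KC.add {f g : ℝ → ℝ → ℝ → ℝ} (hf : KC f) (hg : KC g) :
    KC (fun t x y => f t x y + g t x y) := ContinuousOn.add hf hg

lemma KBd.add {L θ m : ℝ} {f g : ℝ → ℝ → ℝ → ℝ} (hf : KBd L θ m f) (hg : KBd L θ m g) :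
    KBd L θ m (fun t x y => f t x y + g t x y) := by
  obtain ⟨C, hC, hf⟩ := hf
  obtain ⟨D, hD, hg⟩ := hg
  refine ⟨C + D, by positivity, fun t ht x y => ?_⟩
  have := abs_add_le (f t x y) (g t x y)
  linarith [hf t ht x y, hg t ht x y]

lemma GK.add {L θ m : ℝ} {f g : ℝ → ℝ → ℝ → ℝ} (hf : GK L θ m f) (hg : GK L θ m g) :
    GK L θ m (fun t x y => f t x y + g t x y) := ⟨hf.cont.add hg.cont, hf.bd.add hg.bd⟩

lemma KBd.mono_m {L θ m m' : ℝ} {f : ℝ → ℝ → ℝ → ℝ} (hf : KBd L θ m f) (hm : m ≤ m') :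
    KBd L θ m' f := by
  obtain ⟨C, hC, hf⟩ := hf
  refine ⟨C, hC, fun t ht x y => (hf t ht x y).trans ?_⟩
  have := gk_nonneg (L * t) (x - y)
  gcongr

lemma GK.mono_m {L θ m m' : ℝ} {f : ℝ → ℝ → ℝ → ℝ} (hf : GK L θ m f) (hm : m ≤ m') :
    GK L θ m' f := ⟨hf.cont, hf.bd.mono_m hm⟩

lemma abs_tsum_le_geom {u : ℕ → ℝ} {B : ℝ} (h : ∀ n, |u n| ≤ B * (1 / 2) ^ n) :
    Summable u ∧ |∑' n, u n| ≤ 2 * B := by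
  have hs : HasSum (fun n : ℕ => B * (1 / 2 : ℝ) ^ n) (B * 2) := hasSum_geometric_two.mul_left B
  refine ⟨Summable.of_norm_bounded (f := u) hs.summable h, ?_⟩
  have := tsum_of_norm_bounded (f := u) hs h
  rw [Real.norm_eq_abs] at this
  linarith

/-- The solution is the Neumann series, which is geometric in every good weight. Measuring the same
series in different weights transfers a better time exponent or Hölder regularity in `y` from `K` to
`Φ` without changing `m`. Regularity of `Φ` in `x` is not needed: it will come from the left factor
of later convolutions. -/
theorem exists_volterraSol {L A θ₀ : ℝ} (hL : 0 < L) (hA : 0 ≤ A) (hθ₀ : 0 < θ₀) (hθ₁ : θ₀ ≤ 1) :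
    ∃ m : ℝ, 1 ≤ m ∧ ∀ K DK : ℝ → ℝ → ℝ → ℝ, KC K → KC DK → HasTimeDeriv K DK →
      (∀ t > 0, ∀ x z, |K t x z| ≤ volt A θ₀ t * gk (L * t) (x - z)) →
      (∀ t > 0, ∀ x z, |DK t x z| ≤ volt A θ₀ t * gk (L * t) (x - z)) →
      ∃ Φ DΦ, VolterraSol L θ₀ m K DK Φ DΦ := by
  obtain ⟨m, hm, H⟩ := exists_goodW hA hθ₀ hθ₁
  refine ⟨m, hm, fun K DK cK cDK dK hK hDK => ?_⟩
  set f : ℕ → ℝ → ℝ → ℝ → ℝ := fun n => (volterraIter K DK n).1 with hfdef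
  set Df : ℕ → ℝ → ℝ → ℝ → ℝ := fun n => (volterraIter K DK n).2 with hDfdef
  have bK : KBd L θ₀ 1 K :=
    ⟨A, hA, fun t ht x y => (hK t ht x y).trans_eq (by unfold volt; rw [one_mul]; ring)⟩
  have bDK : KBd L θ₀ 1 DK :=
    ⟨A, hA, fun t ht x y => (hDK t ht x y).trans_eq (by unfold volt; rw [one_mul]; ring)⟩
  have gK : GK L θ₀ m K := ⟨cK, bK.mono_m hm⟩
  have gDK : GK L θ₀ m DK := ⟨cDK, bDK.mono_m hm⟩
  -- bounds of the iterates, for every good weight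
  have hbound : ∀ (w : ℝ → ℝ) (θ c : ℝ), GoodW A θ₀ (1 / 6) w →
      (∀ t > 0, t ^ (θ - 1) * Real.exp t ≤ w t) → 0 ≤ c →
      (∀ t > 0, ∀ x y, |K t x y| ≤ c * (t ^ (θ - 1) * Real.exp (1 * t) * _root_.gk (L * t) (x - y))) →
      (∀ t > 0, ∀ x y, |DK t x y| ≤ c * (t ^ (θ - 1) * Real.exp (1 * t) * _root_.gk (L * t) (x - y))) →
      ∀ n, ∀ t > 0, ∀ x y, |f n t x y| ≤ c * (1 / 2) ^ n * (w t * _root_.gk (L * t) (x - y)) ∧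
        |Df n t x y| ≤ c * (1 / 2) ^ n * (w t * _root_.gk (L * t) (x - y)) := by
    intro w θ c hw hw1 hc h1 h2 n t ht x y
    have aux : ∀ (k : ℝ → ℝ → ℝ → ℝ), (∀ t > 0, ∀ x y,
        |k t x y| ≤ c * (t ^ (θ - 1) * Real.exp (1 * t) * _root_.gk (L * t) (x - y))) →
        ∀ t > 0, ∀ x, |k t x y| ≤ c * (w t * _root_.gk (L * t) (x - y)) := by
      intro k hk t ht x
      have := hw1 t ht
      have := gk_nonneg (L * t) (x - y)
      refine (hk t ht x y).trans ?_
      rw [one_mul]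
      gcongr
    have := iter_bound (g := fun n t x => f n t x y) (Dg := fun n t x => Df n t x y) hw
      (propagated_gk hL y) (fun t _ x => gk_nonneg _ _) hc hK hDK (aux K h1) (aux DK h2)
      (fun n t _ x => rfl) (fun n t _ x => rfl) n
    exact ⟨this.1 t ht x, this.2 t ht x⟩
  obtain ⟨w₀, C₀, hC₀, gw₀, hw₀⟩ := H θ₀ hθ₀ hθ₁
  have hK' : ∀ t > 0, ∀ x y, |K t x y|
      ≤ A * (t ^ (θ₀ - 1) * Real.exp (1 * t) * _root_.gk (L * t) (x - y)) := fun t ht x y =>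
    (hK t ht x y).trans_eq (by unfold volt; rw [one_mul]; ring)
  have hDK' : ∀ t > 0, ∀ x y, |DK t x y|
      ≤ A * (t ^ (θ₀ - 1) * Real.exp (1 * t) * _root_.gk (L * t) (x - y)) := fun t ht x y =>
    (hDK t ht x y).trans_eq (by unfold volt; rw [one_mul]; ring)
  have hb0 : ∀ n, ∀ t > 0, ∀ x y,
      |f n t x y| ≤ (A * C₀ * (t ^ (θ₀ - 1) * Real.exp (m * t) * _root_.gk (L * t) (x - y))) * (1 / 2) ^ n ∧
      |Df n t x y| ≤ (A * C₀ * (t ^ (θ₀ - 1) * Real.exp (m * t) * _root_.gk (L * t) (x - y))) * (1 / 2) ^ n := by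
    intro n t ht x y
    obtain ⟨h1, h2⟩ := hbound w₀ θ₀ A gw₀ (fun t ht => (hw₀ t ht).1) hA hK' hDK' n t ht x y
    have h3 := (hw₀ t ht).2
    have h4 := gk_nonneg (L * t) (x - y)
    have h5 : A * (1 / 2) ^ n * (w₀ t * _root_.gk (L * t) (x - y))
        ≤ (A * C₀ * (t ^ (θ₀ - 1) * Real.exp (m * t) * _root_.gk (L * t) (x - y))) * (1 / 2) ^ n := by
      calc _ ≤ A * (1 / 2) ^ n * (C₀ * (t ^ (θ₀ - 1) * Real.exp (m * t)) * _root_.gk (L * t) (x - y)) := by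
            gcongr
        _ = _ := by ring
    exact ⟨h1.trans h5, h2.trans h5⟩
  have hGK : ∀ n, GK L θ₀ m (f n) ∧ GK L θ₀ m (Df n) ∧ HasTimeDeriv (f n) (Df n) := by
    have hB : ∀ n, KBd L θ₀ m (f n) ∧ KBd L θ₀ m (Df n) := fun n =>
      ⟨⟨A * C₀ * (1 / 2) ^ n, by positivity, fun t ht x y => ((hb0 n t ht x y).1).trans_eq (by ring)⟩,
        ⟨A * C₀ * (1 / 2) ^ n, by positivity, fun t ht x y => ((hb0 n t ht x y).2).trans_eq (by ring)⟩⟩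
    intro n
    induction n with
    | zero => exact ⟨gK, gDK, dK⟩
    | succ n ih =>
      obtain ⟨i1, i2, i3⟩ := ih
      refine ⟨⟨KC.conv hL hθ₀ hθ₀ gK i1, (hB (n + 1)).1⟩, ⟨?_, (hB (n + 1)).2⟩,
        hasTimeDeriv_conv hL hθ₀ hθ₀ gK gDK i1 i2 dK i3⟩
      exact ((KC.conv hL hθ₀ hθ₀ gK i1).add (KC.conv hL hθ₀ hθ₀ gDK i1)).add
        (KC.conv hL hθ₀ hθ₀ gK i2)
  have hsum : ∀ t > 0, ∀ x y, Summable (fun n => f n t x y) := fun t ht x y =>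
    (abs_tsum_le_geom fun n => (hb0 n t ht x y).1).1
  -- local uniform bounds
  have hloc : ∀ t > 0, ∃ D : ℝ, ∀ n, ∀ s ∈ Ioo (t / 2) (2 * t), ∀ x y,
      |f n s x y| ≤ D * (1 / 2) ^ n ∧ |Df n s x y| ≤ D * (1 / 2) ^ n ∧
        |Df n s x y / s| ≤ D * (2 / t) * (1 / 2) ^ n := by
    intro t ht
    obtain ⟨C, ρ, hC, hρ, hg⟩ := exists_gauss_le hL (θ₀ - 1) m ht
    refine ⟨A * C₀ * C, fun n s hs x y => ?_⟩
    have hs0 : 0 < s := lt_trans (by positivity) hs.1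
    obtain ⟨h1, h2⟩ := hb0 n s hs0 x y
    have h3 := hg s (Ioo_subset_Icc_self hs) x x (by simp) y
    have h4 : Real.exp (-ρ * (y - x) ^ 2) ≤ 1 := by
      rw [Real.exp_le_one_iff]; nlinarith [sq_nonneg (y - x)]
    have h5 : (A * C₀ * (s ^ (θ₀ - 1) * Real.exp (m * s) * _root_.gk (L * s) (x - y))) * (1 / 2) ^ n
        ≤ A * C₀ * C * (1 / 2) ^ n := by
      gcongr; nlinarith
    refine ⟨h1.trans h5, h2.trans h5, ?_⟩
    rw [abs_div, abs_of_pos hs0, div_le_iff₀ hs0]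
    have h6 : 1 ≤ 2 / t * s := by
      rw [div_mul_eq_mul_div, le_div_iff₀ ht]; linarith [hs.1]
    have h7 : 0 ≤ A * C₀ * C * (1 / 2) ^ n := by positivity
    calc _ ≤ A * C₀ * C * (1 / 2) ^ n := h2.trans h5
      _ ≤ A * C₀ * C * (1 / 2) ^ n * (2 / t * s) := le_mul_of_one_le_right h7 h6
      _ = _ := by ring
  have hgeo : ∀ D : ℝ, Summable (fun n : ℕ => D * (1 / 2 : ℝ) ^ n) := fun D =>
    (hasSum_geometric_two.mul_left D).summable
  have hcont : ∀ g : ℕ → ℝ → ℝ → ℝ → ℝ, (∀ n, KC (g n)) → (∀ t > 0, ∃ D : ℝ, ∀ n,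
      ∀ s ∈ Ioo (t / 2) (2 * t), ∀ x y, |g n s x y| ≤ D * (1 / 2) ^ n) →
      KC (fun t x y => ∑' n, g n t x y) := by
    rintro g hg hb ⟨t, x, y⟩ ⟨ht, -⟩
    simp only [mem_Ioi] at ht
    obtain ⟨D, hD⟩ := hb t ht
    apply ContinuousAt.continuousWithinAt
    have hsub : Ioo (t / 2) (2 * t) ×ˢ (univ : Set (ℝ × ℝ)) ⊆ Ioi 0 ×ˢ univ :=
      prod_mono (fun s hs => lt_trans (by positivity) hs.1) subset_rfl
    refine (continuousOn_tsum (u := fun n => D * (1 / 2 : ℝ) ^ n)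
      (s := Ioo (t / 2) (2 * t) ×ˢ (univ : Set (ℝ × ℝ))) (fun n => ContinuousOn.mono (hg n) hsub)
      (hgeo D) ?_).continuousAt ((isOpen_Ioo.prod isOpen_univ).mem_nhds
        ⟨mem_Icc_half ht, mem_univ _⟩)
    rintro n ⟨s, x', y'⟩ ⟨hs, -⟩
    exact hD n s hs x' y'
  have hΦc : KC (fun t x y => ∑' n, f n t x y) := hcont f (fun n => (hGK n).1.cont) fun t ht => by
    obtain ⟨D, hD⟩ := hloc t ht
    exact ⟨D, fun n s hs x y => (hD n s hs x y).1⟩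
  have hDΦc : KC (fun t x y => ∑' n, Df n t x y) :=
    hcont Df (fun n => (hGK n).2.1.cont) fun t ht => by
      obtain ⟨D, hD⟩ := hloc t ht
      exact ⟨D, fun n s hs x y => (hD n s hs x y).2.1⟩
  have hbd : ∀ θ : ℝ, 0 < θ → θ ≤ 1 → KBd L θ 1 K → KBd L θ 1 DK →
      KBd L θ m (fun t x y => ∑' n, f n t x y) ∧ KBd L θ m (fun t x y => ∑' n, Df n t x y) := by
    intro θ hθ hθ' h1 h2
    obtain ⟨c1, hc1, h1⟩ := h1
    obtain ⟨c2, hc2, h2⟩ := h2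
    obtain ⟨w, C, hC, gw, hw⟩ := H θ hθ hθ'
    have hmono : ∀ (c : ℝ) t x y, 0 < t → c ≤ c1 + c2 →
        c * (t ^ (θ - 1) * Real.exp (1 * t) * _root_.gk (L * t) (x - y))
        ≤ (c1 + c2) * (t ^ (θ - 1) * Real.exp (1 * t) * _root_.gk (L * t) (x - y)) := by
      intro c t x y ht hc
      have := gk_nonneg (L * t) (x - y)
      gcongr
    have B := hbound w θ (c1 + c2) gw (fun t ht => (hw t ht).1) (by positivity)
      (fun t ht x y => (h1 t ht x y).trans (hmono _ t x y ht (by linarith)))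
      (fun t ht x y => (h2 t ht x y).trans (hmono _ t x y ht (by linarith)))
    have hfin : ∀ t > 0, ∀ x y, 2 * ((c1 + c2) * (w t * _root_.gk (L * t) (x - y)))
        ≤ 2 * (c1 + c2) * C * (t ^ (θ - 1) * Real.exp (m * t) * _root_.gk (L * t) (x - y)) := by
      intro t ht x y
      have h3 := (hw t ht).2
      have h4 := gk_nonneg (L * t) (x - y)
      calc _ ≤ 2 * ((c1 + c2) * (C * (t ^ (θ - 1) * Real.exp (m * t)) * _root_.gk (L * t) (x - y))) := by
            gcongr
        _ = _ := by ring
    refine ⟨⟨2 * (c1 + c2) * C, by positivity, fun t ht x y => ?_⟩,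
      ⟨2 * (c1 + c2) * C, by positivity, fun t ht x y => ?_⟩⟩
    · exact ((abs_tsum_le_geom fun n => ((B n t ht x y).1).trans_eq (by ring)).2).trans (hfin t ht x y)
    · exact ((abs_tsum_le_geom fun n => ((B n t ht x y).2).trans_eq (by ring)).2).trans (hfin t ht x y)
  obtain ⟨hΦb, hDΦb⟩ := hbd θ₀ hθ₀ hθ₁ bK bDK
  refine ⟨fun t x y => ∑' n, f n t x y, fun t x y => ∑' n, Df n t x y,
    ⟨hΦc, hΦb⟩, ⟨hDΦc, hDΦb⟩, ?_, ?_, hbd, ?_⟩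
  · intro t ht x y
    obtain ⟨D, hD⟩ := hloc t ht
    have := hasDerivAt_tsum_of_isPreconnected (g := fun n s => f n s x y)
      (g' := fun n s => Df n s x y / s) (hgeo (D * (2 / t))) isOpen_Ioo isPreconnected_Ioo
      (fun n s hs => (hGK n).2.2 s (lt_trans (by positivity) hs.1) x y)
      (fun n s hs => (hD n s hs x y).2.2) (mem_Icc_half ht) (hsum t ht x y) (mem_Icc_half ht)
    rwa [tsum_div_const] at this
  · intro t ht x y
    -- The relation `r N = f N + r (N + 1)` for the tails telescopes `K * r 0` into a partial sum
    -- plus `K * r N`, and the contraction estimate sends the latter to zero. This takes the place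
    -- of exchanging the series with the integral.
    set r : ℕ → ℝ → ℝ → ℝ → ℝ := fun N t x y => ∑' n, f (n + N) t x y with hr
    have hrb : ∀ N, ∀ t > 0, ∀ x y, |r N t x y| ≤ 2 * A * (1 / 2) ^ N
        * (w₀ t * _root_.gk (L * t) (x - y)) := by
      intro N t ht x y
      have := (abs_tsum_le_geom (u := fun n => f (n + N) t x y)
        (B := A * (1 / 2) ^ N * (w₀ t * _root_.gk (L * t) (x - y))) fun n => by
          refine ((hbound w₀ θ₀ A gw₀ (fun t ht => (hw₀ t ht).1) hA hK' hDK' (n + N) t ht x y).1).trans_eq ?_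
          rw [pow_add]; ring).2
      linarith
    have hrG : ∀ N, GK L θ₀ m (r N) := by
      intro N
      refine ⟨hcont (fun n => f (n + N)) (fun n => (hGK (n + N)).1.cont) fun t ht => ?_,
        ⟨2 * A * (1 / 2) ^ N * C₀, by positivity, fun t ht x y => (hrb N t ht x y).trans ?_⟩⟩
      · obtain ⟨D, hD⟩ := hloc t ht
        refine ⟨D * (1 / 2) ^ N, fun n s hs x y => ((hD (n + N) s hs x y).1).trans_eq ?_⟩
        rw [pow_add]; ring
      · have h3 := (hw₀ t ht).2
        have h4 := gk_nonneg (L * t) (x - y)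
        calc _ ≤ 2 * A * (1 / 2) ^ N * (C₀ * (t ^ (θ₀ - 1) * Real.exp (m * t)) * _root_.gk (L * t) (x - y)) := by
              gcongr
          _ = _ := by ring
    have hrs : ∀ N, ∀ t > 0, ∀ x y, r N t x y = f N t x y + r (N + 1) t x y := by
      intro N t ht x y
      have := ((summable_nat_add_iff N).2 (hsum t ht x y)).tsum_eq_zero_add
      simp only [hr]
      rw [this, zero_add]
      congr 2
      funext n
      rw [show n + 1 + N = n + (N + 1) by ring]
    have hcr : ∀ N, conv K (r N) t x y = f (N + 1) t x y + conv K (r (N + 1)) t x y := by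
      intro N
      rw [conv_congr_right (hrs N) ht, conv_add_right hL hθ₀ hθ₀ gK (hGK N).1 (hrG (N + 1)) ht]
      rfl
    have hind : ∀ N, conv K (r 0) t x y = ∑ n ∈ Finset.range N, f (n + 1) t x y + conv K (r N) t x y := by
      intro N
      induction N with
      | zero => simp
      | succ N ih => rw [ih, hcr N, Finset.sum_range_succ]; ring
    have hlim1 : Tendsto (fun N => conv K (r N) t x y) atTop (𝓝 0) := by
      have hb : ∀ N, |conv K (r N) t x y|
          ≤ 1 / 6 * (2 * A * (1 / 2) ^ N) * (w₀ t * _root_.gk (L * t) (x - y)) := fun N =>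
        abs_cop_le gw₀ (propagated_gk hL y) (fun t _ x => gk_nonneg _ _) (by positivity) hK
          (F := fun s z => r N s z y) (fun s hs z => hrb N s hs z y) ht x
      refine squeeze_zero_norm hb ?_
      have h0 : Tendsto (fun N : ℕ => (1 / 2 : ℝ) ^ N) atTop (𝓝 0) :=
        tendsto_pow_atTop_nhds_zero_of_lt_one (by norm_num) (by norm_num)
      have := h0.const_mul (1 / 6 * (2 * A) * (w₀ t * _root_.gk (L * t) (x - y)))
      rw [mul_zero] at this
      refine this.congr fun N => by ring
    have hs1 : Summable (fun n => f (n + 1) t x y) := (summable_nat_add_iff 1).2 (hsum t ht x y)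
    have hlim2 := hs1.hasSum.tendsto_sum_nat.add hlim1
    have heq : conv K (r 0) t x y = (∑' n, f (n + 1) t x y) + 0 :=
      tendsto_nhds_unique tendsto_const_nhds (hlim2.congr fun N => (hind N).symm)
    change _ = K t x y + conv K (r 0) t x y
    rw [heq, add_zero]
    exact (hsum t ht x y).tsum_eq_zero_add
  · intro θ κ hθ hθ' h1 h2
    obtain ⟨c1, hc1, h1⟩ := h1
    obtain ⟨c2, hc2, h2⟩ := h2
    obtain ⟨w, C, hC, gw, hw⟩ := H (θ - κ / 2) hθ hθ'
    set c := c1 + c2 with hcdef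
    have hc0 : 0 ≤ c := by positivity
    -- Increments in `y` satisfy the recursion of the iterates themselves, with the profile centred
    -- at both `y` and `y'` and the weight of exponent `θ - κ/2`.
    have B : ∀ y y' : ℝ, ∀ n, (∀ t > 0, ∀ x, |f n t x y - f n t x y'| ≤ c * |y - y'| ^ κ * (1 / 2) ^ n
        * (w t * (_root_.gk (L * t) (x - y) + _root_.gk (L * t) (x - y')))) ∧
        ∀ t > 0, ∀ x, |Df n t x y - Df n t x y'| ≤ c * |y - y'| ^ κ * (1 / 2) ^ n
        * (w t * (_root_.gk (L * t) (x - y) + _root_.gk (L * t) (x - y'))) := by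
      intro y y' n
      have aux : ∀ (k : ℝ → ℝ → ℝ → ℝ) (c' : ℝ), c' ≤ c → (∀ t > 0, ∀ x x' y,
          |kswap k t x y - kswap k t x' y| ≤ c' * (|x - x'| ^ κ * (t ^ (θ - 1 - κ / 2) * Real.exp (1 * t)
            * (_root_.gk (L * t) (x - y) + _root_.gk (L * t) (x' - y))))) →
          ∀ t > 0, ∀ x, |k t x y - k t x y'| ≤ c * |y - y'| ^ κ
            * (w t * (_root_.gk (L * t) (x - y) + _root_.gk (L * t) (x - y'))) := by
        intro k c' hc' hk t ht x
        have h3 := (hw t ht).1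
        have h4 := gk_nonneg (L * t) (x - y)
        have h5 := gk_nonneg (L * t) (x - y')
        refine (hk t ht y y' x).trans ?_
        rw [one_mul, gk_sub_comm _ y x, gk_sub_comm _ y' x,
          show θ - 1 - κ / 2 = θ - κ / 2 - 1 by ring, mul_assoc c]
        gcongr
      exact iter_bound (g := fun n t x => f n t x y - f n t x y')
        (Dg := fun n t x => Df n t x y - Df n t x y') (c := c * |y - y'| ^ κ) gw
        ((propagated_gk hL y).add (propagated_gk hL y'))
        (fun t _ x => add_nonneg (gk_nonneg _ _) (gk_nonneg _ _)) (by positivity) hK hDK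
        (aux K c1 (by linarith) h1) (aux DK c2 (by linarith) h2)
        (fun n t ht x => conv_sub_right hL hθ₀ hθ₀ gK (hGK n).1 ht x y y')
        (fun n t ht x => by
          rw [← conv_sub_right hL hθ₀ hθ₀ gK (hGK n).1 ht x y y',
            ← conv_sub_right hL hθ₀ hθ₀ gDK (hGK n).1 ht x y y',
            ← conv_sub_right hL hθ₀ hθ₀ gK (hGK n).2.1 ht x y y']
          change _ + _ + _ - (_ + _ + _) = _
          ring) n
    have hfin : ∀ t > 0, ∀ x y y' : ℝ, 2 * (c * |y - y'| ^ κ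
        * (w t * (_root_.gk (L * t) (x - y) + _root_.gk (L * t) (x - y'))))
        ≤ 2 * c * C * (|y - y'| ^ κ * (t ^ (θ - 1 - κ / 2) * Real.exp (m * t)
          * (_root_.gk (L * t) (y - x) + _root_.gk (L * t) (y' - x)))) := by
      intro t ht x y y'
      have h3 := (hw t ht).2
      have h4 := gk_nonneg (L * t) (x - y)
      have h5 := gk_nonneg (L * t) (x - y')
      rw [gk_sub_comm _ y x, gk_sub_comm _ y' x, show θ - 1 - κ / 2 = θ - κ / 2 - 1 by ring]
      calc _ ≤ 2 * (c * |y - y'| ^ κ * (C * (t ^ (θ - κ / 2 - 1) * Real.exp (m * t))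
            * (_root_.gk (L * t) (x - y) + _root_.gk (L * t) (x - y')))) := by gcongr
        _ = _ := by ring
    have hsum' : ∀ t > 0, ∀ x y, Summable (fun n => Df n t x y) := fun t ht x y =>
      (abs_tsum_le_geom fun n => (hb0 n t ht x y).2).1
    refine ⟨⟨2 * c * C, by positivity, fun t ht y y' x => ?_⟩,
      ⟨2 * c * C, by positivity, fun t ht y y' x => ?_⟩⟩
    · simp only [kswap]
      rw [← (hsum t ht x y).tsum_sub (hsum t ht x y')]
      exact ((abs_tsum_le_geom fun n => ((B y y' n).1 t ht x).trans_eq (by ring)).2).trans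
        (hfin t ht x y y')
    · simp only [kswap]
      rw [← (hsum' t ht x y).tsum_sub (hsum' t ht x y')]
      exact ((abs_tsum_le_geom fun n => ((B y y' n).2 t ht x).trans_eq (by ring)).2).trans
        (hfin t ht x y y')

/-! ### Approximate identities with variable diffusivity -/

lemma gk_scale (u : ℝ) {τ : ℝ} (hτ : 0 < τ) (w : ℝ) : √τ * gk (u * τ) (√τ * w) = gk u w := by
  unfold gk
  have h : √(2 * Real.pi * (u * τ)) = √(2 * Real.pi * u) * √τ := by
    rw [← mul_assoc, Real.sqrt_mul' _ hτ.le]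
  have hs : √τ ≠ 0 := (Real.sqrt_pos.2 hτ).ne'
  have e : -(√τ * w) ^ 2 / (2 * (u * τ)) = -w ^ 2 / (2 * u) := by
    rw [mul_pow, Real.sq_sqrt hτ.le, show -(τ * w ^ 2) = -w ^ 2 * τ by ring,
      show 2 * (u * τ) = 2 * u * τ by ring, mul_div_mul_right _ _ hτ.ne']
  rw [h, e, mul_inv, ← mul_assoc]
  congr 1
  field_simp

lemma continuous_gk_var {b : ℝ → ℝ} (hb : Continuous b) (hb0 : ∀ z, 0 < b z) {τ : ℝ} (hτ : 0 < τ)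
    {g : ℝ → ℝ} (hg : Continuous g) : Continuous (fun z => gk (2 * b z * τ) (g z)) := by
  have h : ∀ z, √(2 * Real.pi * (2 * b z * τ)) ≠ 0 := fun z => by
    have := hb0 z
    positivity
  have h' : ∀ z, 2 * (2 * b z * τ) ≠ 0 := fun z => by
    have := hb0 z
    positivity
  unfold gk
  exact (Continuous.inv₀ (by fun_prop) h).mul
    (Real.continuous_exp.comp (Continuous.div (by fun_prop) (by fun_prop) h'))

lemma integrable_mul_of_gk_bound {k F : ℝ → ℝ} {A B u x : ℝ} (hu : 0 < u) (hk : Continuous k)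
    (hF : Continuous F) (hkb : ∀ z, |k z| ≤ A * gk u (x - z)) (hFb : ∀ z, |F z| ≤ B) :
    Integrable (fun z => k z * F z) ∧ |∫ z, k z * F z| ≤ A * B := by
  have hi : Integrable (fun z => gk u (x - z) * 1) := by simpa using integrable_gk_sub hu x
  refine ⟨?_, ?_⟩
  · refine ((integrable_gk_sub hu x).const_mul (A * B)).mono' (hk.mul hF).aestronglyMeasurable
      (Eventually.of_forall fun z => ?_)
    rw [Real.norm_eq_abs, abs_mul]
    calc _ ≤ A * gk u (x - z) * B :=
          mul_le_mul (hkb z) (hFb z) (abs_nonneg _) ((abs_nonneg _).trans (hkb z))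
      _ = _ := by ring
  · have := abs_scomp_le (h := fun _ => 1) hkb (fun z => (hFb z).trans_eq (mul_one B).symm) hi rfl
    refine this.trans_eq ?_
    simp [integral_gk_sub hu x]

/-- The parabolic rescaling `z = x - √τ w` is used. Since the diffusivity depends on `z` this is not
a convolution, but the rescaled density converges pointwise to that of variance `2 b(x₀)` and is
dominated by one fixed Gaussian. The function `F` may vary with the parameter because `Φ` at time
`t(1-ε)` will be inserted. -/
lemma tendsto_integral_gk {ι : Type*} {l : Filter ι} [l.IsCountablyGenerated] {δ M : ℝ} {b : ℝ → ℝ}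
    (hδ : 0 < δ) (hb : ∀ z, b z ∈ Icc δ M) (hbc : Continuous b) {τ x : ι → ℝ} {x₀ f₀ C : ℝ}
    {F : ι → ℝ → ℝ} (hτ : Tendsto τ l (𝓝 0)) (hτ0 : ∀ᶠ i in l, 0 < τ i)
    (hx : Tendsto x l (𝓝 x₀)) (hF : ∀ᶠ i in l, Continuous (F i))
    (hFb : ∀ᶠ i in l, ∀ z, |F i z| ≤ C)
    (hlim : Tendsto (fun p : ι × ℝ => F p.1 p.2) (l ×ˢ 𝓝 x₀) (𝓝 f₀)) :
    Tendsto (fun i => ∫ z, gk (2 * b z * τ i) (x i - z) * F i z) l (𝓝 f₀) := by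
  have hb0 : ∀ z, 0 < b z := fun z => hδ.trans_le (hb z).1
  have hM : 0 < M := (hb0 0).trans_le (hb 0).2
  obtain ⟨D, hD, hgb⟩ := gkD_bound hδ hM 0 0
  have hgb' : ∀ z w, gk (2 * b z) w ≤ D * gk (8 * M) w := by
    intro z w
    have := hgb 1 one_pos (b z) (hb z) w w (by simp)
    simpa [gkD_zero, abs_of_nonneg (gk_nonneg _ _)] using this
  have hev : ∀ᶠ i in l, ∫ w, gk (2 * b (x i - √(τ i) * w)) w * F i (x i - √(τ i) * w)
      = ∫ z, gk (2 * b z * τ i) (x i - z) * F i z := by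
    filter_upwards [hτ0] with i hi
    have hs : 0 < √(τ i) := Real.sqrt_pos.2 hi
    have h1 := Measure.integral_comp_mul_left
      (fun w => gk (2 * b (x i - w) * τ i) w * F i (x i - w)) (√(τ i))
    have h2 := integral_sub_left_eq_self
      (fun z => gk (2 * b z * τ i) (x i - z) * F i z) (volume : Measure ℝ) (x i)
    simp only [sub_sub_cancel] at h2
    rw [h2, abs_of_pos (inv_pos.2 hs), smul_eq_mul] at h1
    have h3 : ∫ w, gk (2 * b (x i - √(τ i) * w)) w * F i (x i - √(τ i) * w)
        = √(τ i) * ∫ w, gk (2 * b (x i - √(τ i) * w) * τ i) (√(τ i) * w)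
          * F i (x i - √(τ i) * w) := by
      rw [← integral_const_mul]
      congr 1
      funext w
      rw [← gk_scale (2 * b (x i - √(τ i) * w)) hi w]
      ring
    rw [h3, h1, ← mul_assoc, mul_inv_cancel₀ hs.ne', one_mul]
  refine Tendsto.congr' hev ?_
  have hlim0 : ∫ w, gk (2 * b x₀) w * f₀ = f₀ := by
    rw [integral_mul_const, integral_gk (by have := hb0 x₀; positivity), one_mul]
  rw [← hlim0]
  refine tendsto_integral_filter_of_dominated_convergence (fun w => D * gk (8 * M) w * C) ?_ ?_
    (((integrable_gk (by positivity)).const_mul D).mul_const C) (Eventually.of_forall fun w => ?_)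
  · filter_upwards [hτ0, hF] with i hi hFi
    have := continuous_gk_var (b := fun w => b (x i - √(τ i) * w)) (by fun_prop) (fun _ => hb0 _)
      one_pos continuous_id
    simp only [mul_one, id] at this
    exact (this.mul (hFi.comp (by fun_prop))).aestronglyMeasurable
  · filter_upwards [hFb] with i hi
    refine Eventually.of_forall fun w => ?_
    rw [Real.norm_eq_abs, abs_mul, abs_of_nonneg (gk_nonneg _ _)]
    have h1 := hgb' (x i - √(τ i) * w) w
    exact mul_le_mul h1 (hi _) (abs_nonneg _) ((gk_nonneg _ _).trans h1)
  · have h1 : Tendsto (fun i => x i - √(τ i) * w) l (𝓝 x₀) := by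
      have := hx.sub (((Real.continuous_sqrt.tendsto 0).comp hτ).mul_const w)
      simpa using this
    refine Tendsto.mul ?_ (hlim.comp (tendsto_id.prodMk h1))
    have h2 : ContinuousAt (fun u => gk u w) (2 * b x₀) :=
      (hasDerivAt_gk_var (by have := hb0 x₀; positivity) w).continuousAt
    exact h2.tendsto.comp (((hbc.tendsto x₀).comp h1).const_mul 2)

/-- A kernel which is close to the frozen Gaussian kernel is an approximate identity. -/
lemma tendsto_integral_kernel {ι : Type*} {l : Filter ι} [l.IsCountablyGenerated] {δ M L m ε : ℝ}
    {b : ℝ → ℝ} (hδ : 0 < δ) (hL : 0 < L) (hε : 0 < ε) (hb : ∀ z, b z ∈ Icc δ M) (hbc : Continuous b)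
    {P : ℝ → ℝ → ℝ → ℝ} (hP : GK L 1 m P)
    (hPg : KBd L (1 + ε) m (fun t x y => P t x y - gk (2 * b y * t) (x - y)))
    {τ x : ι → ℝ} {x₀ f₀ C : ℝ} {F : ι → ℝ → ℝ} (hτ : Tendsto τ l (𝓝 0))
    (hτ0 : ∀ᶠ i in l, 0 < τ i) (hx : Tendsto x l (𝓝 x₀)) (hF : ∀ᶠ i in l, Continuous (F i))
    (hFb : ∀ᶠ i in l, ∀ z, |F i z| ≤ C)
    (hlim : Tendsto (fun p : ι × ℝ => F p.1 p.2) (l ×ˢ 𝓝 x₀) (𝓝 f₀)) :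
    Tendsto (fun i => ∫ z, P (τ i) (x i) z * F i z) l (𝓝 f₀) := by
  have hb0 : ∀ z, 0 < b z := fun z => hδ.trans_le (hb z).1
  obtain ⟨C1, hC1, b1⟩ := hP.bd
  obtain ⟨C2, hC2, b2⟩ := hPg
  have hmain := tendsto_integral_gk hδ hb hbc hτ hτ0 hx hF hFb hlim
  have hdiff : Tendsto (fun i => ∫ z, (P (τ i) (x i) z - gk (2 * b z * τ i) (x i - z)) * F i z) l
      (𝓝 0) := by
    refine squeeze_zero_norm' (a := fun i => C2 * ((τ i) ^ ε * Real.exp (m * τ i)) * C) ?_ ?_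
    · filter_upwards [hτ0, hF, hFb] with i hi hFi hFbi
      refine (integrable_mul_of_gk_bound (u := L * τ i) (x := x i) (by positivity)
        ((hP.cont.continuous_right hi _).sub (continuous_gk_var hbc hb0 hi (by fun_prop)))
        hFi (fun z => ?_) hFbi).2
      refine (b2 _ hi _ _).trans_eq ?_
      rw [add_sub_cancel_left]; ring
    · have h1 : Tendsto (fun i => (τ i) ^ ε) l (𝓝 0) := by
        have := ((Real.continuousAt_rpow_const 0 ε (Or.inr hε.le)).tendsto).comp hτ
        rwa [Real.zero_rpow hε.ne'] at this
      have h2 : Tendsto (fun i => Real.exp (m * τ i)) l (𝓝 (Real.exp (m * 0))) :=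
        (Real.continuous_exp.tendsto _).comp (hτ.const_mul m)
      simpa using ((h1.mul h2).const_mul C2).mul_const C
  have := hmain.add hdiff
  rw [add_zero] at this
  refine this.congr' ?_
  filter_upwards [hτ0, hF, hFb] with i hi hFi hFbi
  have c1 := hP.cont.continuous_right hi (x i)
  have c2 := continuous_gk_var hbc hb0 hi (g := fun z => x i - z) (by fun_prop)
  have i1 := (integrable_mul_of_gk_bound (u := L * τ i) (x := x i) (by positivity) c1 hFi
    (A := C1 * ((τ i) ^ ((1 : ℝ) - 1) * Real.exp (m * τ i)))
    (fun z => (b1 _ hi _ _).trans_eq (by ring)) hFbi).1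
  have i2 := (integrable_mul_of_gk_bound (u := L * τ i) (x := x i) (by positivity)
    (k := fun z => P (τ i) (x i) z - gk (2 * b z * τ i) (x i - z)) (c1.sub c2) hFi
    (A := C2 * ((τ i) ^ (1 + ε - 1) * Real.exp (m * τ i)))
    (fun z => (b2 _ hi _ _).trans_eq (by ring)) hFbi).1
  have h3 : ∫ z, gk (2 * b z * τ i) (x i - z) * F i z = (∫ z, P (τ i) (x i) z * F i z)
      - ∫ z, (P (τ i) (x i) z - gk (2 * b z * τ i) (x i - z)) * F i z := by
    rw [← integral_sub i1 i2]
    congr 1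
    funext z
    ring
  rw [h3]; ring

/-! ### From heat-like kernels to fundamental solutions -/

/-- A kernel solving `∂_t Q = b ∂_x² Q`, with Gaussian bounds, which is close to the frozen Gaussian
kernel for small times. Here `DQ = t ∂_t Q`. -/
structure HeatLike (b : ℝ → ℝ) (L m ε : ℝ) (Q DQ Qx : ℝ → ℝ → ℝ → ℝ) : Prop where
  q : GK L 1 m Q
  dq : GK L 1 m DQ
  qx : GK L (1 / 2) m Qx
  deriv_time : HasTimeDeriv Q DQ
  deriv_space : ∀ t > 0, ∀ x y, HasDerivAt (fun x' => Q t x' y) (Qx t x y) x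
  deriv_space_two : ∀ t > 0, ∀ x y, HasDerivAt (fun x' => Qx t x' y) (DQ t x y / t / b x) x
  approx : KBd L (1 + ε) m (fun t x y => Q t x y - gk (2 * b y * t) (x - y))

/-- The second derivative is supplied in the form `∂_t u / b`, so the equation is built in and its
joint continuity reduces to that of the time derivative. -/
lemma isClassicalSolution_exp_mul {b : ℝ → ℝ} (hb : Continuous b) (hb0 : ∀ x, 0 < b x) (c : ℝ)
    {u ux ut : ℝ → ℝ → ℝ} (h1 : ∀ t > 0, ∀ x, HasDerivAt (u t) (ux t x) x)
    (h2 : ∀ t > 0, ∀ x, HasDerivAt (ux t) (ut t x / b x) x)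
    (h3 : ∀ t > 0, ∀ x, HasDerivAt (fun s => u s x) (ut t x) t)
    (hc : ContinuousOn (fun p : ℝ × ℝ => ut p.1 p.2) (Ioi 0 ×ˢ univ)) :
    IsClassicalSolution b c (fun t x => Real.exp (-c * t) * u t x) := by
  have d1 : ∀ t > 0, deriv (fun x => Real.exp (-c * t) * u t x)
      = fun x => Real.exp (-c * t) * ux t x := fun t ht =>
    funext fun x => ((h1 t ht x).const_mul _).deriv
  have d2 : ∀ t > 0, deriv (fun x => Real.exp (-c * t) * ux t x)
      = fun x => Real.exp (-c * t) * (ut t x / b x) := fun t ht =>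
    funext fun x => ((h2 t ht x).const_mul _).deriv
  have i2 : ∀ t > 0, iteratedDeriv 2 (fun x => Real.exp (-c * t) * u t x)
      = fun x => Real.exp (-c * t) * (ut t x / b x) := fun t ht => by
    rw [iteratedDeriv_succ, iteratedDeriv_one, d1 t ht, d2 t ht]
  have hcont : ContinuousOn (fun p : ℝ × ℝ => Real.exp (-c * p.1) * (ut p.1 p.2 / b p.2))
      (Ioi 0 ×ˢ univ) :=
    (Continuous.continuousOn (by fun_prop)).mul
      (hc.div (hb.comp continuous_snd).continuousOn fun p _ => (hb0 p.2).ne')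
  refine ⟨fun t ht => ?_, ?_, fun t ht x => ?_⟩
  · have hct : Continuous (fun x => Real.exp (-c * t) * (ut t x / b x)) := by
      rw [← continuousOn_univ]
      exact hcont.comp (f := fun x => (t, x)) (by fun_prop) (fun x _ => ⟨ht, mem_univ _⟩)
    rw [show (2 : WithTop ℕ∞) = 1 + 1 by norm_num, contDiff_succ_iff_deriv]
    refine ⟨fun x => ((h1 t ht x).const_mul _).differentiableAt, by simp, ?_⟩
    rw [d1 t ht, contDiff_one_iff_deriv, d2 t ht]
    exact ⟨fun x => ((h2 t ht x).const_mul _).differentiableAt, hct⟩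
  · exact hcont.congr fun p hp => by simp only [i2 p.1 hp.1]
  · rw [i2 t ht]
    have he : HasDerivAt (fun s => Real.exp (-c * s)) (Real.exp (-c * t) * (-c)) t := by
      have := ((hasDerivAt_id t).const_mul (-c)).exp
      simpa using this
    refine (he.mul (h3 t ht x)).congr_deriv ?_
    have := (hb0 x).ne'
    field_simp
    ring

lemma HeatLike.iteratedDeriv_eq {b : ℝ → ℝ} {L m ε : ℝ} {Q DQ Qx : ℝ → ℝ → ℝ → ℝ}
    (h : HeatLike b L m ε Q DQ Qx) (c : ℝ) {t : ℝ} (ht : 0 < t) (x y : ℝ) :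
    iteratedDeriv 1 (fun x => Real.exp (-c * t) * Q t x y) x = Real.exp (-c * t) * Qx t x y ∧
    iteratedDeriv 2 (fun x => Real.exp (-c * t) * Q t x y) x
      = Real.exp (-c * t) * (DQ t x y / t / b x) := by
  have d1 : deriv (fun x => Real.exp (-c * t) * Q t x y)
      = fun x => Real.exp (-c * t) * Qx t x y :=
    funext fun x => ((h.deriv_space t ht x y).const_mul _).deriv
  have d2 : deriv (fun x => Real.exp (-c * t) * Qx t x y)
      = fun x => Real.exp (-c * t) * (DQ t x y / t / b x) :=
    funext fun x => ((h.deriv_space_two t ht x y).const_mul _).deriv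
  refine ⟨by rw [iteratedDeriv_one, d1], ?_⟩
  rw [iteratedDeriv_succ, iteratedDeriv_one, d1, d2]

theorem HeatLike.isFundamentalSolution {b : ℝ → ℝ} {δ M L m ε : ℝ} (hδ : 0 < δ) (hL : 0 < L)
    (hε : 0 < ε) (hb : ∀ z, b z ∈ Icc δ M) (hbc : Continuous b) {Q DQ Qx : ℝ → ℝ → ℝ → ℝ}
    (h : HeatLike b L m ε Q DQ Qx) (c : ℝ) :
    IsFundamentalSolution b c (fun t x y => Real.exp (-c * t) * Q t x y) := by
  have hb0 : ∀ z, 0 < b z := fun z => hδ.trans_le (hb z).1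
  obtain ⟨C, hC, hQ⟩ := h.q.bd
  have hQ' : ∀ t > 0, ∀ x z, |Q t x z| ≤ C * Real.exp (m * t) * gk (L * t) (x - z) :=
    fun t ht x z => (hQ t ht x z).trans_eq (by rw [sub_self, Real.rpow_zero]; ring)
  have hf : ∀ f : ℝ →ᵇ ℝ, ∀ z, |f z| ≤ ‖f‖ := fun f z => f.norm_coe_le_norm z
  have hint : ∀ f : ℝ →ᵇ ℝ, ∀ t > 0, ∀ x, Integrable (fun z => Q t x z * f z) ∧
      |∫ z, Q t x z * f z| ≤ C * Real.exp (m * t) * ‖f‖ := fun f t ht x =>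
    integrable_mul_of_gk_bound (by positivity) (h.q.cont.continuous_right ht x) f.continuous
      (hQ' t ht x) (hf f)
  have hpull : ∀ (f : ℝ →ᵇ ℝ) t x, ∫ y, Real.exp (-c * t) * Q t x y * f y
      = Real.exp (-c * t) * ∫ y, Q t x y * f y := by
    intro f t x
    rw [← integral_const_mul]
    simp only [mul_assoc]
  constructor
  · exact (Continuous.continuousOn (by fun_prop)).mul h.q.cont
  · intro y
    exact (isClassicalSolution_exp_mul hbc hb0 c (u := fun t x => Q t x y)
      (ux := fun t x => Qx t x y) (ut := fun t x => DQ t x y / t)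
      (fun t ht x => h.deriv_space t ht x y) (fun t ht x => h.deriv_space_two t ht x y)
      (fun t ht x => h.deriv_time t ht x y)
      (h.dq.cont.div_time.comp (f := fun p : ℝ × ℝ => (p.1, p.2, y)) (by fun_prop)
        (fun p hp => ⟨hp.1, mem_univ _⟩)))
  · intro t ht x
    refine Integrable.const_mul ?_ _
    refine ((integrable_gk_sub (mul_pos hL ht) x).const_mul (C * Real.exp (m * t))).mono'
      (h.q.cont.continuous_right ht x).aestronglyMeasurable (Eventually.of_forall (hQ' t ht x))
  · intro f
    simp only [hpull]
    -- The initial datum is viewed as a kernel independent of time and of its second space variable,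
    -- so that the composition lemmas apply. Its time derivative is the zero kernel, and the time
    -- `1` and the point `0` below are dummies.
    have cf : KC (fun _ z _ => f z) :=
      Continuous.continuousOn (f.continuous.comp (continuous_fst.comp continuous_snd))
    have bf : LBdd (fun _ z _ => f z) := fun s₀ _ y₀ => ⟨‖f‖, fun _ _ _ _ z => hf f z⟩
    have c0 : KC (fun _ _ _ => 0) := continuousOn_const
    have b0 : LBdd (fun _ _ _ => 0) := fun s₀ _ y₀ => ⟨0, fun _ _ _ _ z => by simp⟩
    have gD := h.dq.bd.div_time.lgau hL
    have cD := h.dq.cont.div_time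
    have hpxx : KC (fun t x y => DQ t x y / t / b x) :=
      cD.div (hbc.comp (continuous_fst.comp continuous_snd)).continuousOn fun p _ => (hb0 _).ne'
    have gpxx : LGau (fun t x y => DQ t x y / t / b x) := by
      intro τ₀ hτ₀ x₀
      obtain ⟨C, ρ, hρ, H⟩ := gD τ₀ hτ₀ x₀
      refine ⟨C / δ, ρ, hρ, fun τ hτ x hx z => ?_⟩
      have := H τ hτ x hx z
      rw [abs_div, abs_of_pos (hb0 x), div_mul_eq_mul_div]
      exact div_le_div₀ ((abs_nonneg _).trans this) this hδ (hb x).1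
    refine isClassicalSolution_exp_mul hbc hb0 c
      (u := fun t x => scomp Q (fun _ z _ => f z) t 1 x 0)
      (ux := fun t x => scomp Qx (fun _ z _ => f z) t 1 x 0)
      (ut := fun t x => scomp (fun t x y => DQ t x y / t) (fun _ z _ => f z) t 1 x 0)
      (fun t ht x => ?_) (fun t ht x => ?_) (fun t ht x => ?_) ?_
    · exact hasDerivAt_scomp_space h.q.cont (h.q.bd.lgau hL) h.qx.cont (h.qx.bd.lgau hL) cf bf
        h.deriv_space ht one_pos x 0
    · refine (hasDerivAt_scomp_space h.qx.cont (h.qx.bd.lgau hL) hpxx gpxx cf bf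
        h.deriv_space_two ht one_pos x 0).congr_deriv ?_
      unfold scomp
      rw [div_eq_mul_inv, ← integral_mul_const]
      congr 1
      funext z
      ring
    · have := hasDerivAt_scomp_time h.q.cont (h.q.bd.lgau hL) cD gD cf bf c0 b0 h.deriv_time
        (fun t _ z y => hasDerivAt_const t (f z)) 0 1 1 0 (r := t) (by simpa) (by simp) x 0
      simpa using this
    · exact (scomp_continuousOn cD gD cf bf).comp (f := fun p : ℝ × ℝ => (p.1, 1, p.2, 0))
        (by fun_prop) (fun p hp => ⟨hp.1, mem_Ioi.2 one_pos, mem_univ _⟩)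
  · intro f T hT
    refine ⟨Real.exp (|c| * T) * (C * Real.exp (|m| * T) * ‖f‖), fun t ht x => ?_⟩
    rw [hpull, abs_mul, Real.abs_exp]
    have e : ∀ r : ℝ, r * t ≤ |r| * T := fun r =>
      (mul_le_mul_of_nonneg_right (le_abs_self r) ht.1.le).trans
        (mul_le_mul_of_nonneg_left ht.2 (abs_nonneg r))
    have e1 : -c * t ≤ |c| * T := by simpa using e (-c)
    refine mul_le_mul (Real.exp_le_exp.2 e1) (((hint f t ht.1 x).2).trans ?_) (abs_nonneg _)
      (Real.exp_pos _).le
    have := e m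
    gcongr
  · intro f x
    simp only [hpull]
    have h1 : Tendsto (fun p : ℝ × ℝ => p.1) (𝓝[>] 0 ×ˢ 𝓝 x) (𝓝 0) :=
      tendsto_fst.mono_right nhdsWithin_le_nhds
    have h2 : ∀ᶠ p : ℝ × ℝ in 𝓝[>] 0 ×ˢ 𝓝 x, 0 < p.1 :=
      tendsto_fst.eventually self_mem_nhdsWithin
    have := tendsto_integral_kernel hδ hL hε hb hbc h.q h.approx (F := fun _ z => f z) (C := ‖f‖)
      h1 h2 tendsto_snd (Eventually.of_forall fun _ => f.continuous)
      (Eventually.of_forall fun _ => hf f) ((f.continuous.tendsto x).comp tendsto_snd)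
    have h3 : Tendsto (fun p : ℝ × ℝ => Real.exp (-c * p.1)) (𝓝[>] 0 ×ˢ 𝓝 x) (𝓝 (Real.exp (-c * 0))) :=
      (Real.continuous_exp.tendsto _).comp (h1.const_mul (-c))
    simpa using h3.mul this

/-! ### The second space derivative of the convolution -/

lemma tendsto_intervalIntegral_trunc {f : ℝ → ℝ} (hf : IntegrableOn f (Ioo 0 1)) :
    Tendsto (fun ε => ∫ σ in ε..(1 - ε), f σ) (𝓝[>] 0) (𝓝 (∫ σ in Ioo (0 : ℝ) 1, f σ)) := by
  have hf' : IntegrableOn f (Icc 0 1) := by rwa [integrableOn_Icc_iff_integrableOn_Ioo]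
  have hc := intervalIntegral.continuousOn_primitive_interval (a := (0 : ℝ)) (b := 1) (f := f)
    (μ := volume) (by rwa [uIcc_of_le zero_le_one])
  rw [uIcc_of_le zero_le_one] at hc
  have hI : ∀ x ∈ Icc (0 : ℝ) 1, IntervalIntegrable f volume 0 x := fun x hx => by
    rw [intervalIntegrable_iff_integrableOn_Icc_of_le hx.1]
    exact hf'.mono_set (Icc_subset_Icc_right hx.2)
  have hev : ∀ᶠ ε : ℝ in 𝓝[>] 0, ε ∈ Ioo (0 : ℝ) (1 / 2) := Ioo_mem_nhdsGT (by norm_num)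
  have e1 : Tendsto (fun ε : ℝ => ε) (𝓝[>] 0) (𝓝[Icc 0 1] 0) :=
    tendsto_nhdsWithin_iff.2 ⟨tendsto_id.mono_left nhdsWithin_le_nhds, by
      filter_upwards [hev] with ε hε using ⟨hε.1.le, by linarith [hε.2]⟩⟩
  have e2 : Tendsto (fun ε : ℝ => 1 - ε) (𝓝[>] 0) (𝓝[Icc 0 1] 1) := by
    refine tendsto_nhdsWithin_iff.2 ⟨?_, ?_⟩
    · have : Tendsto (fun ε : ℝ => 1 - ε) (𝓝 0) (𝓝 (1 - 0)) := by
        apply Continuous.tendsto; fun_prop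
      rw [sub_zero] at this
      exact this.mono_left nhdsWithin_le_nhds
    · filter_upwards [hev] with ε hε using ⟨by linarith [hε.2], by linarith [hε.1]⟩
  have l1 := (hc 0 (by simp)).tendsto.comp e1
  have l2 := (hc 1 (by simp)).tendsto.comp e2
  have := l2.sub l1
  simp only [intervalIntegral.integral_same, sub_zero] at this
  rw [intervalIntegral.integral_of_le zero_le_one, integral_Ioc_eq_integral_Ioo] at this
  refine this.congr' ?_
  filter_upwards [hev] with ε hε
  simp only [Function.comp]
  rw [intervalIntegral.integral_interval_sub_left]
  · exact hI _ ⟨by linarith [hε.2], by linarith [hε.1]⟩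
  · exact hI _ ⟨hε.1.le, by linarith [hε.2]⟩

lemma abs_intervalIntegral_trunc_le {f g : ℝ → ℝ} (hg : IntegrableOn g (Ioo 0 1))
    (hfg : ∀ σ ∈ Ioo (0 : ℝ) 1, |f σ| ≤ g σ) {ε : ℝ} (hε : ε ∈ Ioo (0 : ℝ) (1 / 2)) :
    |∫ σ in ε..(1 - ε), f σ| ≤ ∫ σ in Ioo (0 : ℝ) 1, g σ := by
  have hsub : Ioc ε (1 - ε) ⊆ Ioo 0 1 := fun σ hσ =>
    ⟨hε.1.trans hσ.1, lt_of_le_of_lt hσ.2 (by linarith [hε.1])⟩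
  rw [intervalIntegral.integral_of_le (by linarith [hε.2]), ← Real.norm_eq_abs]
  refine (norm_integral_le_of_norm_le (hg.mono_set hsub) ?_).trans ?_
  · filter_upwards [ae_restrict_mem measurableSet_Ioc] with σ hσ using hfg σ (hsub hσ)
  · refine setIntegral_mono_set hg ?_ (LE.le.eventuallyLE hsub)
    filter_upwards [ae_restrict_mem measurableSet_Ioo] with σ hσ
    exact (abs_nonneg _).trans (hfg σ hσ)

/-- A parametrix of `∂_t - b ∂_x²`: here `DP = t ∂_t P` and `K = b ∂_x² P - ∂_t P`. -/
structure Parametrix (b : ℝ → ℝ) (L m θ₀ : ℝ) (P DP Px K : ℝ → ℝ → ℝ → ℝ) : Prop where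
  p : GK L 1 m P
  dp : GK L 1 m DP
  px : GK L (1 / 2) m Px
  k : GK L θ₀ m K
  deriv_time : HasTimeDeriv P DP
  deriv_space : ∀ t > 0, ∀ x y, HasDerivAt (fun x' => P t x' y) (Px t x y) x
  deriv_space_two : ∀ t > 0, ∀ x y,
    HasDerivAt (fun x' => Px t x' y) ((DP t x y / t + K t x y) / b x) x
  approx : KBd L (1 + θ₀) m (fun t x y => P t x y - gk (2 * b y * t) (x - y))

lemma LGau.add {f g : ℝ → ℝ → ℝ → ℝ} (hf : LGau f) (hg : LGau g) :
    LGau (fun t x y => f t x y + g t x y) := by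
  intro τ₀ hτ₀ x₀
  obtain ⟨C, ρ, hρ, hf⟩ := hf τ₀ hτ₀ x₀
  obtain ⟨D, ρ', hρ', hg⟩ := hg τ₀ hτ₀ x₀
  refine ⟨|C| + |D|, min ρ ρ', lt_min hρ hρ', fun τ hτ x hx z => ?_⟩
  have h1 := hf τ hτ x hx z
  have h2 := hg τ hτ x hx z
  have e : ∀ r, min ρ ρ' ≤ r → Real.exp (-r * (z - x₀) ^ 2)
      ≤ Real.exp (-(min ρ ρ') * (z - x₀) ^ 2) := fun r hr =>
    Real.exp_le_exp.2 (by nlinarith [sq_nonneg (z - x₀)])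
  have h3 : C * Real.exp (-ρ * (z - x₀) ^ 2) ≤ |C| * Real.exp (-(min ρ ρ') * (z - x₀) ^ 2) :=
    mul_le_mul (le_abs_self C) (e ρ (min_le_left _ _)) (Real.exp_pos _).le (abs_nonneg _)
  have h4 : D * Real.exp (-ρ' * (z - x₀) ^ 2) ≤ |D| * Real.exp (-(min ρ ρ') * (z - x₀) ^ 2) :=
    mul_le_mul (le_abs_self D) (e ρ' (min_le_right _ _)) (Real.exp_pos _).le (abs_nonneg _)
  refine (abs_add_le _ _).trans ?_
  linarith

lemma LGau.div_left {f : ℝ → ℝ → ℝ → ℝ} (hf : LGau f) {b : ℝ → ℝ} {δ : ℝ} (hδ : 0 < δ)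
    (hb : ∀ x, δ ≤ b x) : LGau (fun t x y => f t x y / b x) := by
  intro τ₀ hτ₀ x₀
  obtain ⟨C, ρ, hρ, H⟩ := hf τ₀ hτ₀ x₀
  refine ⟨C / δ, ρ, hρ, fun τ hτ x hx z => ?_⟩
  have := H τ hτ x hx z
  rw [abs_div, abs_of_pos (hδ.trans_le (hb x)), div_mul_eq_mul_div]
  exact div_le_div₀ ((abs_nonneg _).trans this) this hδ (hb x)

lemma KC.div_left {f : ℝ → ℝ → ℝ → ℝ} (hf : KC f) {b : ℝ → ℝ} (hb : Continuous b)
    (hb0 : ∀ x, 0 < b x) : KC (fun t x y => f t x y / b x) :=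
  ContinuousOn.div hf (hb.comp (continuous_fst.comp continuous_snd)).continuousOn
    fun _ _ => (hb0 _).ne'

/-- Uniform bounds for the spatial compositions at complementary times. -/
lemma exists_scomp_scale_le {L a b m : ℝ} (hL : 0 < L) {k f : ℝ → ℝ → ℝ → ℝ} (hk : KBd L a m k)
    (hf : KBd L b m f) {t : ℝ} (ht : 0 < t) : ∃ D : ℝ, 0 ≤ D ∧ ∀ σ ∈ Ioo (0 : ℝ) 1, ∀ x y,
      |scomp k f (t * (1 - σ)) (t * σ) x y| ≤ D * ((1 - σ) ^ (a - 1) * σ ^ (b - 1)) := by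
  obtain ⟨A, hA, hk⟩ := hk
  obtain ⟨B, hB, hf⟩ := hf
  refine ⟨A * B * (t ^ (a + b - 2) * Real.exp (m * t) * (√(2 * Real.pi * (L * t)))⁻¹),
    by positivity, fun σ hσ x y => ?_⟩
  refine (abs_scomp_scale_le hL hk hf ht hσ x y).trans ?_
  have h3 : 0 < σ := hσ.1
  have h4 : 0 < 1 - σ := by linarith [hσ.2]
  gcongr
  exact gk_le (by positivity) _

lemma continuousOn_scomp_scale {k f : ℝ → ℝ → ℝ → ℝ} (hk : KC k) (hk' : LGau k) (hf : KC f)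
    (hf' : LBdd f) {t : ℝ} (ht : 0 < t) (y : ℝ) :
    ContinuousOn (fun p : ℝ × ℝ => scomp k f (t * (1 - p.2)) (t * p.2) p.1 y)
      (univ ×ˢ Ioo 0 1) :=
  (scomp_continuousOn hk hk' hf hf').comp
    (f := fun p : ℝ × ℝ => (t * (1 - p.2), t * p.2, p.1, y)) (by fun_prop)
    (fun _ hp => ⟨mul_one_sub_pos ht hp.2, mul_Ioo_pos ht hp.2, mem_univ _⟩)

/-- The truncated identity for the increments of a differentiable family of kernels. -/
lemma integral_trunc_sub_eq {J H : ℝ → ℝ → ℝ} (hH : ContinuousOn (fun p : ℝ × ℝ => H p.1 p.2)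
      (univ ×ˢ Ioo 0 1)) (hJ : ContinuousOn (fun p : ℝ × ℝ => J p.1 p.2) (univ ×ˢ Ioo 0 1))
    (hd : ∀ σ ∈ Ioo (0 : ℝ) 1, ∀ x, HasDerivAt (fun x' => J x' σ) (H x σ) x) {ε : ℝ}
    (hε : ε ∈ Ioo (0 : ℝ) (1 / 2)) (x₁ x₂ : ℝ) :
    (∫ σ in ε..(1 - ε), J x₂ σ) - ∫ σ in ε..(1 - ε), J x₁ σ
        = ∫ x in x₁..x₂, ∫ σ in ε..(1 - ε), H x σ ∧
      AEStronglyMeasurable (fun x => ∫ σ in ε..(1 - ε), H x σ) (volume.restrict (uIoc x₁ x₂)) := by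
  have hle : ε ≤ 1 - ε := by linarith [hε.2]
  have hsub : Icc ε (1 - ε) ⊆ Ioo 0 1 := fun σ hσ =>
    ⟨hε.1.trans_le hσ.1, lt_of_le_of_lt hσ.2 (by linarith [hε.1])⟩
  have hint : IntegrableOn (Function.uncurry H) (uIoc x₁ x₂ ×ˢ uIoc ε (1 - ε)) := by
    have : IntegrableOn (Function.uncurry H) (uIcc x₁ x₂ ×ˢ uIcc ε (1 - ε)) := by
      refine ContinuousOn.integrableOn_compact (isCompact_uIcc.prod isCompact_uIcc) ?_
      rw [uIcc_of_le hle]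
      exact hH.mono (prod_mono (subset_univ _) hsub)
    exact this.mono_set (prod_mono uIoc_subset_uIcc uIoc_subset_uIcc)
  have hJi : ∀ x, IntervalIntegrable (J x) volume ε (1 - ε) := fun x =>
    ContinuousOn.intervalIntegrable_of_Icc hle
      (hJ.comp (f := fun σ => (x, σ)) (by fun_prop) (fun σ hσ => ⟨mem_univ _, hsub hσ⟩))
  refine ⟨?_, ?_⟩
  · rw [intervalIntegral_intervalIntegral_swap hint, ← intervalIntegral.integral_sub (hJi _) (hJi _)]
    refine intervalIntegral.integral_congr fun σ hσ => ?_
    rw [uIcc_of_le hle] at hσ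
    have hσ' := hsub hσ
    have hc : Continuous (fun x => H x σ) := by
      rw [← continuousOn_univ]
      exact hH.comp (f := fun x => (x, σ)) (by fun_prop) (fun x _ => ⟨mem_univ _, hσ'⟩)
    exact (intervalIntegral.integral_eq_sub_of_hasDerivAt (fun x _ => hd σ hσ' x)
      (hc.intervalIntegrable _ _)).symm
  · rw [IntegrableOn, Measure.volume_eq_prod, ← Measure.prod_restrict] at hint
    have := hint.integral_prod_left.aestronglyMeasurable
    simp only [intervalIntegral.integral_of_le hle]
    rwa [uIoc_of_le hle] at this

/-- The composition of `∂_x² P` with `Φ` has a nonintegrable bound at `σ = 1`. On `(ε, 1-ε)` one has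
`b ∂_x² P = ∂_t P + K`, and `t` times the part with `∂_t P` equals the integrable combination `T`
minus the total derivative of `σ S0`. The boundary term at `1-ε` tends to `Φ(t,x,y)`, since `P` is
an approximate identity, and the one at `ε` vanishes. The Volterra equation turns `-Φ + K * Φ` into
`-K`. The limit is taken after integrating in `x`, so no limit has to be differentiated. -/
theorem Parametrix.hasDerivAt_conv {b : ℝ → ℝ} {δ M L m θ₀ : ℝ} (hδ : 0 < δ) (hL : 0 < L)
    (hθ₀ : 0 < θ₀) (hb : ∀ z, b z ∈ Icc δ M) (hbc : Continuous b)
    {P DP Px K Φ DΦ : ℝ → ℝ → ℝ → ℝ} (hP : Parametrix b L m θ₀ P DP Px K) (hΦ : GK L θ₀ m Φ)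
    (hDΦ : GK L θ₀ m DΦ) (dΦ : HasTimeDeriv Φ DΦ)
    (heq : ∀ t > 0, ∀ x y, Φ t x y = K t x y + conv K Φ t x y) {t : ℝ} (ht : 0 < t) (x y : ℝ) :
    HasDerivAt (fun x' => conv Px Φ t x' y)
      (((conv P Φ t x y + conv DP Φ t x y + conv P DΦ t x y) / t - K t x y) / b x) x := by
  have hb0 : ∀ z, 0 < b z := fun z => hδ.trans_le (hb z).1
  have h1 : (0 : ℝ) < 1 := one_pos
  have hh : (0 : ℝ) < 1 / 2 := by norm_num
  have gP := hP.p.bd.lgau hL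
  have cDP := hP.dp.cont.div_time
  have gDP := hP.dp.bd.div_time.lgau hL
  have gK := hP.k.bd.lgau hL
  have bΦ := hΦ.bd.lbdd hL
  have bDΦ := hDΦ.bd.lbdd hL
  set S0 : ℝ → ℝ → ℝ := fun x σ => scomp P Φ (t * (1 - σ)) (t * σ) x y with hS0
  set T : ℝ → ℝ → ℝ := fun x σ => S0 x σ + scomp DP Φ (t * (1 - σ)) (t * σ) x y
    + scomp P DΦ (t * (1 - σ)) (t * σ) x y with hT
  set SK : ℝ → ℝ → ℝ := fun x σ => scomp K Φ (t * (1 - σ)) (t * σ) x y with hSK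
  set A : ℝ → ℝ → ℝ := fun x σ => scomp (fun t x y => DP t x y / t) Φ (t * (1 - σ)) (t * σ) x y
    with hA
  set J : ℝ → ℝ → ℝ := fun x σ => scomp Px Φ (t * (1 - σ)) (t * σ) x y with hJ
  set H : ℝ → ℝ → ℝ := fun x σ => (A x σ + SK x σ) / b x with hH
  have cA := continuousOn_scomp_scale cDP gDP hΦ.cont bΦ ht y
  have cSK := continuousOn_scomp_scale hP.k.cont gK hΦ.cont bΦ ht y
  have cS0 := continuousOn_scomp_scale hP.p.cont gP hΦ.cont bΦ ht y
  have cSD := continuousOn_scomp_scale hP.dp.cont (hP.dp.bd.lgau hL) hΦ.cont bΦ ht y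
  have cSP := continuousOn_scomp_scale hP.p.cont gP hDΦ.cont bDΦ ht y
  have cH : ContinuousOn (fun p : ℝ × ℝ => H p.1 p.2) (univ ×ˢ Ioo 0 1) :=
    (cA.add cSK).div (hbc.comp continuous_fst).continuousOn fun p _ => (hb0 _).ne'
  have cJ := continuousOn_scomp_scale hP.px.cont (hP.px.bd.lgau hL) hΦ.cont bΦ ht y
  have hd : ∀ σ ∈ Ioo (0 : ℝ) 1, ∀ x, HasDerivAt (fun x' => J x' σ) (H x σ) x := by
    intro σ hσ x
    have h2 := mul_one_sub_pos ht hσ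
    have h3 := mul_Ioo_pos ht hσ
    refine (hasDerivAt_scomp_space hP.px.cont (hP.px.bd.lgau hL)
      ((cDP.add hP.k.cont).div_left hbc hb0) ((gDP.add gK).div_left hδ fun x => (hb x).1)
      hΦ.cont bΦ hP.deriv_space_two h2 h3 x y).congr_deriv ?_
    simp only [hH, hA, hSK, scomp]
    rw [← integral_add (integrable_scomp cDP gDP hΦ.cont bΦ h2 h3 x y)
      (integrable_scomp hP.k.cont gK hΦ.cont bΦ h2 h3 x y), div_eq_mul_inv, ← integral_mul_const]
    congr 1
    funext z
    ring
  -- the time derivative as a total derivative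
  have hdS : ∀ σ ∈ Ioo (0 : ℝ) 1, ∀ x,
      HasDerivAt (fun σ => σ * S0 x σ) (T x σ - t * A x σ) σ := by
    intro σ hσ x
    have h2 := mul_one_sub_pos ht hσ
    have h3 := mul_Ioo_pos ht hσ
    have e1 : t + -t * σ = t * (1 - σ) := by ring
    have h4 := hasDerivAt_scomp_time hP.p.cont gP cDP gDP hΦ.cont bΦ hDΦ.cont.div_time
      (hDΦ.bd.div_time.lbdd hL) hP.deriv_time dΦ t (-t) 0 t (r := σ) (by rwa [e1])
      (by rwa [zero_add]) x y
    rw [e1, zero_add] at h4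
    have h5 : HasDerivAt (fun σ => S0 x σ)
        (-t * A x σ + t * scomp P (fun t x y => DΦ t x y / t) (t * (1 - σ)) (t * σ) x y) σ := by
      refine HasDerivAt.congr_of_eventuallyEq h4 (Eventually.of_forall fun r => ?_)
      simp only [hS0]
      rw [show t + -t * r = t * (1 - r) by ring, zero_add]
    refine ((hasDerivAt_id σ).mul h5).congr_deriv ?_
    have e2 : scomp DP Φ (t * (1 - σ)) (t * σ) x y = t * (1 - σ) * A x σ := by
      simp only [hA, scomp]
      rw [← integral_const_mul]
      congr 1
      funext z
      have := (sub_pos.2 hσ.2).ne'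
      field_simp
    have e3 : scomp P DΦ (t * (1 - σ)) (t * σ) x y
        = t * σ * scomp P (fun t x y => DΦ t x y / t) (t * (1 - σ)) (t * σ) x y := by
      simp only [scomp]
      rw [← integral_const_mul]
      congr 1
      funext z
      have := hσ.1.ne'
      field_simp
    simp only [hT, e2, e3, id]
    ring
  obtain ⟨D0, hD0, bS0⟩ := exists_scomp_scale_le hL hP.p.bd hΦ.bd ht
  obtain ⟨D1, hD1, bSD⟩ := exists_scomp_scale_le hL hP.dp.bd hΦ.bd ht
  obtain ⟨D2, hD2, bSP⟩ := exists_scomp_scale_le hL hP.p.bd hDΦ.bd ht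
  obtain ⟨D3, hD3, bSK⟩ := exists_scomp_scale_le hL hP.k.bd hΦ.bd ht
  have bT : ∀ x, ∀ σ ∈ Ioo (0 : ℝ) 1,
      |T x σ| ≤ (D0 + D1 + D2) * ((1 - σ) ^ ((1 : ℝ) - 1) * σ ^ (θ₀ - 1)) := by
    intro x σ hσ
    refine (abs_add_three _ _ _).trans ?_
    linarith [bS0 σ hσ x y, bSD σ hσ x y, bSP σ hσ x y]
  -- The factor `σ` compensates the singularity `σ^{θ₀-1}` of `Φ` at small times. It is the same
  -- factor that lets `t ∂_t Φ`, rather than `∂_t Φ`, appear in `T`.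
  have bσS0 : ∀ x, ∀ σ ∈ Ioo (0 : ℝ) 1, |σ * S0 x σ| ≤ D0 * σ ^ θ₀ := by
    intro x σ hσ
    rw [abs_mul, abs_of_pos hσ.1]
    have := mul_le_mul_of_nonneg_left (bS0 σ hσ x y) hσ.1.le
    refine this.trans_eq ?_
    rw [sub_self, Real.rpow_zero, Real.rpow_sub_one hσ.1.ne']
    have := hσ.1.ne'
    field_simp
  have iT : ∀ x, IntegrableOn (T x) (Ioo 0 1) := fun x =>
    ((integrableOn_scomp hL h1 hθ₀ hP.p hΦ ht x y).add
      (integrableOn_scomp hL h1 hθ₀ hP.dp hΦ ht x y)).add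
      (integrableOn_scomp hL h1 hθ₀ hP.p hDΦ ht x y)
  have iSK : ∀ x, IntegrableOn (SK x) (Ioo 0 1) := fun x =>
    integrableOn_scomp hL hθ₀ hθ₀ hP.k hΦ ht x y
  -- the truncated second derivative
  have hG : ∀ ε ∈ Ioo (0 : ℝ) (1 / 2), ∀ x, t * ∫ σ in ε..(1 - ε), H x σ
      = ((∫ σ in ε..(1 - ε), T x σ) - ((1 - ε) * S0 x (1 - ε) - ε * S0 x ε)
        + t * ∫ σ in ε..(1 - ε), SK x σ) / b x := by
    intro ε hε x
    have hle : ε ≤ 1 - ε := by linarith [hε.2]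
    have hsub : Icc ε (1 - ε) ⊆ Ioo 0 1 := fun σ hσ =>
      ⟨hε.1.trans_le hσ.1, lt_of_le_of_lt hσ.2 (by linarith [hε.1])⟩
    have hI : ∀ {g : ℝ → ℝ → ℝ}, ContinuousOn (fun p : ℝ × ℝ => g p.1 p.2) (univ ×ˢ Ioo 0 1) →
        IntervalIntegrable (g x) volume ε (1 - ε) := fun hg =>
      ContinuousOn.intervalIntegrable_of_Icc hle
        (hg.comp (f := fun σ => (x, σ)) (by fun_prop) (fun σ hσ => ⟨mem_univ _, hsub hσ⟩))
    have iA := hI (g := A) cA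
    have iS := hI (g := SK) cSK
    have iT' : IntervalIntegrable (T x) volume ε (1 - ε) := hI ((cS0.add cSD).add cSP)
    have e1 := intervalIntegral.integral_eq_sub_of_hasDerivAt (f := fun σ => σ * S0 x σ)
      (a := ε) (b := 1 - ε) (f' := fun σ => T x σ - t * A x σ)
      (fun σ hσ => hdS σ (hsub (by rwa [uIcc_of_le hle] at hσ)) x) (iT'.sub (iA.const_mul t))
    rw [intervalIntegral.integral_sub iT' (iA.const_mul t), intervalIntegral.integral_const_mul] at e1
    have e2 : ∫ σ in ε..(1 - ε), H x σ
        = ((∫ σ in ε..(1 - ε), A x σ) + ∫ σ in ε..(1 - ε), SK x σ) / b x := by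
      rw [← intervalIntegral.integral_add iA iS, ← intervalIntegral.integral_div]
    rw [e2, ← e1]
    ring
  set g : ℝ → ℝ := fun x =>
    ((conv P Φ t x y + conv DP Φ t x y + conv P DΦ t x y) / t - K t x y) / b x with hg
  have hev : ∀ᶠ ε : ℝ in 𝓝[>] 0, ε ∈ Ioo (0 : ℝ) (1 / 2) := Ioo_mem_nhdsGT (by norm_num)
  have hlimG : ∀ x, Tendsto (fun ε => t * ∫ σ in ε..(1 - ε), H x σ) (𝓝[>] 0) (𝓝 (g x)) := by
    intro x
    have l1 := tendsto_intervalIntegral_trunc (iT x)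
    have l2 := (tendsto_intervalIntegral_trunc (iSK x)).const_mul t
    have l3 : Tendsto (fun ε => ε * S0 x ε) (𝓝[>] 0) (𝓝 0) := by
      refine squeeze_zero_norm' (a := fun ε => D0 * ε ^ θ₀) ?_ ?_
      · filter_upwards [hev] with ε hε
        exact bσS0 x ε ⟨hε.1, by linarith [hε.2]⟩
      · have := ((Real.continuousAt_rpow_const 0 θ₀ (Or.inr hθ₀.le)).tendsto).const_mul D0
        rw [Real.zero_rpow hθ₀.ne', mul_zero] at this
        exact this.mono_left nhdsWithin_le_nhds
    have hz : Tendsto (fun ε : ℝ => ε) (𝓝[>] 0) (𝓝 0) := tendsto_id.mono_left nhdsWithin_le_nhds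
    have l4 : Tendsto (fun ε => S0 x (1 - ε)) (𝓝[>] 0) (𝓝 (Φ t x y)) := by
      obtain ⟨C, hC⟩ := bΦ t ht y
      have e : ∀ ε : ℝ, S0 x (1 - ε) = ∫ z, P (t * ε) x z * Φ (t * (1 - ε)) z y := fun ε => by
        simp only [hS0, scomp, sub_sub_cancel]
      simp only [e]
      refine tendsto_integral_kernel (C := C) (x := fun _ => x)
        (F := fun ε z => Φ (t * (1 - ε)) z y) (τ := fun ε => t * ε) hδ hL hθ₀ hb hbc hP.p hP.approx
        (by simpa using hz.const_mul t) ?_ tendsto_const_nhds ?_ ?_ ?_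
      · filter_upwards [hev] with ε hε using mul_pos ht hε.1
      · filter_upwards [hev] with ε hε
        exact hΦ.cont.continuous_left (mul_pos ht (by linarith [hε.2])) y
      · filter_upwards [hev] with ε hε z
        exact hC _ ⟨by nlinarith [hε.2], by nlinarith [hε.1]⟩ y (by simp) z
      · have l5 : Tendsto (fun p : ℝ × ℝ => (t * (1 - p.1), p.2, y)) (𝓝[>] 0 ×ˢ 𝓝 x)
            (𝓝 (t, x, y)) := by
          have : Tendsto (fun p : ℝ × ℝ => (t * (1 - p.1), p.2, y)) (𝓝 ((0 : ℝ), x))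
              (𝓝 (t * (1 - 0), x, y)) := by
            apply Continuous.tendsto'
            · fun_prop
            · rfl
          rw [sub_zero, mul_one, nhds_prod_eq] at this
          exact this.mono_left (Filter.prod_mono nhdsWithin_le_nhds le_rfl)
        exact (hΦ.cont.continuousAt ht x y).tendsto.comp l5
    have l6 : Tendsto (fun ε => (1 - ε) * S0 x (1 - ε)) (𝓝[>] 0) (𝓝 (Φ t x y)) := by
      have := (tendsto_const_nhds (x := (1 : ℝ)).sub hz).mul l4
      simpa using this
    have l7 := ((l1.sub (l6.sub l3)).add l2).div_const (b x)
    have e : ((∫ σ in Ioo (0 : ℝ) 1, T x σ) - (Φ t x y - 0) + t * ∫ σ in Ioo (0 : ℝ) 1, SK x σ) / b x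
        = g x := by
      simp only [hg]
      congr 1
      have e1 : conv P Φ t x y + conv DP Φ t x y + conv P DΦ t x y
          = t * ∫ σ in Ioo (0 : ℝ) 1, T x σ := by
        have i1 := integrableOn_scomp hL h1 hθ₀ hP.p hΦ ht x y
        have i2 := integrableOn_scomp hL h1 hθ₀ hP.dp hΦ ht x y
        have i3 := integrableOn_scomp hL h1 hθ₀ hP.p hDΦ ht x y
        have : ∫ σ in Ioo (0 : ℝ) 1, T x σ = _ := integral_add (i1.add i2) i3
        rw [this, integral_add i1 i2]
        unfold conv
        ring
      rw [e1, heq t ht x y, mul_div_cancel_left₀ _ ht.ne']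
      unfold conv
      ring
    rw [e] at l7
    refine l7.congr' ?_
    filter_upwards [hev] with ε hε using (hG ε hε x).symm
  -- The domination has to be uniform in `ε` and `x`. It goes through the integrated identity `hG`,
  -- because the available bound on `H` itself is not integrable up to `σ = 1`.
  obtain ⟨C, hC⟩ : ∃ C : ℝ, ∀ ε ∈ Ioo (0 : ℝ) (1 / 2), ∀ x, |t * ∫ σ in ε..(1 - ε), H x σ| ≤ C := by
    refine ⟨((∫ σ in Ioo (0 : ℝ) 1, (D0 + D1 + D2) * ((1 - σ) ^ ((1 : ℝ) - 1) * σ ^ (θ₀ - 1)))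
      + (D0 + D0) + t * ∫ σ in Ioo (0 : ℝ) 1, D3 * ((1 - σ) ^ (θ₀ - 1) * σ ^ (θ₀ - 1))) / δ,
      fun ε hε x => ?_⟩
    have hε1 : ε ∈ Ioo (0 : ℝ) 1 := ⟨hε.1, by linarith [hε.2]⟩
    have hε2 : 1 - ε ∈ Ioo (0 : ℝ) 1 := ⟨by linarith [hε.2], by linarith [hε.1]⟩
    have j1 := abs_intervalIntegral_trunc_le ((integrableOn_beta h1 hθ₀).const_mul _) (bT x) hε
    have j2 := abs_intervalIntegral_trunc_le ((integrableOn_beta hθ₀ hθ₀).const_mul D3)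
      (fun σ hσ => bSK σ hσ x y) hε
    have j3 : ∀ σ ∈ Ioo (0 : ℝ) 1, |σ * S0 x σ| ≤ D0 := fun σ hσ =>
      (bσS0 x σ hσ).trans (mul_le_of_le_one_right hD0 (Real.rpow_le_one hσ.1.le hσ.2.le hθ₀.le))
    have j4 := j3 _ hε1
    have j5 := j3 _ hε2
    rw [hG ε hε x, abs_div, abs_of_pos (hb0 x)]
    have j7 : |t * ∫ σ in ε..(1 - ε), SK x σ|
        ≤ t * ∫ σ in Ioo (0 : ℝ) 1, D3 * ((1 - σ) ^ (θ₀ - 1) * σ ^ (θ₀ - 1)) := by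
      rw [abs_mul, abs_of_pos ht]
      exact mul_le_mul_of_nonneg_left j2 ht.le
    have j6 : |(∫ σ in ε..(1 - ε), T x σ) - ((1 - ε) * S0 x (1 - ε) - ε * S0 x ε)
        + t * ∫ σ in ε..(1 - ε), SK x σ| ≤ _ := (abs_add_le _ _).trans
          (add_le_add ((abs_sub _ _).trans (add_le_add j1 ((abs_sub _ _).trans (add_le_add j5 j4))))
            j7)
    exact div_le_div₀ ((abs_nonneg _).trans j6) j6 hδ (hb x).1
  have hgc : Continuous g := by
    have c1 := (KC.conv hL h1 hθ₀ hP.p hΦ).continuous_left ht y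
    have c2 := (KC.conv hL h1 hθ₀ hP.dp hΦ).continuous_left ht y
    have c3 := (KC.conv hL h1 hθ₀ hP.p hDΦ).continuous_left ht y
    have c4 := hP.k.cont.continuous_left ht y
    exact ((((c1.add c2).add c3).div_const t).sub c4).div hbc fun x => (hb0 x).ne'
  have hFTC : ∀ x', conv Px Φ t x' y = conv Px Φ t x y + ∫ r in x..x', g r := by
    intro x'
    have r1 : Tendsto (fun ε => ∫ r in x..x', t * ∫ σ in ε..(1 - ε), H r σ) (𝓝[>] 0)
        (𝓝 (∫ r in x..x', g r)) := by
      refine intervalIntegral.tendsto_integral_filter_of_dominated_convergence (fun _ => C) ?_ ?_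
        intervalIntegrable_const ?_
      · filter_upwards [hev] with ε hε
        exact (integral_trunc_sub_eq cH cJ hd hε x x').2.const_mul t
      · filter_upwards [hev] with ε hε
        exact Eventually.of_forall fun r _ => hC ε hε r
      · exact Eventually.of_forall fun r _ => hlimG r
    have r2 : Tendsto (fun ε => t * (∫ σ in ε..(1 - ε), J x' σ) - t * ∫ σ in ε..(1 - ε), J x σ)
        (𝓝[>] 0) (𝓝 (conv Px Φ t x' y - conv Px Φ t x y)) :=
      ((tendsto_intervalIntegral_trunc
        (integrableOn_scomp hL hh hθ₀ hP.px hΦ ht x' y)).const_mul t).sub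
      ((tendsto_intervalIntegral_trunc
        (integrableOn_scomp hL hh hθ₀ hP.px hΦ ht x y)).const_mul t)
    have r3 := tendsto_nhds_unique (r2.congr' ?_) r1
    · linarith
    · filter_upwards [hev] with ε hε
      rw [← mul_sub, (integral_trunc_sub_eq cH cJ hd hε x x').1, intervalIntegral.integral_const_mul]
  have := (intervalIntegral.integral_hasDerivAt_right (hgc.intervalIntegrable x x)
    hgc.aestronglyMeasurable.stronglyMeasurableAtFilter hgc.continuousAt).const_add (conv Px Φ t x y)
  exact this.congr_of_eventuallyEq (Eventually.of_forall hFTC)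

/-- A surplus power of `t` is absorbed into one more unit of exponential growth. -/
lemma KBd.mono_θ {L θ θ' m : ℝ} {f : ℝ → ℝ → ℝ → ℝ} (hf : KBd L θ m f) (hθ : θ' ≤ θ) :
    KBd L θ' (m + 1) f := by
  obtain ⟨C, hC, hf⟩ := hf
  refine ⟨C * Real.exp ((θ - θ') * (θ - θ')), by positivity, fun t ht x y => (hf t ht x y).trans ?_⟩
  have h1 := rpow_le_exp ht (sub_nonneg.2 hθ)
  have h2 : t ^ (θ - 1) = t ^ (θ' - 1) * t ^ (θ - θ') := by
    rw [← Real.rpow_add ht]; ring_nf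
  have h3 := gk_nonneg (L * t) (x - y)
  rw [h2, add_mul, one_mul, Real.exp_add]
  calc _ ≤ C * (t ^ (θ' - 1) * (Real.exp ((θ - θ') * (θ - θ')) * Real.exp t) * Real.exp (m * t)
        * gk (L * t) (x - y)) := by gcongr
    _ = _ := by ring

/-- The defect left by `∂_x² P` cancels against the one in `∂_x² (P * Φ)`, so that exactly `∂_x² Q =
∂_t Q / b` remains. The rate increases by one because the convolution terms have a surplus power of
`t`. -/
theorem Parametrix.heatLike {b : ℝ → ℝ} {δ M L m θ₀ : ℝ} (hδ : 0 < δ) (hL : 0 < L)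
    (hθ₀ : 0 < θ₀) (hb : ∀ z, b z ∈ Icc δ M) (hbc : Continuous b)
    {P DP Px K Φ DΦ : ℝ → ℝ → ℝ → ℝ} (hP : Parametrix b L m θ₀ P DP Px K) (hΦ : GK L θ₀ m Φ)
    (hDΦ : GK L θ₀ m DΦ) (dΦ : HasTimeDeriv Φ DΦ)
    (heq : ∀ t > 0, ∀ x y, Φ t x y = K t x y + conv K Φ t x y) :
    HeatLike b L (m + 1) θ₀ (fun t x y => P t x y + conv P Φ t x y)
      (fun t x y => DP t x y + (conv P Φ t x y + conv DP Φ t x y + conv P DΦ t x y))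
      (fun t x y => Px t x y + conv Px Φ t x y) := by
  have h1 : (0 : ℝ) < 1 := one_pos
  have hh : (0 : ℝ) < 1 / 2 := by norm_num
  have hm : m ≤ m + 1 := by linarith
  have g1 := GK.conv hL h1 hθ₀ hP.p hΦ
  have g2 := GK.conv hL h1 hθ₀ hP.dp hΦ
  have g3 := GK.conv hL h1 hθ₀ hP.p hDΦ
  have g4 := GK.conv hL hh hθ₀ hP.px hΦ
  have mono : ∀ {θ θ' : ℝ} {f : ℝ → ℝ → ℝ → ℝ}, GK L θ m f → θ' ≤ θ → GK L θ' (m + 1) f :=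
    fun hf h => ⟨hf.cont, hf.bd.mono_θ h⟩
  refine ⟨(hP.p.mono_m hm).add (mono g1 (by linarith)), (hP.dp.mono_m hm).add
    (((mono g1 (by linarith)).add (mono g2 (by linarith))).add (mono g3 (by linarith))),
    (hP.px.mono_m hm).add (mono g4 (by linarith)), ?_, ?_, ?_, ?_⟩
  · intro t ht x y
    refine ((hP.deriv_time t ht x y).add
      (hasTimeDeriv_conv hL h1 hθ₀ hP.p hP.dp hΦ hDΦ hP.deriv_time dΦ t ht x y)).congr_deriv ?_
    ring
  · intro t ht x y
    exact (hP.deriv_space t ht x y).add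
      (hasDerivAt_conv_space hL h1 hh hθ₀ hP.p hP.px hΦ hP.deriv_space ht x y)
  · intro t ht x y
    refine ((hP.deriv_space_two t ht x y).add
      (hP.hasDerivAt_conv hδ hL hθ₀ hb hbc hΦ hDΦ dΦ heq ht x y)).congr_deriv ?_
    ring
  · obtain ⟨C, hC, H⟩ := (hP.approx.add g1.bd).mono_m hm
    exact ⟨C, hC, fun t ht x y => by
      have := H t ht x y
      beta_reduce at this ⊢
      rwa [show P t x y - gk (2 * b y * t) (x - y) + conv P Φ t x y
        = P t x y + conv P Φ t x y - gk (2 * b y * t) (x - y) by ring] at this⟩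

/-! ### The maximum principle and uniqueness -/

lemma IsClassicalSolution.sub {b : ℝ → ℝ} {c : ℝ} {u v : ℝ → ℝ → ℝ}
    (hu : IsClassicalSolution b c u) (hv : IsClassicalSolution b c v) :
    IsClassicalSolution b c (fun t x => u t x - v t x) := by
  have h : ∀ t > 0, ∀ x, iteratedDeriv 2 (fun x => u t x - v t x) x
      = iteratedDeriv 2 (u t) x - iteratedDeriv 2 (v t) x := fun t ht x =>
    iteratedDeriv_fun_sub (hu.contDiff t ht).contDiffAt (hv.contDiff t ht).contDiffAt
  refine ⟨fun t ht => (hu.contDiff t ht).sub (hv.contDiff t ht),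
    (hu.continuousOn.sub hv.continuousOn).congr fun p hp => h p.1 hp.1 p.2, fun t ht x => ?_⟩
  rw [h t ht x]
  exact ((hu.equation t ht x).sub (hv.equation t ht x)).congr_deriv (by ring)

/-- A classical solution which is bounded on bounded time intervals is jointly continuous. -/
lemma IsClassicalSolution.continuousAt {b : ℝ → ℝ} {c M : ℝ} (hb : ∀ x, |b x| ≤ M) {u : ℝ → ℝ → ℝ}
    (hu : IsClassicalSolution b c u) (hB : ∀ T > 0, ∃ C : ℝ, ∀ t ∈ Ioc 0 T, ∀ x, |u t x| ≤ C)
    {t₀ : ℝ} (ht₀ : 0 < t₀) (x₀ : ℝ) : ContinuousAt (fun p : ℝ × ℝ => u p.1 p.2) (t₀, x₀) := by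
  obtain ⟨C, hC⟩ := hB (2 * t₀) (by positivity)
  have hsub : Icc (t₀ / 2) (2 * t₀) ×ˢ Icc (x₀ - 1) (x₀ + 1) ⊆ Ioi (0 : ℝ) ×ˢ univ := fun p hp =>
    ⟨lt_of_lt_of_le (half_pos ht₀) hp.1.1, mem_univ _⟩
  obtain ⟨D, hD⟩ := (isCompact_Icc.prod isCompact_Icc).exists_bound_of_continuousOn
    (hu.continuousOn.mono hsub)
  have hM : 0 ≤ M := (abs_nonneg _).trans (hb 0)
  -- The equation bounds `∂_t u` on a compact neighbourhood, so `u` is Lipschitz in time uniformly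
  -- in `x` there. Joint continuity then follows from continuity in `x` at the single time `t₀`.
  have hd : ∀ x ∈ Icc (x₀ - 1) (x₀ + 1), ∀ t ∈ Icc (t₀ / 2) (2 * t₀),
      |u t x - u t₀ x| ≤ (M * D + |c| * C) * |t - t₀| := by
    intro x hx t ht
    refine Convex.norm_image_sub_le_of_norm_hasDerivWithin_le (f := fun s => u s x)
      (fun s hs => (hu.equation s (hsub (mk_mem_prod hs hx)).1 x).hasDerivWithinAt)
      (fun s hs => ?_) (convex_Icc (t₀ / 2) (2 * t₀))
      (Ioo_subset_Icc_self (mem_Icc_half ht₀)) ht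
    have h1 := hD (s, x) (mk_mem_prod hs hx)
    have h2 := hC s ⟨(hsub (mk_mem_prod hs hx)).1, hs.2⟩ x
    refine (norm_sub_le _ _).trans ?_
    rw [norm_mul, norm_mul]
    exact add_le_add (mul_le_mul (hb x) h1 (norm_nonneg _) hM)
      (mul_le_mul_of_nonneg_left h2 (norm_nonneg c))
  rw [ContinuousAt, tendsto_iff_dist_tendsto_zero]
  have hcx : Continuous (u t₀) := (hu.contDiff t₀ ht₀).continuous
  have hlim : Tendsto (fun p : ℝ × ℝ => (M * D + |c| * C) * |p.1 - t₀| + |u t₀ p.2 - u t₀ x₀|)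
      (𝓝 (t₀, x₀)) (𝓝 0) := by
    have : Continuous (fun p : ℝ × ℝ => (M * D + |c| * C) * |p.1 - t₀| + |u t₀ p.2 - u t₀ x₀|) := by
      fun_prop
    simpa using this.tendsto (t₀, x₀)
  refine squeeze_zero' (Eventually.of_forall fun _ => dist_nonneg) ?_ hlim
  have hn : Ioo (t₀ / 2) (2 * t₀) ×ˢ Ioo (x₀ - 1) (x₀ + 1) ∈ 𝓝 (t₀, x₀) :=
    (isOpen_Ioo.prod isOpen_Ioo).mem_nhds ⟨mem_Icc_half ht₀, by simp, by simp⟩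
  filter_upwards [hn] with p hp
  rw [Real.dist_eq]
  have := hd p.2 (Ioo_subset_Icc_self hp.2) p.1 (Ioo_subset_Icc_self hp.1)
  calc _ = |(u p.1 p.2 - u t₀ p.2) + (u t₀ p.2 - u t₀ x₀)| := by ring_nf
    _ ≤ _ := (abs_add_le _ _).trans (by linarith)

/-- With a positive second derivative the critical point would also be a local minimum. The function
would be locally constant, which contradicts that positivity. -/
lemma iteratedDeriv_two_nonpos_of_isLocalMax {f : ℝ → ℝ} (hf : ContDiff ℝ 2 f) {x : ℝ}
    (h : IsLocalMax f x) : iteratedDeriv 2 f x ≤ 0 := by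
  by_contra hpos
  push Not at hpos
  rw [iteratedDeriv_succ, iteratedDeriv_one] at hpos
  have hmin := isLocalMin_of_deriv_deriv_pos hpos h.deriv_eq_zero hf.continuous.continuousAt
  have heq : f =ᶠ[𝓝 x] fun _ => f x := by
    filter_upwards [h, hmin] with y h1 h2 using le_antisymm h1 h2
  have h2 : deriv (deriv f) x = 0 := by
    have := heq.deriv.deriv_eq
    simpa using this
  exact hpos.ne' h2

lemma nonneg_of_hasDerivAt_of_max_left {f : ℝ → ℝ} {f' t r : ℝ} (hr : r < t)
    (hf : HasDerivAt f f' t) (h : ∀ s ∈ Ioo r t, f s ≤ f t) : 0 ≤ f' := by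
  by_contra hneg
  push Not at hneg
  have h1 := (hasDerivAt_iff_tendsto_slope.1 hf).mono_left
    (nhdsWithin_mono t (fun s (hs : s < t) => ne_of_lt hs) : 𝓝[<] t ≤ 𝓝[≠] t)
  have h2 := h1.eventually (gt_mem_nhds hneg)
  obtain ⟨s, hs1, hs2⟩ := (h2.and (Ioo_mem_nhdsLT hr)).exists
  rw [slope_def_field, div_neg_iff] at hs1
  have := h s hs2
  have := hs2.2
  rcases hs1 with h | h <;> linarith

/-- The maximum principle for bounded solutions with zero initial value. -/
theorem IsClassicalSolution.nonpos {b : ℝ → ℝ} {c M : ℝ} (hc : 0 ≤ c) (hb0 : ∀ x, 0 ≤ b x)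
    (hb : ∀ x, b x ≤ M) {u : ℝ → ℝ → ℝ} (hu : IsClassicalSolution b c u)
    (hB : ∀ T > 0, ∃ C : ℝ, ∀ t ∈ Ioc 0 T, ∀ x, |u t x| ≤ C)
    (h0 : ∀ x, Tendsto (fun p : ℝ × ℝ => u p.1 p.2) (𝓝[>] 0 ×ˢ 𝓝 x) (𝓝 0)) {t₁ : ℝ} (ht₁ : 0 < t₁)
    (x₁ : ℝ) : u t₁ x₁ ≤ 0 := by
  have hM : 0 ≤ M := (hb0 0).trans (hb 0)
  obtain ⟨C, hC⟩ := hB t₁ ht₁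
  have hC0 : 0 ≤ C := (abs_nonneg _).trans (hC t₁ ⟨ht₁, le_rfl⟩ 0)
  -- Comparison with the barrier `ψ = ε(1 + x² + (2M+1)t)`. Since `b ≤ M`, `∂_t ψ - b ∂_x² ψ ≥ ε >
  -- 0`, and the quadratic term keeps the maximum of `u - ψ` in a bounded interval.
  suffices h : ∀ ε > 0, u t₁ x₁ ≤ ε * (1 + x₁ ^ 2 + (2 * M + 1) * t₁) by
    have hp : 0 < 1 + x₁ ^ 2 + (2 * M + 1) * t₁ := by positivity
    refine le_of_forall_pos_le_add fun ε hε => ?_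
    have := h (ε / (1 + x₁ ^ 2 + (2 * M + 1) * t₁)) (by positivity)
    rw [div_mul_cancel₀ _ hp.ne'] at this
    linarith
  intro ε hε
  by_contra hcon
  push Not at hcon
  set ψ : ℝ → ℝ → ℝ := fun t x => ε * (1 + x ^ 2 + (2 * M + 1) * t) with hψ
  -- Extending `u` by zero to `t = 0` is continuous because the initial limit is joint in `(t,x)`. A
  -- maximum on a closed rectangle therefore exists.
  set w : ℝ × ℝ → ℝ := fun p => (if 0 < p.1 then u p.1 p.2 else 0) - ψ p.1 p.2 with hw
  -- This choice gives `R ≥ 1` and `ε R > C`, so that `ε x²` exceeds the bound of `u` once `|x| ≥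
  -- R`, and `x₁` lies inside.
  set R : ℝ := |x₁| + C / ε + 1 with hR
  have hR1 : 1 ≤ R := by rw [hR]; have := abs_nonneg x₁; have : 0 ≤ C / ε := by positivity
                         linarith
  have hcont : ContinuousOn w (Icc 0 t₁ ×ˢ Icc (-R) R) := by
    rintro ⟨t, x⟩ ⟨ht, hx⟩
    have hψc : ContinuousAt (fun p : ℝ × ℝ => ψ p.1 p.2) (t, x) := by
      simp only [hψ]; fun_prop
    simp only [mem_Icc] at ht
    refine ContinuousWithinAt.sub ?_ hψc.continuousWithinAt
    rcases eq_or_lt_of_le ht.1 with h | h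
    · subst h
      rw [ContinuousWithinAt]
      simp only [lt_self_iff_false, if_false]
      rw [Metric.tendsto_nhds]
      intro e he
      have h1 := (h0 x).eventually (Metric.ball_mem_nhds 0 he)
      rw [← nhdsWithin_univ x, ← nhdsWithin_prod_eq] at h1
      filter_upwards [nhdsWithin_le_nhds (eventually_nhdsWithin_iff.1 h1)] with p hp
      split_ifs with hp1
      · exact hp ⟨hp1, mem_univ _⟩
      · simpa using he
    · refine ContinuousAt.continuousWithinAt ?_
      refine (hu.continuousAt (fun x => by rw [abs_of_nonneg (hb0 x)]; exact hb x) hB h x).congr ?_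
      filter_upwards [(isOpen_Ioi.prod isOpen_univ).mem_nhds (⟨h, mem_univ x⟩ :
        (t, x) ∈ Ioi (0 : ℝ) ×ˢ univ)] with p hp
      simp only [if_pos (show 0 < p.1 from hp.1)]
  have hx₁R : |x₁| ≤ R := by rw [hR]; have : 0 ≤ C / ε := by positivity
                             linarith
  obtain ⟨⟨t, x⟩, ⟨ht, hx⟩, hmax⟩ := (isCompact_Icc.prod isCompact_Icc).exists_isMaxOn
    ⟨(t₁, x₁), ⟨ht₁.le, le_rfl⟩, abs_le.1 hx₁R⟩ hcont
  have hpos : 0 < w (t, x) := by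
    refine lt_of_lt_of_le ?_ (hmax ⟨⟨ht₁.le, le_rfl⟩, abs_le.1 hx₁R⟩ : w (t₁, x₁) ≤ w (t, x))
    simp only [hw, if_pos ht₁]
    linarith
  have hψ0 : ∀ t ≥ 0, ∀ x, ε * x ^ 2 < ψ t x := by
    intro t ht x
    have : 0 ≤ (2 * M + 1) * t := by positivity
    simp only [hψ]
    nlinarith
  have ht0 : 0 < t := by
    rcases eq_or_lt_of_le ht.1 with h | h
    · exfalso
      have h := h.symm
      simp only at h
      subst h
      simp only [hw, lt_self_iff_false, if_false] at hpos
      nlinarith [hψ0 0 le_rfl x, sq_nonneg x]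
    · exact h
  simp only [mem_Icc] at ht hx
  have hwu : ∀ s > 0, ∀ y, w (s, y) = u s y - ψ s y := fun s hs y => by
    simp only [hw, if_pos hs]
  have hu0 : 0 < u t x := by
    rw [hwu t ht0] at hpos
    nlinarith [hψ0 t ht0.le x, sq_nonneg x]
  have hxR : x ∈ Ioo (-R) R := by
    rw [mem_Ioo, ← abs_lt]
    by_contra hge
    push Not at hge
    have h1 := hψ0 t ht0.le x
    have h2 := hC t ⟨ht0, ht.2⟩ x
    have h3 : R ≤ x ^ 2 := by rw [← sq_abs]; nlinarith
    have h4 : C < ε * R := by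
      rw [hR]
      have : ε * (C / ε) = C := by field_simp
      nlinarith [abs_nonneg x₁]
    rw [hwu t ht0] at hpos
    have := le_abs_self (u t x)
    nlinarith
  have hxx : iteratedDeriv 2 (fun y => u t y - ψ t y) x ≤ 0 := by
    refine iteratedDeriv_two_nonpos_of_isLocalMax ((hu.contDiff t ht0).sub ?_) ?_
    · simp only [hψ]; fun_prop
    · filter_upwards [isOpen_Ioo.mem_nhds hxR] with y hy
      have := hmax (show (t, y) ∈ Icc 0 t₁ ×ˢ Icc (-R) R from ⟨ht, Ioo_subset_Icc_self hy⟩)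
      simp only [mem_ofPred_eq] at this
      rwa [hwu t ht0, hwu t ht0] at this
  have hψ2 : iteratedDeriv 2 (ψ t) x = 2 * ε := by
    have d1 : deriv (ψ t) = fun y => ε * (2 * y) := by
      funext y
      have : HasDerivAt (ψ t) (ε * (2 * y)) y := by
        have := ((((hasDerivAt_id y).pow 2).const_add 1).add_const ((2 * M + 1) * t)).const_mul ε
        simpa using this
      exact this.deriv
    rw [iteratedDeriv_succ, iteratedDeriv_one, d1]
    have : HasDerivAt (fun y : ℝ => ε * (2 * y)) (ε * (2 * 1)) x :=
      ((hasDerivAt_id x).const_mul 2).const_mul ε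
    rw [this.deriv]; ring
  have hψc : ContDiff ℝ 2 (ψ t) := by simp only [hψ]; fun_prop
  rw [iteratedDeriv_fun_sub (hu.contDiff t ht0).contDiffAt hψc.contDiffAt, hψ2] at hxx
  have hdt : HasDerivAt (fun s => u s x - ψ s x)
      (b x * iteratedDeriv 2 (u t) x - c * u t x - ε * (2 * M + 1)) t := by
    refine (hu.equation t ht0 x).sub ?_
    have := (((hasDerivAt_id t).const_mul (2 * M + 1)).const_add (1 + x ^ 2)).const_mul ε
    simpa using this
  have := nonneg_of_hasDerivAt_of_max_left ht0 hdt fun s hs => by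
    have := hmax (show (s, x) ∈ Icc 0 t₁ ×ˢ Icc (-R) R from ⟨⟨hs.1.le, hs.2.le.trans ht.2⟩, hx⟩)
    simp only [mem_ofPred_eq] at this
    rwa [hwu t ht0, hwu s hs.1] at this
  have h1 : b x * iteratedDeriv 2 (u t) x ≤ b x * (2 * ε) :=
    mul_le_mul_of_nonneg_left (by linarith) (hb0 x)
  have h2 := mul_le_mul_of_nonneg_right (hb x) hε.le
  have h3 := mul_nonneg hc hu0.le
  nlinarith

theorem IsFundamentalSolution.unique {b : ℝ → ℝ} {c M : ℝ} (hc : 0 ≤ c) (hb0 : ∀ x, 0 ≤ b x)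
    (hb : ∀ x, b x ≤ M) {Q Q' : ℝ → ℝ → ℝ → ℝ} (hQ : IsFundamentalSolution b c Q)
    (hQ' : IsFundamentalSolution b c Q') {t : ℝ} (ht : 0 < t) (x y : ℝ) : Q t x y = Q' t x y := by
  have hle : ∀ {Q Q' : ℝ → ℝ → ℝ → ℝ}, IsFundamentalSolution b c Q → IsFundamentalSolution b c Q' →
      ∀ f : ℝ →ᵇ ℝ, (∫ y, Q t x y * f y) - ∫ y, Q' t x y * f y ≤ 0 := by
    intro Q Q' hQ hQ' f
    refine ((hQ.cauchy_solution f).sub (hQ'.cauchy_solution f)).nonpos hc hb0 hb (fun T hT => ?_)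
      (fun x => ?_) ht x
    · obtain ⟨C, hC⟩ := hQ.cauchy_bounded f T hT
      obtain ⟨D, hD⟩ := hQ'.cauchy_bounded f T hT
      exact ⟨C + D, fun t ht x => (abs_sub _ _).trans (add_le_add (hC t ht x) (hD t ht x))⟩
    · simpa using (hQ.cauchy_initial f x).sub (hQ'.cauchy_initial f x)
  have hcont : ∀ {Q : ℝ → ℝ → ℝ → ℝ}, IsFundamentalSolution b c Q → Continuous (Q t x) := by
    intro Q hQ
    rw [← continuousOn_univ]
    exact hQ.continuousOn.comp (f := fun y => (t, x, y)) (by fun_prop)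
      (fun _ _ => ⟨ht, mem_univ _⟩)
  set h : ℝ → ℝ := fun y => Q t x y - Q' t x y with hh
  have hhc : Continuous h := (hcont hQ).sub (hcont hQ')
  have hhi : Integrable h := (hQ.integrable t ht x).sub (hQ'.integrable t ht x)
  have hpos : ∀ y, 0 < 1 + |h y| := fun y => by positivity
  -- The difference `h` need not be bounded. The function `h / (1 + |h|)` is an admissible datum of
  -- the same sign, and testing with it forces `h = 0`.
  have hfc : Continuous (fun y => h y / (1 + |h y|)) :=
    hhc.div (by fun_prop) fun y => (hpos y).ne'
  have hf1 : ∀ y, ‖h y / (1 + |h y|)‖ ≤ 1 := fun y => by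
    rw [Real.norm_eq_abs, abs_div, abs_of_pos (hpos y), div_le_one (hpos y)]
    linarith
  set f : ℝ →ᵇ ℝ := BoundedContinuousFunction.ofNormedAddCommGroup _ hfc 1 hf1 with hf
  have hfe : ∀ y, f y = h y / (1 + |h y|) := fun y => rfl
  have hmul : ∀ {g : ℝ → ℝ}, Integrable g → Integrable (fun y => g y * f y) := fun hg =>
    hg.mul_bdd (c := 1) f.continuous.aestronglyMeasurable (Eventually.of_forall hf1)
  have hzero : ∫ y, h y * f y = 0 := by
    have e : ∫ y, h y * f y = (∫ y, Q t x y * f y) - ∫ y, Q' t x y * f y := by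
      rw [← integral_sub (hmul (hQ.integrable t ht x)) (hmul (hQ'.integrable t ht x))]
      simp only [hh, sub_mul]
    rw [e]
    linarith [hle hQ hQ' f, hle hQ' hQ f]
  have hnn : ∀ y, 0 ≤ h y * f y := fun y => by
    rw [hfe, ← mul_div_assoc]
    exact div_nonneg (mul_self_nonneg _) (hpos y).le
  have hae := (integral_eq_zero_iff_of_nonneg hnn (hmul hhi)).1 hzero
  have := congr_fun ((hhc.mul f.continuous).ae_eq_iff_eq volume continuous_zero |>.1 hae) y
  simp only [Pi.mul_apply, Pi.zero_apply, hfe] at this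
  rw [← mul_div_assoc, div_eq_zero_iff, or_iff_left (hpos y).ne', mul_self_eq_zero] at this
  exact sub_eq_zero.1 this

/-! ### Operations on Gaussian Hölder bounds -/

/-- Gaussian bounds of a kernel together with its Hölder bounds in both space variables. -/
structure KReg (L θ m κ : ℝ) (f : ℝ → ℝ → ℝ → ℝ) : Prop where
  bd : KBd L θ m f
  hx : KHx L θ m κ f
  hy : KHy L θ m κ f

lemma KHx.add {L θ m κ : ℝ} {f g : ℝ → ℝ → ℝ → ℝ} (hf : KHx L θ m κ f) (hg : KHx L θ m κ g) :
    KHx L θ m κ (fun t x y => f t x y + g t x y) := by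
  obtain ⟨C, hC, hf⟩ := hf
  obtain ⟨D, hD, hg⟩ := hg
  refine ⟨C + D, by positivity, fun t ht x x' y => ?_⟩
  have := abs_add_le (f t x y - f t x' y) (g t x y - g t x' y)
  rw [add_sub_add_comm]
  linarith [hf t ht x x' y, hg t ht x x' y]

lemma KBd.const_mul {L θ m : ℝ} {f : ℝ → ℝ → ℝ → ℝ} (hf : KBd L θ m f) (a : ℝ) :
    KBd L θ m (fun t x y => a * f t x y) := by
  obtain ⟨C, hC, hf⟩ := hf
  refine ⟨|a| * C, by positivity, fun t ht x y => ?_⟩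
  rw [abs_mul, mul_assoc]
  exact mul_le_mul_of_nonneg_left (hf t ht x y) (abs_nonneg a)

lemma KHx.const_mul {L θ m κ : ℝ} {f : ℝ → ℝ → ℝ → ℝ} (hf : KHx L θ m κ f) (a : ℝ) :
    KHx L θ m κ (fun t x y => a * f t x y) := by
  obtain ⟨C, hC, hf⟩ := hf
  refine ⟨|a| * C, by positivity, fun t ht x x' y => ?_⟩
  rw [← mul_sub, abs_mul, mul_assoc]
  exact mul_le_mul_of_nonneg_left (hf t ht x x' y) (abs_nonneg a)

lemma KReg.add {L θ m κ : ℝ} {f g : ℝ → ℝ → ℝ → ℝ} (hf : KReg L θ m κ f) (hg : KReg L θ m κ g) :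
    KReg L θ m κ (fun t x y => f t x y + g t x y) :=
  ⟨hf.bd.add hg.bd, hf.hx.add hg.hx, KHx.add hf.hy hg.hy⟩

lemma KReg.const_mul {L θ m κ : ℝ} {f : ℝ → ℝ → ℝ → ℝ} (hf : KReg L θ m κ f) (a : ℝ) :
    KReg L θ m κ (fun t x y => a * f t x y) :=
  ⟨hf.bd.const_mul a, hf.hx.const_mul a, KHx.const_mul hf.hy a⟩

lemma KReg.sub {L θ m κ : ℝ} {f g : ℝ → ℝ → ℝ → ℝ} (hf : KReg L θ m κ f) (hg : KReg L θ m κ g) :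
    KReg L θ m κ (fun t x y => f t x y - g t x y) := by
  simpa only [neg_one_mul, ← sub_eq_add_neg] using hf.add (hg.const_mul (-1))

lemma KHx.mono_m {L θ m m' κ : ℝ} {f : ℝ → ℝ → ℝ → ℝ} (hf : KHx L θ m κ f) (hm : m ≤ m') :
    KHx L θ m' κ f := by
  obtain ⟨C, hC, hf⟩ := hf
  refine ⟨C, hC, fun t ht x x' y => (hf t ht x x' y).trans ?_⟩
  have h1 := gk_nonneg (L * t) (x - y)
  have h2 := gk_nonneg (L * t) (x' - y)
  gcongr

lemma KReg.mono_m {L θ m m' κ : ℝ} {f : ℝ → ℝ → ℝ → ℝ} (hf : KReg L θ m κ f) (hm : m ≤ m') :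
    KReg L θ m' κ f := ⟨hf.bd.mono_m hm, hf.hx.mono_m hm, KHx.mono_m hf.hy hm⟩

lemma KBd.congr {L θ m : ℝ} {f g : ℝ → ℝ → ℝ → ℝ} (hf : KBd L θ m f)
    (h : ∀ t > 0, ∀ x y, f t x y = g t x y) : KBd L θ m g := by
  obtain ⟨C, hC, hf⟩ := hf
  exact ⟨C, hC, fun t ht x y => h t ht x y ▸ hf t ht x y⟩

lemma KHx.congr {L θ m κ : ℝ} {f g : ℝ → ℝ → ℝ → ℝ} (hf : KHx L θ m κ f)
    (h : ∀ t > 0, ∀ x y, f t x y = g t x y) : KHx L θ m κ g := by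
  obtain ⟨C, hC, hf⟩ := hf
  exact ⟨C, hC, fun t ht x x' y => h t ht x y ▸ h t ht x' y ▸ hf t ht x x' y⟩

lemma KReg.congr {L θ m κ : ℝ} {f g : ℝ → ℝ → ℝ → ℝ} (hf : KReg L θ m κ f)
    (h : ∀ t > 0, ∀ x y, f t x y = g t x y) : KReg L θ m κ g :=
  ⟨hf.bd.congr h, hf.hx.congr h, KHx.congr hf.hy fun t ht x y => h t ht y x⟩

lemma KHx.div_time {L θ m κ : ℝ} {f : ℝ → ℝ → ℝ → ℝ} (h : KHx L θ m κ f) :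
    KHx L (θ - 1) m κ (fun t x y => f t x y / t) := by
  obtain ⟨C, hC, hb⟩ := h
  refine ⟨C, hC, fun t ht x x' y => ?_⟩
  rw [← sub_div, abs_div, abs_of_pos ht, div_le_iff₀ ht]
  refine (hb t ht x x' y).trans (le_of_eq ?_)
  rw [show θ - 1 - κ / 2 = θ - 1 - 1 - κ / 2 + 1 by ring, Real.rpow_add_one ht.ne']
  ring

lemma KReg.div_time {L θ m κ : ℝ} {f : ℝ → ℝ → ℝ → ℝ} (h : KReg L θ m κ f) :
    KReg L (θ - 1) m κ (fun t x y => f t x y / t) :=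
  ⟨h.bd.div_time, h.hx.div_time, KHx.div_time h.hy⟩

lemma abs_sub_le_rpow_of_le {g : ℝ → ℝ} {B C α κ : ℝ} (hκ : 0 ≤ κ) (hκα : κ ≤ α) (hB : 0 ≤ B)
    (hC : 0 ≤ C) (hb : ∀ x y, |g x - g y| ≤ B) (hg : ∀ x y, |g x - g y| ≤ C * |x - y| ^ α) (x y : ℝ) :
    |g x - g y| ≤ (B + C) * |x - y| ^ κ := by
  rcases le_total |x - y| 1 with h | h
  · rcases eq_or_lt_of_le (abs_nonneg (x - y)) with h0 | h0
    · have : x = y := by rw [eq_comm, abs_eq_zero] at h0; linarith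
      subst this
      simp only [sub_self, abs_zero]
      positivity
    · refine (hg x y).trans ?_
      have := Real.rpow_le_rpow_of_exponent_ge h0 h hκα
      have h3 : 0 ≤ |x - y| ^ κ := by positivity
      nlinarith
  · have := Real.one_le_rpow h hκ
    nlinarith [hb x y]

lemma KReg.div_left {L θ m κ α δ Cb : ℝ} {f : ℝ → ℝ → ℝ → ℝ} (h : KReg L θ m κ f) {b : ℝ → ℝ}
    (hκ : 0 ≤ κ) (hκα : κ ≤ α) (hα : α ≤ 1) (hδ : 0 < δ) (hb : ∀ x, δ ≤ b x) (hCb : 0 ≤ Cb)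
    (hbh : ∀ x y, |b x - b y| ≤ Cb * |x - y| ^ α) :
    KReg L θ (m + 1) κ (fun t x y => f t x y / b x) := by
  have hb0 : ∀ x, 0 < b x := fun x => hδ.trans_le (hb x)
  have hinv : ∀ x, (b x)⁻¹ ≤ δ⁻¹ := fun x => inv_anti₀ hδ (hb x)
  have hinv0 : ∀ x, 0 < (b x)⁻¹ := fun x => inv_pos.2 (hb0 x)
  have hd := abs_sub_le_rpow_of_le (g := fun x => (b x)⁻¹) (B := δ⁻¹) (C := δ⁻¹ * (Cb * δ⁻¹)) hκ hκα
    (by positivity) (by positivity) (fun x y => by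
      rw [abs_le]; constructor <;> linarith [hinv x, hinv y, hinv0 x, hinv0 y]) (fun x y => by
      rw [inv_sub_inv (hb0 x).ne' (hb0 y).ne', abs_div, abs_of_pos (mul_pos (hb0 x) (hb0 y)),
        div_eq_mul_inv, mul_inv, abs_sub_comm]
      have := hbh x y
      have h1 := hinv x
      have h2 := hinv y
      have h3 := (hinv0 x).le
      have h4 := (hinv0 y).le
      calc _ ≤ (Cb * |x - y| ^ α) * (δ⁻¹ * δ⁻¹) := by gcongr
        _ = _ := by ring)
  obtain ⟨C, hC, h1⟩ := h.bd
  obtain ⟨D, hD, h2⟩ := h.hx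
  obtain ⟨E, hE, h3⟩ := h.hy
  have hm : ∀ t > 0, Real.exp (m * t) ≤ Real.exp ((m + 1) * t) := fun t ht =>
    Real.exp_le_exp.2 (by nlinarith)
  refine ⟨⟨C * δ⁻¹, by positivity, fun t ht x y => ?_⟩, ⟨D * δ⁻¹ + C * (δ⁻¹ + δ⁻¹ * (Cb * δ⁻¹)),
    by positivity, fun t ht x x' y => ?_⟩, ⟨E * δ⁻¹, by positivity, fun t ht x x' y => ?_⟩⟩
  · beta_reduce
    rw [div_eq_mul_inv, abs_mul, abs_of_pos (hinv0 x)]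
    have g1 := gk_nonneg (L * t) (x - y)
    have := hm t ht
    calc _ ≤ (C * (t ^ (θ - 1) * Real.exp (m * t) * gk (L * t) (x - y))) * δ⁻¹ :=
          mul_le_mul (h1 t ht x y) (hinv x) (hinv0 x).le (by positivity)
      _ ≤ (C * (t ^ (θ - 1) * Real.exp ((m + 1) * t) * gk (L * t) (x - y))) * δ⁻¹ := by gcongr
      _ = _ := by ring
  · have g1 := gk_nonneg (L * t) (x - y)
    have g2 := gk_nonneg (L * t) (x' - y)
    have hm' := hm t ht
    have e : f t x y / b x - f t x' y / b x'
        = (f t x y - f t x' y) * (b x)⁻¹ + f t x' y * ((b x)⁻¹ - (b x')⁻¹) := by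
      rw [div_eq_mul_inv, div_eq_mul_inv]; ring
    rw [e]
    refine (abs_add_le _ _).trans ?_
    rw [abs_mul, abs_mul, abs_of_pos (hinv0 x)]
    have p1 : |f t x y - f t x' y| * (b x)⁻¹ ≤ D * (|x - x'| ^ κ * (t ^ (θ - 1 - κ / 2)
        * Real.exp ((m + 1) * t) * (gk (L * t) (x - y) + gk (L * t) (x' - y)))) * δ⁻¹ := by
      refine mul_le_mul ((h2 t ht x x' y).trans ?_) (hinv x) (hinv0 x).le (by positivity)
      gcongr
    have p2 : |f t x' y| * |(b x)⁻¹ - (b x')⁻¹| ≤ C * (t ^ (θ - 1 - κ / 2) * Real.exp ((m + 1) * t)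
        * (gk (L * t) (x - y) + gk (L * t) (x' - y))) * ((δ⁻¹ + δ⁻¹ * (Cb * δ⁻¹)) * |x - x'| ^ κ) := by
      refine mul_le_mul ((h1 t ht x' y).trans ?_) (hd x x') (abs_nonneg _) (by positivity)
      have q1 := rpow_le_exp_of_le_one (p := κ / 2) ht (by positivity) (by linarith)
      have q2 : t ^ (θ - 1) = t ^ (θ - 1 - κ / 2) * t ^ (κ / 2) := by
        rw [← Real.rpow_add ht]; ring_nf
      rw [q2]
      calc _ ≤ C * (t ^ (θ - 1 - κ / 2) * Real.exp t * Real.exp (m * t)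
            * (gk (L * t) (x - y) + gk (L * t) (x' - y))) := by
            gcongr
            linarith
        _ = _ := by rw [add_mul m, Real.exp_add, one_mul]; ring
    refine (add_le_add p1 p2).trans_eq (by ring)
  · simp only [kswap]
    rw [← sub_div, div_eq_mul_inv, abs_mul, abs_of_pos (hinv0 y)]
    have g1 := gk_nonneg (L * t) (x - y)
    have g2 := gk_nonneg (L * t) (x' - y)
    have := hm t ht
    calc _ ≤ (E * (|x - x'| ^ κ * (t ^ (θ - 1 - κ / 2) * Real.exp (m * t)
            * (gk (L * t) (x - y) + gk (L * t) (x' - y))))) * δ⁻¹ :=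
          mul_le_mul (h3 t ht x x' y) (hinv y) (hinv0 y).le (by positivity)
      _ ≤ (E * (|x - x'| ^ κ * (t ^ (θ - 1 - κ / 2) * Real.exp ((m + 1) * t)
            * (gk (L * t) (x - y) + gk (L * t) (x' - y))))) * δ⁻¹ := by gcongr
      _ = _ := by ring

lemma KReg.conv {L a b m κ : ℝ} (hL : 0 < L) (ha : 0 < a) (ha' : 0 < a - κ / 2) (hb : 0 < b)
    (hb' : 0 < b - κ / 2) {k f : ℝ → ℝ → ℝ → ℝ} (hk : GK L a m k) (hkx : KHx L a m κ k)
    (hf : GK L b m f) (hfy : KHy L b m κ f) : KReg L (a + b) m κ (conv k f) :=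
  ⟨KBd.conv hL ha hb hk.bd hf.bd, KHx.conv hL ha ha' hb hk hkx hf, KHy.conv hL ha hb hb' hk hf hfy⟩

/-- A weight with a good exponent and large growth, combined with one of good growth. -/
lemma glue_weight_le {θ θ' m m' C C' t r : ℝ} (hθ : θ' ≤ θ) (hm : 0 ≤ m) (hm' : 0 ≤ m') (hC : 0 ≤ C)
    (hC' : 0 ≤ C') (ht : 0 < t) (h : r ≤ C * (t ^ θ * Real.exp (m' * t)))
    (h' : r ≤ C' * (t ^ θ' * Real.exp (m * t))) :
    r ≤ (C * Real.exp m' + C') * (t ^ θ * Real.exp (m * t)) := by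
  have p1 : 0 ≤ C' * (t ^ θ * Real.exp (m * t)) := by positivity
  have p2 : 0 ≤ C * Real.exp m' * (t ^ θ * Real.exp (m * t)) := by positivity
  rw [add_mul]
  rcases le_total t 1 with h1 | h1
  · have e1 : Real.exp (m' * t) ≤ Real.exp m' := Real.exp_le_exp.2 (by nlinarith)
    have e2 : 1 ≤ Real.exp (m * t) := Real.one_le_exp (by positivity)
    have : C * (t ^ θ * Real.exp (m' * t)) ≤ C * Real.exp m' * (t ^ θ * Real.exp (m * t)) := by
      calc _ ≤ C * (t ^ θ * Real.exp m') * 1 := by rw [mul_one]; gcongr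
        _ ≤ C * (t ^ θ * Real.exp m') * Real.exp (m * t) := by gcongr
        _ = _ := by ring
    linarith
  · have : C' * (t ^ θ' * Real.exp (m * t)) ≤ C' * (t ^ θ * Real.exp (m * t)) := by
      have := Real.rpow_le_rpow_of_exponent_le h1 hθ
      gcongr
    linarith

lemma KHx.glue {L θ θ' m m' κ : ℝ} {f : ℝ → ℝ → ℝ → ℝ} (hL : 0 < L) (h : KHx L θ m' κ f)
    (h' : KHx L θ' m κ f) (hθ : θ' ≤ θ) (hm : 0 ≤ m) (hm' : 0 ≤ m') : KHx L θ m κ f := by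
  obtain ⟨C, hC, h⟩ := h
  obtain ⟨C', hC', h'⟩ := h'
  refine ⟨C * Real.exp m' + C', by positivity, fun t ht x x' y => ?_⟩
  have g1 := gk_pos (mul_pos hL ht) (x - y)
  have g2 := gk_pos (mul_pos hL ht) (x' - y)
  have := glue_weight_le (θ := θ - 1 - κ / 2) (θ' := θ' - 1 - κ / 2)
    (C := C * (|x - x'| ^ κ * (gk (L * t) (x - y) + gk (L * t) (x' - y))))
    (C' := C' * (|x - x'| ^ κ * (gk (L * t) (x - y) + gk (L * t) (x' - y)))) (by linarith) hm hm'
    (by positivity) (by positivity) ht ((h t ht x x' y).trans_eq (by ring))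
    ((h' t ht x x' y).trans_eq (by ring))
  exact this.trans_eq (by ring)

/-- A better power of `t` matters only for `t ≤ 1`, where any growth rate is harmless. For `t ≥ 1`
the bound with the smaller exponent is already stronger in its power of `t`, and it has the wanted
growth. This removes growth rates that depend on `C²` norms. -/
lemma KReg.glue {L θ θ' m m' κ : ℝ} {f : ℝ → ℝ → ℝ → ℝ} (hL : 0 < L) (h : KReg L θ m' κ f)
    (h' : KReg L θ' m κ f) (hθ : θ' ≤ θ) (hm : 0 ≤ m) (hm' : 0 ≤ m') : KReg L θ m κ f := by
  refine ⟨?_, h.hx.glue hL h'.hx hθ hm hm', KHx.glue hL h.hy h'.hy hθ hm hm'⟩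
  obtain ⟨C, hC, h⟩ := h.bd
  obtain ⟨C', hC', h'⟩ := h'.bd
  refine ⟨C * Real.exp m' + C', by positivity, fun t ht x y => ?_⟩
  have g1 := gk_pos (mul_pos hL ht) (x - y)
  have := glue_weight_le (θ := θ - 1) (θ' := θ' - 1) (C := C * gk (L * t) (x - y))
    (C' := C' * gk (L * t) (x - y)) (by linarith) hm hm'
    (by positivity) (by positivity) ht ((h t ht x y).trans_eq (by ring))
    ((h' t ht x y).trans_eq (by ring))
  exact this.trans_eq (by ring)

/-! ### Two-sided weighted bounds and Taylor coefficients -/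

/-- Weighted bounds of a kernel and of its transpose. -/
def BiWk (L θ m κ : ℝ) (f : ℝ → ℝ → ℝ → ℝ) : Prop := Wk L θ m κ f ∧ Wk L θ m κ (kswap f)

/-- Coefficient bounds of a function of two variables and of its transpose. -/
def BiCoef (p m κ : ℝ) (A : ℝ → ℝ → ℝ) : Prop :=
  Coef p m κ (fun _ x y => A x y) ∧ Coef p m κ (fun _ x y => A y x)

lemma BiWk.kreg {L θ m κ κ' : ℝ} {f : ℝ → ℝ → ℝ → ℝ} (h : BiWk L θ m κ f) (h0 : 0 ≤ κ')
    (h1 : κ' ≤ κ) : KReg L θ m κ' f := ⟨h.1.kbd, h.1.khx h0 h1, h.2.khx h0 h1⟩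

lemma BiWk.mul {L θ m κ p m' : ℝ} {f : ℝ → ℝ → ℝ → ℝ} {A : ℝ → ℝ → ℝ} (hf : BiWk L θ m κ f)
    (hA : BiCoef p m' κ A) : BiWk L (θ + p) (m + m') κ (fun t x y => A x y * f t x y) :=
  ⟨hf.1.mul hA.1, hf.2.mul hA.2⟩

lemma BiCoef.swap {p m κ : ℝ} {A : ℝ → ℝ → ℝ} (h : BiCoef p m κ A) :
    BiCoef p m κ (fun x y => A y x) := ⟨h.2, h.1⟩

lemma BiCoef.mul {p m κ p' m' : ℝ} {A B : ℝ → ℝ → ℝ} (hA : BiCoef p m κ A) (hB : BiCoef p' m' κ B) :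
    BiCoef (p + p') (m + m') κ (fun x y => A x y * B x y) := ⟨hA.1.mul hB.1, hA.2.mul hB.2⟩

lemma biCoef_sub {α C : ℝ} {g : ℝ → ℝ} (hα : 0 ≤ α) (hα1 : α ≤ 1) (hC : 0 ≤ C)
    (hg : ∀ x y, |g x - g y| ≤ C * |x - y| ^ α) : BiCoef (α / 2) 0 α (fun x y => g x - g y) := by
  refine ⟨coef_of_diag hα hα1 hC hg fun x x' y => ?_,
    coef_of_diag hα hα1 hC (fun x y => ?_) fun x x' y => ?_⟩
  · rw [sub_sub_sub_cancel_right]; exact hg x x'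
  · rw [abs_sub_comm]; exact hg x y
  · rw [sub_sub_sub_cancel_left, abs_sub_comm]; exact hg x x'

lemma biCoef_left {C : ℝ} {g : ℝ → ℝ} (hC : 0 ≤ C) (hb : ∀ x, |g x| ≤ C)
    (hg : ∀ x y, |g x - g y| ≤ C * |x - y|) : BiCoef 0 1 1 (fun x _ => g x) := by
  refine ⟨coef_of_holder zero_le_one le_rfl (fun x _ => hb x) fun x x' _ => ?_,
    coef_of_holder zero_le_one le_rfl (fun _ y => hb y) fun x x' y => ?_⟩
  · rw [Real.rpow_one]; exact hg x x'
  · rw [sub_self, abs_zero]; positivity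

/-- The coefficients `b'(x) (b(y) - b(x))`. -/
lemma biCoef_deriv_mul_sub {C : ℝ} {b b' : ℝ → ℝ} (hC : 0 ≤ C) (hb : ∀ x, |b x| ≤ C)
    (hbl : ∀ x y, |b x - b y| ≤ C * |x - y|) (hb' : ∀ x, |b' x| ≤ C)
    (hb'l : ∀ x y, |b' x - b' y| ≤ C * |x - y|) :
    BiCoef (1 / 2) 0 1 (fun x y => b' x * (b y - b x)) := by
  have h2 : ∀ x y, |b x - b y| ≤ 2 * C := fun x y => (abs_sub _ _).trans (by linarith [hb x, hb y])
  have hbd : ∀ x y, |b' x * (b y - b x)| ≤ (3 * C * C) * |x - y| ^ (1 : ℝ) := by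
    intro x y
    rw [Real.rpow_one, abs_mul, abs_sub_comm (b y)]
    have := mul_le_mul (hb' x) (hbl x y) (abs_nonneg _) hC
    have h3 : 0 ≤ C * C * |x - y| := by positivity
    linarith
  refine ⟨coef_of_diag zero_le_one le_rfl (by positivity) hbd fun x x' y => ?_,
    coef_of_diag zero_le_one le_rfl (by positivity) (C := 3 * C * C) (fun x y => ?_) fun x x' y => ?_⟩
  · have e : b' x * (b y - b x) - b' x' * (b y - b x')
        = (b' x - b' x') * (b y - b x') + b' x * (b x' - b x) := by ring
    rw [e, Real.rpow_one]
    refine (abs_add_le _ _).trans ?_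
    rw [abs_mul, abs_mul, abs_sub_comm (b x')]
    have p1 := mul_le_mul (hb'l x x') (h2 y x') (abs_nonneg _) (by positivity)
    have p2 := mul_le_mul (hb' x) (hbl x x') (abs_nonneg _) hC
    linarith
  · rw [abs_sub_comm x y]; exact hbd y x
  · rw [← mul_sub, Real.rpow_one, abs_mul, sub_sub_sub_cancel_right]
    have := mul_le_mul (hb' y) (hbl x x') (abs_nonneg _) hC
    have h3 : 0 ≤ C * C * |x - x'| := by positivity
    linarith

/-- The second order Taylor remainders of a function with Lipschitz derivative. -/
lemma biCoef_taylor {C : ℝ} {b b' : ℝ → ℝ} (hC : 0 ≤ C) (hd : ∀ x, HasDerivAt b (b' x) x)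
    (hb'l : ∀ x y, |b' x - b' y| ≤ C * |x - y|) :
    BiCoef 1 0 1 (fun x y => b x - b y - b' y * (x - y)) := by
  have hbd : ∀ x y, |b x - b y - b' y * (x - y)| ≤ (C + C) * |x - y| ^ 2 := by
    intro x y
    have := Convex.norm_image_sub_le_of_norm_hasDerivWithin_le (f := fun r => b r - b' y * (r - y))
      (f' := fun r => b' r - b' y * 1) (C := C * |x - y|) (s := uIcc x y) (x := y) (y := x)
      (fun r _ => ((hd r).sub (((hasDerivAt_id r).sub_const y).const_mul (b' y))).hasDerivWithinAt)
      (fun r hr => ?_) (convex_uIcc x y) right_mem_uIcc left_mem_uIcc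
    · simp only [Real.norm_eq_abs, sub_self, mul_zero, sub_zero] at this
      rw [show b x - b y - b' y * (x - y) = b x - b' y * (x - y) - b y by ring]
      refine this.trans ?_
      have h3 : 0 ≤ C * |x - y| ^ 2 := by positivity
      nlinarith
    · rw [Real.norm_eq_abs, mul_one]
      refine (hb'l r y).trans ?_
      rw [uIcc_comm] at hr
      exact mul_le_mul_of_nonneg_left (abs_sub_left_of_mem_uIcc hr) hC
  refine ⟨coef_of_diag_two (C := C + C) (by positivity) hbd fun x x' y => ?_,
    coef_of_diag_two (C := C + C) (by positivity) (fun x y => ?_) fun x x' y => ?_⟩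
  -- The increment of a Taylor remainder is a remainder between `x` and `x'` plus a difference of
  -- slopes, so only the Lipschitz bound on `b'` is used.
  · have e : b x - b y - b' y * (x - y) - (b x' - b y - b' y * (x' - y))
        = -(b x' - b x - b' x * (x' - x)) + (b' x - b' y) * (x - x') := by ring
    rw [e]
    refine (abs_add_le _ _).trans ?_
    rw [abs_neg, abs_mul]
    have p1 := hbd x' x
    have p2 := mul_le_mul_of_nonneg_right (hb'l x y) (abs_nonneg (x - x'))
    rw [abs_sub_comm x' x] at p1
    have h3 : 0 ≤ C * (|x - x'| * |x - y|) := by positivity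
    nlinarith
  · rw [abs_sub_comm x y]; exact hbd y x
  · have e : b y - b x - b' x * (y - x) - (b y - b x' - b' x' * (y - x'))
        = -(b x - b x' - b' x' * (x - x')) + (b' x' - b' x) * (y - x) := by ring
    rw [e]
    refine (abs_add_le _ _).trans ?_
    rw [abs_neg, abs_mul, abs_sub_comm y x]
    have p1 := hbd x x'
    have p2 := mul_le_mul_of_nonneg_right (hb'l x' x) (abs_nonneg (x - y))
    rw [abs_sub_comm x' x] at p2
    have h3 : 0 ≤ C * (|x - x'| * |x - y|) := by positivity
    nlinarith

/-- These averages over the segment from `b x` to `b y`, which stays in `[δ, M]` by convexity, are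
the integral remainders of Taylor expansions in the diffusivity. -/
lemma Fam.biWk_integral {δ M d α Cb : ℝ} (hδ : 0 < δ) (hM : 0 < M) {H : ℝ → ℝ → ℝ → ℝ}
    (hH : H ∈ Fam d) {φ : ℝ → ℝ} (hφ : Continuous φ) (hφ1 : ∀ s ∈ Icc (0 : ℝ) 1, |φ s| ≤ 1)
    {b : ℝ → ℝ} (hb : ∀ x, b x ∈ Icc δ M) (hα : 0 ≤ α) (hα1 : α ≤ 1) (hCb : 0 ≤ Cb)
    (hbh : ∀ x y, |b x - b y| ≤ Cb * |x - y| ^ α) :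
    BiWk (8 * M) (1 - d / 2) 1 α
      (fun t x y => ∫ s in (0 : ℝ)..1, φ s * H (b x + s * (b y - b x)) t (x - y)) := by
  have hm : ∀ s ∈ Icc (0 : ℝ) 1, ∀ x y, b x + s * (b y - b x) ∈ Icc δ M := by
    intro s hs x y
    have h1 := (convex_Icc δ M).add_smul_sub_mem (hb x) (hb y) hs
    simpa using h1
  have hle : ∀ s : ℝ, |s| ≤ 1 → ∀ x x', |s * (b x - b x')| ≤ Cb * |x - x'| ^ α := by
    intro s hs x x'
    rw [abs_mul]
    exact (mul_le_of_le_one_left (abs_nonneg _) hs).trans (hbh x x')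
  have habs : ∀ s ∈ Icc (0 : ℝ) 1, |s| ≤ 1 ∧ |1 - s| ≤ 1 := fun s hs =>
    ⟨abs_le.2 ⟨by linarith [hs.1], hs.2⟩, abs_le.2 ⟨by linarith [hs.2], by linarith [hs.1]⟩⟩
  constructor
  · have := Fam.wk_integral hδ hM hH hφ hφ1 (β := fun s x y => b x + s * (b y - b x))
      (fun x y => by fun_prop) hm hα hα1 hCb (fun s hs x x' y => by
        rw [show b x + s * (b y - b x) - (b x' + s * (b y - b x')) = (1 - s) * (b x - b x') by ring]
        exact hle _ (habs s hs).2 x x') 1 abs_one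
    simpa only [one_mul] using this
  · have := Fam.wk_integral hδ hM hH hφ hφ1 (β := fun s x y => b y + s * (b x - b y))
      (fun x y => by fun_prop) (fun s hs x y => hm s hs y x) hα hα1 hCb (fun s hs x x' y => by
        rw [show b y + s * (b x - b y) - (b y + s * (b x' - b y)) = s * (b x - b x') by ring]
        exact hle _ (habs s hs).1 x x') (-1) (by simp)
    simp only [neg_one_mul, neg_sub] at this
    exact this

lemma Fam.biWk_left {δ M d α Cb : ℝ} (hδ : 0 < δ) (hM : 0 < M) {H : ℝ → ℝ → ℝ → ℝ}
    (hH : H ∈ Fam d) {b : ℝ → ℝ} (hb : ∀ x, b x ∈ Icc δ M) (hα : 0 ≤ α) (hα1 : α ≤ 1) (hCb : 0 ≤ Cb)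
    (hbh : ∀ x y, |b x - b y| ≤ Cb * |x - y| ^ α) :
    BiWk (8 * M) (1 - d / 2) 1 α (fun t x y => H (b x) t (x - y)) := by
  constructor
  · have := Fam.wk hδ hM hH (β := fun x _ => b x) (fun x _ => hb x) hα hα1 hCb
      (fun x x' _ => hbh x x') 1 abs_one
    simpa only [one_mul] using this
  · have := Fam.wk hδ hM hH (β := fun _ y => b y) (fun _ y => hb y) hα hα1 hCb
      (fun x x' y => by rw [sub_self, abs_zero]; positivity) (-1) (by simp)
    simp only [neg_one_mul, neg_sub] at this
    exact this

lemma Fam.biWk_right {δ M d α Cb : ℝ} (hδ : 0 < δ) (hM : 0 < M) {H : ℝ → ℝ → ℝ → ℝ}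
    (hH : H ∈ Fam d) {b : ℝ → ℝ} (hb : ∀ x, b x ∈ Icc δ M) (hα : 0 ≤ α) (hα1 : α ≤ 1) (hCb : 0 ≤ Cb)
    (hbh : ∀ x y, |b x - b y| ≤ Cb * |x - y| ^ α) :
    BiWk (8 * M) (1 - d / 2) 1 α (fun t x y => H (b y) t (x - y)) := by
  constructor
  · have := Fam.wk hδ hM hH (β := fun _ y => b y) (fun _ y => hb y) hα hα1 hCb
      (fun x x' y => by rw [sub_self, abs_zero]; positivity) 1 abs_one
    simpa only [one_mul] using this
  · have := Fam.wk hδ hM hH (β := fun x _ => b x) (fun x _ => hb x) hα hα1 hCb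
      (fun x x' _ => hbh x x') (-1) (by simp)
    simp only [neg_one_mul, neg_sub] at this
    exact this

lemma Fam.kc_right {d : ℝ} {H : ℝ → ℝ → ℝ → ℝ} (hH : H ∈ Fam d) {b : ℝ → ℝ} (hb : Continuous b)
    (hb0 : ∀ x, 0 < b x) : KC (fun t x y => H (b y) t (x - y)) :=
  (Fam.continuousOn hH).comp (f := fun p : ℝ × ℝ × ℝ => (b p.2.2, p.1, p.2.1 - p.2.2))
    (by fun_prop) (fun p hp => ⟨hb0 _, hp.1, mem_univ _⟩)

lemma Fam.kc_left {d : ℝ} {H : ℝ → ℝ → ℝ → ℝ} (hH : H ∈ Fam d) {b : ℝ → ℝ} (hb : Continuous b)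
    (hb0 : ∀ x, 0 < b x) : KC (fun t x y => H (b x) t (x - y)) :=
  (Fam.continuousOn hH).comp (f := fun p : ℝ × ℝ × ℝ => (b p.2.1, p.1, p.2.1 - p.2.2))
    (by fun_prop) (fun p hp => ⟨hb0 _, hp.1, mem_univ _⟩)

lemma KC.mul_fun {f : ℝ → ℝ → ℝ → ℝ} (hf : KC f) {A : ℝ → ℝ → ℝ}
    (hA : Continuous (fun p : ℝ × ℝ => A p.1 p.2)) : KC (fun t x y => A x y * f t x y) :=
  ContinuousOn.mul (hA.comp continuous_snd).continuousOn hf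

lemma KHx.mono_θ {L θ θ' m κ : ℝ} {f : ℝ → ℝ → ℝ → ℝ} (hf : KHx L θ m κ f) (hθ : θ' ≤ θ) :
    KHx L θ' (m + 1) κ f := by
  obtain ⟨C, hC, hf⟩ := hf
  refine ⟨C * Real.exp ((θ - θ') * (θ - θ')), by positivity,
    fun t ht x x' y => (hf t ht x x' y).trans ?_⟩
  have h1 := rpow_le_exp ht (sub_nonneg.2 hθ)
  have h2 : t ^ (θ - 1 - κ / 2) = t ^ (θ' - 1 - κ / 2) * t ^ (θ - θ') := by
    rw [← Real.rpow_add ht]; ring_nf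
  have h3 := gk_nonneg (L * t) (x - y)
  have h4 := gk_nonneg (L * t) (x' - y)
  rw [h2, add_mul, one_mul, Real.exp_add]
  calc _ ≤ C * (|x - x'| ^ κ * (t ^ (θ' - 1 - κ / 2)
        * (Real.exp ((θ - θ') * (θ - θ')) * Real.exp t) * Real.exp (m * t)
        * (gk (L * t) (x - y) + gk (L * t) (x' - y)))) := by gcongr
    _ = _ := by ring

lemma KReg.mono_θ {L θ θ' m κ : ℝ} {f : ℝ → ℝ → ℝ → ℝ} (hf : KReg L θ m κ f) (hθ : θ' ≤ θ) :
    KReg L θ' (m + 1) κ f := ⟨hf.bd.mono_θ hθ, hf.hx.mono_θ hθ, KHx.mono_θ hf.hy hθ⟩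

/-! ### The corrected parametrix and its defect -/

/-- The first order correction of the frozen heat kernel and its spatial derivatives. -/
def corr (n : ℕ) : ℝ → ℝ → ℝ → ℝ := -famGen 1 2 (n + 3) - (2 : ℝ) • famGen 0 1 (n + 1)

/-- The logarithmic time derivative of `corr n`. -/
def corrD (n : ℕ) : ℝ → ℝ → ℝ → ℝ :=
  -((2 : ℝ) • famGen 1 2 (n + 3) + famGen 2 3 (n + 5))
    - (2 : ℝ) • (famGen 0 1 (n + 1) + famGen 1 2 (n + 3))

lemma corr_mem (n : ℕ) : corr n ∈ Fam (n - 1) := by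
  refine Submodule.sub_mem _ (Submodule.neg_mem _ ?_) (Submodule.smul_mem _ _ ?_) <;>
  · apply famGen_mem; push_cast; ring

lemma corrD_mem (n : ℕ) : corrD n ∈ Fam (n - 1) := by
  refine Submodule.sub_mem _ (Submodule.neg_mem _ (Submodule.add_mem _ (Submodule.smul_mem _ _ ?_) ?_))
    (Submodule.smul_mem _ _ (Submodule.add_mem _ ?_ ?_)) <;>
  · apply famGen_mem; push_cast; ring

lemma hasDerivAt_corr_space (n : ℕ) (lam t w : ℝ) :
    HasDerivAt (corr n lam t) (corr (n + 1) lam t w) w :=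
  (hasDerivAt_famGen_space 1 2 (n + 3) lam t w).neg.sub
    ((hasDerivAt_famGen_space 0 1 (n + 1) lam t w).const_mul 2)

lemma hasDerivAt_corr_time (n : ℕ) {lam t : ℝ} (hl : 0 < lam) (ht : 0 < t) (w : ℝ) :
    HasDerivAt (fun s => corr n lam s w) (corrD n lam t w / t) t := by
  refine ((hasDerivAt_famGen_time 1 2 (n + 3) hl ht w).neg.sub
    ((hasDerivAt_famGen_time 0 1 (n + 1) hl ht w).const_mul 2)).congr_deriv ?_
  simp only [corrD, Pi.sub_apply, Pi.neg_apply, Pi.add_apply, Pi.smul_apply, smul_eq_mul]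
  push_cast
  ring

/-- The parametrix with coefficient `B` of the correction, and its spatial derivatives. -/
def pker (b B : ℝ → ℝ) (n : ℕ) (t x y : ℝ) : ℝ :=
  famGen 0 0 n (b y) t (x - y) + B y * corr n (b y) t (x - y)

/-- The logarithmic time derivative of the parametrix. -/
def pkerD (b B : ℝ → ℝ) (t x y : ℝ) : ℝ :=
  famGen 1 1 2 (b y) t (x - y) + B y * corrD 0 (b y) t (x - y)

/-- The defect of the parametrix. -/
def defect (b B : ℝ → ℝ) (t x y : ℝ) : ℝ :=
  (b x - b y - B y * (x - y)) * famGen 0 0 2 (b y) t (x - y)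
    + B y * (b x - b y) * corr 2 (b y) t (x - y)

/-- The logarithmic time derivative of the defect. -/
def defectD (b B : ℝ → ℝ) (t x y : ℝ) : ℝ :=
  (b x - b y - B y * (x - y)) * famGen 1 1 4 (b y) t (x - y)
    + B y * (b x - b y) * corrD 2 (b y) t (x - y)

lemma hasDerivAt_pker_space (b B : ℝ → ℝ) (n : ℕ) (t x y : ℝ) :
    HasDerivAt (fun x' => pker b B n t x' y) (pker b B (n + 1) t x y) x := by
  have h1 := (hasDerivAt_famGen_space 0 0 n (b y) t (x - y)).comp_sub_const x y
  have h2 := (hasDerivAt_corr_space n (b y) t (x - y)).comp_sub_const x y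
  exact h1.add (h2.const_mul (B y))

lemma hasTimeDeriv_pker {b : ℝ → ℝ} (hb0 : ∀ x, 0 < b x) (B : ℝ → ℝ) :
    HasTimeDeriv (pker b B 0) (pkerD b B) := by
  intro t ht x y
  refine ((hasDerivAt_famGen_time 0 0 0 (hb0 y) ht (x - y)).add
    ((hasDerivAt_corr_time 0 (hb0 y) ht (x - y)).const_mul (B y))).congr_deriv ?_
  simp only [pkerD]
  push_cast
  ring

lemma hasTimeDeriv_defect {b : ℝ → ℝ} (hb0 : ∀ x, 0 < b x) (B : ℝ → ℝ) :
    HasTimeDeriv (defect b B) (defectD b B) := by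
  intro t ht x y
  refine (((hasDerivAt_famGen_time 0 0 2 (hb0 y) ht (x - y)).const_mul _).add
    ((hasDerivAt_corr_time 2 (hb0 y) ht (x - y)).const_mul _)).congr_deriv ?_
  simp only [defectD]
  push_cast
  ring

/-- The recurrence for the third derivative amounts to `(∂_t - λ ∂_w²) corr 0 = w ∂_w² Z`. Hence the
correction cancels the linear term `B y * (x - y)` in the defect. -/
lemma pker_two_eq {b : ℝ → ℝ} (hb0 : ∀ x, 0 < b x) (B : ℝ → ℝ) {t : ℝ} (ht : 0 < t) (x y : ℝ) :
    pker b B 2 t x y = (pkerD b B t x y / t + defect b B t x y) / b x := by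
  rw [eq_div_iff (hb0 x).ne', div_add' _ _ _ ht.ne', eq_div_iff ht.ne']
  have h := gkD_rec (u := 2 * b y * t) (by have := hb0 y; positivity) 1 (x - y)
  simp only [pker, pkerD, defect, corr, corrD, famGen, Pi.sub_apply, Pi.neg_apply, Pi.add_apply,
    Pi.smul_apply, smul_eq_mul]
  norm_num at h ⊢
  linear_combination (B y * t) * h

/-- Regularity of the coefficients of the parametrix. -/
structure FreezeData (δ M α Cb ν : ℝ) (b B : ℝ → ℝ) : Prop where
  δ_pos : 0 < δ
  α_pos : 0 < α
  α_le : α ≤ 1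
  αν : α ≤ ν
  ν_le : ν ≤ 2
  Cb_nonneg : 0 ≤ Cb
  mem : ∀ x, b x ∈ Icc δ M
  holder : ∀ x y, |b x - b y| ≤ Cb * |x - y| ^ α
  corr_left : BiCoef 0 1 α (fun x _ => B x)
  corr_cont : Continuous B
  coef_one : BiCoef (ν / 2) 0 α (fun x y => b x - b y - B y * (x - y))
  coef_two : BiCoef (ν / 2 - 1 / 2) 0 α (fun x y => B y * (b x - b y))

namespace FreezeData

variable {δ M α Cb ν : ℝ} {b B : ℝ → ℝ}

lemma M_pos (h : FreezeData δ M α Cb ν b B) : 0 < M :=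
  h.δ_pos.trans_le ((h.mem 0).1.trans (h.mem 0).2)

lemma b_pos (h : FreezeData δ M α Cb ν b B) (x : ℝ) : 0 < b x := h.δ_pos.trans_le (h.mem x).1

lemma continuous (h : FreezeData δ M α Cb ν b B) : Continuous b := by
  rw [continuous_iff_continuousAt]
  intro x
  rw [ContinuousAt, tendsto_iff_dist_tendsto_zero]
  have h1 : Tendsto (fun y : ℝ => Cb * |y - x| ^ α) (𝓝 x) (𝓝 0) := by
    have : Continuous (fun y : ℝ => Cb * |y - x| ^ α) :=
      continuous_const.mul ((by fun_prop : Continuous fun y : ℝ => |y - x|).rpow_const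
        fun _ => Or.inr h.α_pos.le)
    have h2 := this.tendsto x
    rwa [sub_self, abs_zero, Real.zero_rpow h.α_pos.ne', mul_zero] at h2
  exact squeeze_zero (fun _ => dist_nonneg) (fun y => by rw [Real.dist_eq]; exact h.holder y x) h1

lemma biWk_right (h : FreezeData δ M α Cb ν b B) {d : ℝ} {H : ℝ → ℝ → ℝ → ℝ} (hH : H ∈ Fam d) :
    BiWk (8 * M) (1 - d / 2) 1 α (fun t x y => H (b y) t (x - y)) :=
  Fam.biWk_right h.δ_pos h.M_pos hH h.mem h.α_pos.le h.α_le h.Cb_nonneg h.holder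

/-- Regularity of a sum of a frozen kernel and a multiple of a correction of lower degree. -/
lemma kreg_add (h : FreezeData δ M α Cb ν b B) {d κ : ℝ} {H H' : ℝ → ℝ → ℝ → ℝ} (hH : H ∈ Fam d)
    (hH' : H' ∈ Fam (d - 1)) (hκ : 0 ≤ κ) (hκα : κ ≤ α) :
    KReg (8 * M) (1 - d / 2) 3 κ
      (fun t x y => H (b y) t (x - y) + B y * H' (b y) t (x - y)) := by
  refine (((h.biWk_right hH).kreg hκ hκα).mono_m (by norm_num)).add ?_
  have h2 := ((h.biWk_right hH').mul h.corr_left.swap).kreg hκ hκα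
  exact (h2.mono_θ (by linarith)).mono_m (by norm_num)

lemma kc_add (h : FreezeData δ M α Cb ν b B) {d : ℝ} {H H' : ℝ → ℝ → ℝ → ℝ} (hH : H ∈ Fam d)
    (hH' : H' ∈ Fam (d - 1)) :
    KC (fun t x y => H (b y) t (x - y) + B y * H' (b y) t (x - y)) :=
  (Fam.kc_right hH h.continuous h.b_pos).add ((Fam.kc_right hH' h.continuous h.b_pos).mul_fun
    (A := fun _ y => B y) (h.corr_cont.comp continuous_snd))

/-- The number `ν` is the parabolic order gained: `α` for `B = 0` and `2` for `B = b'`. A gain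
`t^{ν/2}` against a kernel of degree two and a gain `t^{(ν-1)/2}` against one of degree one give the
same time exponent. -/
lemma kreg_defect_of_mem (h : FreezeData δ M α Cb ν b B) {κ : ℝ} {H H' : ℝ → ℝ → ℝ → ℝ}
    (hH : H ∈ Fam 2) (hH' : H' ∈ Fam 1) (hκ : 0 ≤ κ) (hκα : κ ≤ α) :
    KReg (8 * M) (ν / 2) 1 κ
      (fun t x y => (b x - b y - B y * (x - y)) * H (b y) t (x - y)
        + B y * (b x - b y) * H' (b y) t (x - y)) := by
  have h1 := ((h.biWk_right hH).mul h.coef_one).kreg hκ hκα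
  have h2 := ((h.biWk_right hH').mul h.coef_two).kreg hκ hκα
  rw [show 1 - 2 / 2 + ν / 2 = ν / 2 by ring, add_zero] at h1
  rw [show 1 - 1 / 2 + (ν / 2 - 1 / 2) = ν / 2 by ring, add_zero] at h2
  exact h1.add h2

lemma kc_defect_of_mem (h : FreezeData δ M α Cb ν b B) {d d' : ℝ} {H H' : ℝ → ℝ → ℝ → ℝ}
    (hH : H ∈ Fam d) (hH' : H' ∈ Fam d') :
    KC (fun t x y => (b x - b y - B y * (x - y)) * H (b y) t (x - y)
        + B y * (b x - b y) * H' (b y) t (x - y)) := by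
  have hb := h.continuous
  have hB := h.corr_cont
  exact ((Fam.kc_right hH hb h.b_pos).mul_fun (A := fun x y => b x - b y - B y * (x - y))
    (by fun_prop)).add ((Fam.kc_right hH' hb h.b_pos).mul_fun (A := fun x y => B y * (b x - b y))
    (by fun_prop))

lemma mem_two : famGen 0 0 2 ∈ Fam 2 := famGen_mem _ _ _ (by norm_num)
lemma mem_four : famGen 1 1 4 ∈ Fam 2 := famGen_mem _ _ _ (by norm_num)
lemma corr_two_mem : corr 2 ∈ Fam 1 := by have := corr_mem 2; norm_num at this; exact this
lemma corrD_two_mem : corrD 2 ∈ Fam 1 := by have := corrD_mem 2; norm_num at this; exact this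

lemma kreg_pker (h : FreezeData δ M α Cb ν b B) (n : ℕ) {κ : ℝ} (hκ : 0 ≤ κ) (hκα : κ ≤ α) :
    KReg (8 * M) (1 - n / 2) 3 κ (pker b B n) :=
  h.kreg_add (famGen_mem 0 0 n (by push_cast; ring)) (corr_mem n) hκ hκα

lemma kc_pker (h : FreezeData δ M α Cb ν b B) (n : ℕ) : KC (pker b B n) :=
  h.kc_add (famGen_mem 0 0 n (by push_cast; ring) : famGen 0 0 n ∈ Fam (n : ℝ)) (corr_mem n)

lemma kreg_pkerD (h : FreezeData δ M α Cb ν b B) {κ : ℝ} (hκ : 0 ≤ κ) (hκα : κ ≤ α) :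
    KReg (8 * M) 1 3 κ (pkerD b B) := by
  have := h.kreg_add (d := 0) (famGen_mem 1 1 2 (by norm_num))
    (by have := corrD_mem 0; norm_num at this ⊢; exact this) hκ hκα
  simp only [zero_div, sub_zero] at this
  exact this

lemma kc_pkerD (h : FreezeData δ M α Cb ν b B) : KC (pkerD b B) :=
  h.kc_add (d := 0) (famGen_mem 1 1 2 (by norm_num))
    (by have := corrD_mem 0; norm_num at this ⊢; exact this)

lemma approx_pker (h : FreezeData δ M α Cb ν b B) :
    KBd (8 * M) (3 / 2) 2 (fun t x y => pker b B 0 t x y - gk (2 * b y * t) (x - y)) := by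
  have h1 := ((h.biWk_right (corr_mem 0)).mul h.corr_left.swap).1.kbd
  norm_num at h1
  refine h1.congr fun t _ x y => ?_
  simp [pker, famGen, gkD_zero]

end FreezeData

/-! ### Construction of the fundamental solution -/

/-- A family of three kernels, indexed by the order of differentiation. -/
def threeKer (f g h : ℝ → ℝ → ℝ → ℝ) : ℕ → ℝ → ℝ → ℝ → ℝ
  | 0 => f
  | 1 => g
  | _ => h

/-- Existence of a fundamental solution, with estimates of the remainder of the parametrix. -/
theorem exists_fundamentalSolution {δ M A θ₀ : ℝ} (hM : 0 < M) (hA : 0 ≤ A) (hθ₀ : 0 < θ₀)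
    (hθ₁ : θ₀ ≤ 1) : ∃ m : ℝ, 1 ≤ m ∧ ∀ (α Cb ν : ℝ) (b B : ℝ → ℝ), FreezeData δ M α Cb ν b B →
      (∀ t > 0, ∀ x z, |defect b B t x z| ≤ volt A θ₀ t * gk (8 * M * t) (x - z)) →
      (∀ t > 0, ∀ x z, |defectD b B t x z| ≤ volt A θ₀ t * gk (8 * M * t) (x - z)) →
      ∃ (Q : ℝ → ℝ → ℝ → ℝ) (R : ℕ → ℝ → ℝ → ℝ → ℝ),
        (∀ c, IsFundamentalSolution b c (fun t x y => Real.exp (-c * t) * Q t x y)) ∧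
        (∀ c, ∀ k ≤ 2, ∀ t > 0, ∀ x y,
          iteratedDeriv k (fun x' => Real.exp (-c * t) * Q t x' y) x
            = Real.exp (-c * t) * (pker b B k t x y + R k t x y)) ∧
        ∀ k ≤ 2, KC (R k) ∧
          ∀ κ ∈ Ico 0 α, KReg (8 * M) (1 + ν / 2 - (k : ℝ) / 2) m κ (R k) := by
  have hL : 0 < 8 * M := by positivity
  -- The rate is chosen from `M`, `A`, `θ₀` before `b` is given; `α`, `Cb` and `ν` can then
  -- influence only multiplicative constants.
  obtain ⟨m, hm, H⟩ := exists_volterraSol hL hA hθ₀ hθ₁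
  refine ⟨m + 4, by linarith, fun α Cb ν b B h hK hDK => ?_⟩
  have hb0 := h.b_pos
  have hbc := h.continuous
  have hα := h.α_pos
  have hα1 := h.α_le
  have hαν := h.αν
  have hν2 := h.ν_le
  have hδ := h.δ_pos
  have kK := h.kc_defect_of_mem FreezeData.mem_two FreezeData.corr_two_mem
  have kDK := h.kc_defect_of_mem FreezeData.mem_four FreezeData.corrD_two_mem
  obtain ⟨Φ, DΦ, hΦ⟩ := H _ _ kK kDK (hasTimeDeriv_defect hb0 B) hK hDK
  have rK := fun κ => h.kreg_defect_of_mem (κ := κ) FreezeData.mem_two FreezeData.corr_two_mem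
  have rDK := fun κ => h.kreg_defect_of_mem (κ := κ) FreezeData.mem_four FreezeData.corrD_two_mem
  have rK0 := rK 0 le_rfl hα.le
  have rDK0 := rDK 0 le_rfl hα.le
  have hν0 : 0 < ν / 2 := by linarith
  -- The same solution is measured a second time, with the exponent `ν/2` of the actual regularity
  -- and the same `m`.
  obtain ⟨bΦ, bDΦ⟩ := hΦ.bd (ν / 2) hν0 (by linarith) rK0.bd rDK0.bd
  set n := m + 3 with hn
  have gP : GK (8 * M) 1 n (pker b B 0) :=
    ⟨h.kc_pker 0, by have := (h.kreg_pker 0 le_rfl hα.le).bd.mono_m (show 3 ≤ n by linarith)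
                     simpa using this⟩
  have gPx : GK (8 * M) (1 / 2) n (pker b B 1) :=
    ⟨h.kc_pker 1, by have := (h.kreg_pker 1 le_rfl hα.le).bd.mono_m (show 3 ≤ n by linarith)
                     norm_num at this ⊢; exact this⟩
  have gDP : GK (8 * M) 1 n (pkerD b B) :=
    ⟨h.kc_pkerD, (h.kreg_pkerD le_rfl hα.le).bd.mono_m (by linarith)⟩
  have gΦ : GK (8 * M) (ν / 2) n Φ := ⟨hΦ.gk.cont, bΦ.mono_m (by linarith)⟩
  have gDΦ : GK (8 * M) (ν / 2) n DΦ := ⟨hΦ.gk'.cont, bDΦ.mono_m (by linarith)⟩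
  -- the fundamental solution
  set θ₁ := min θ₀ (1 / 2) with hθ₁def
  have hθ₁0 : 0 < θ₁ := lt_min hθ₀ (by norm_num)
  have hθ₁a : θ₁ ≤ θ₀ := min_le_left _ _
  have hθ₁b : θ₁ ≤ 1 / 2 := min_le_right _ _
  have bK : KBd (8 * M) θ₀ 1 (defect b B) :=
    ⟨A, hA, fun t ht x y => (hK t ht x y).trans_eq (by unfold volt; rw [one_mul]; ring)⟩
  have hpar : Parametrix b (8 * M) n θ₁ (pker b B 0) (pkerD b B) (pker b B 1) (defect b B) := by
    refine ⟨gP, gDP, gPx, ⟨kK, (bK.mono_θ hθ₁a).mono_m (by linarith)⟩, hasTimeDeriv_pker hb0 B,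
      fun t _ x y => hasDerivAt_pker_space b B 0 t x y, fun t ht x y => ?_,
      (h.approx_pker.mono_θ (by linarith)).mono_m (by linarith)⟩
    rw [← pker_two_eq hb0 B ht]
    exact hasDerivAt_pker_space b B 1 t x y
  have hheat := hpar.heatLike hδ hL hθ₁0 h.mem hbc
    ⟨hΦ.gk.cont, (hΦ.gk.bd.mono_θ hθ₁a).mono_m (by linarith)⟩
    ⟨hΦ.gk'.cont, (hΦ.gk'.bd.mono_θ hθ₁a).mono_m (by linarith)⟩ hΦ.deriv hΦ.eq
  set DR : ℝ → ℝ → ℝ → ℝ := fun t x y => conv (pker b B 0) Φ t x y + conv (pkerD b B) Φ t x y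
    + conv (pker b B 0) DΦ t x y with hDR
  -- For `k = 2` the remainder is obtained by solving the equation for `∂_x²`, so that its bounds
  -- come from convolutions without singular kernels.
  set R2 : ℝ → ℝ → ℝ → ℝ := fun t x y => (DR t x y / t - defect b B t x y) / b x with hR2
  have h1 : (0 : ℝ) < 1 := one_pos
  have hh : (0 : ℝ) < 1 / 2 := by norm_num
  refine ⟨_, threeKer (conv (pker b B 0) Φ) (conv (pker b B 1) Φ) R2,
    fun c => hheat.isFundamentalSolution hδ hL hθ₁0 h.mem hbc c, fun c k hk t ht x y => ?_,
    fun k hk => ?_⟩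
  · have hd := hheat.iteratedDeriv_eq c ht x y
    interval_cases k
    · simp only [iteratedDeriv_zero]; rfl
    · exact hd.1
    · rw [hd.2, pker_two_eq hb0 B ht]
      congr 1
      simp only [threeKer, hR2, hDR]
      ring
  · have cDR : KC DR := ((KC.conv hL h1 hν0 gP gΦ).add (KC.conv hL h1 hν0 gDP gΦ)).add
      (KC.conv hL h1 hν0 gP gDΦ)
    -- The strict inequality `κ < α ≤ ν` keeps `ν/2 - κ/2` positive, as required for convergence of
    -- the time integrals.
    have kr : ∀ κ ∈ Ico 0 α, KHy (8 * M) (ν / 2) n κ Φ ∧ KHy (8 * M) (ν / 2) n κ DΦ := by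
      intro κ hκ
      obtain ⟨q1, q2⟩ := hΦ.hy (ν / 2) κ (by linarith [hκ.2]) (by linarith [hκ.1])
        (rK κ hκ.1 hκ.2.le).hy (rDK κ hκ.1 hκ.2.le).hy
      exact ⟨KHx.mono_m q1 (by linarith), KHx.mono_m q2 (by linarith)⟩
    have kr0 : ∀ κ ∈ Ico 0 α, KReg (8 * M) (1 + ν / 2) n κ (conv (pker b B 0) Φ) := fun κ hκ => by
      have := ((h.kreg_pker 0 hκ.1 hκ.2.le).mono_m (show 3 ≤ n by linarith)).hx
      norm_num at this
      exact KReg.conv hL h1 (by linarith [hκ.2]) hν0 (by linarith [hκ.2]) gP this gΦ (kr κ hκ).1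
    interval_cases k
    · refine ⟨KC.conv hL h1 hν0 gP gΦ, fun κ hκ => ?_⟩
      have := (kr0 κ hκ).mono_m (show n ≤ m + 4 by linarith)
      simpa [threeKer] using this
    · refine ⟨KC.conv hL hh hν0 gPx gΦ, fun κ hκ => ?_⟩
      have := ((h.kreg_pker 1 hκ.1 hκ.2.le).mono_m (show 3 ≤ n by linarith)).hx
      norm_num at this
      have := (KReg.conv hL hh (by linarith [hκ.2]) hν0 (by linarith [hκ.2]) gPx this gΦ
        (kr κ hκ).1).mono_m (show n ≤ m + 4 by linarith)
      rw [show 1 + ν / 2 - ((1 : ℕ) : ℝ) / 2 = 1 / 2 + ν / 2 by push_cast; ring]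
      exact this
    · refine ⟨KC.div_left (f := fun t x y => DR t x y / t - defect b B t x y)
        (cDR.div_time.sub kK) hbc hb0, fun κ hκ => ?_⟩
      have q1 := ((h.kreg_pkerD hκ.1 hκ.2.le).mono_m (show 3 ≤ n by linarith)).hx
      have q2 := ((h.kreg_pker 0 hκ.1 hκ.2.le).mono_m (show 3 ≤ n by linarith)).hx
      norm_num at q2
      have r1 := KReg.conv hL h1 (by linarith [hκ.2]) hν0 (by linarith [hκ.2]) gDP q1 gΦ (kr κ hκ).1
      have r2 := KReg.conv hL h1 (by linarith [hκ.2]) hν0 (by linarith [hκ.2]) gP q2 gDΦ (kr κ hκ).2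
      have r3 := (((kr0 κ hκ).add r1).add r2).div_time
      rw [add_sub_cancel_left] at r3
      have r4 := (r3.sub ((rK κ hκ.1 hκ.2.le).mono_m (by linarith))).div_left hκ.1 hκ.2.le hα1 hδ
        (fun x => (h.mem x).1) h.Cb_nonneg h.holder
      rw [show 1 + ν / 2 - ((2 : ℕ) : ℝ) / 2 = ν / 2 by push_cast; ring,
        show m + 4 = n + 1 by rw [hn]; ring]
      exact r4

/-! ### Passage to the Gaussian classes -/

/-- The dictionary between the two scales of exponents is `ζ = 2θ - 2`: the normalisation of the
density supplies the remaining factor `t^{-1/2}`. -/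
lemma gk_eq_gaussKernel {L t : ℝ} (hL : 0 < L) (ht : 0 < t) (θ w : ℝ) :
    t ^ (θ - 1) * gk (L * t) w
      = (√(2 * Real.pi * L))⁻¹ * gaussKernel (1 / (2 * L)) (2 * θ - 2) t w := by
  unfold gk gaussKernel
  have h1 : √(2 * Real.pi * (L * t)) = √(2 * Real.pi * L) * √t := by
    rw [← mul_assoc, Real.sqrt_mul' _ ht.le]
  have h2 : t ^ (θ - 1) = t ^ ((2 * θ - 2 - 1) / 2) * √t := by
    rw [Real.sqrt_eq_rpow, ← Real.rpow_add ht]; ring_nf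
  have h3 : -w ^ 2 / (2 * (L * t)) = -(1 / (2 * L)) * (w ^ 2 / t) := by field_simp
  have hs : √t ≠ 0 := (Real.sqrt_pos.2 ht).ne'
  rw [h1, h2, h3, mul_inv]
  field_simp

lemma MemGaussClassOn.congr {ι : Type*} {S : Set ι} {ζ β₁ β₂ : ℝ} {A B : ι → ℝ → ℝ → ℝ → ℝ}
    (hA : MemGaussClassOn S ζ β₁ β₂ A) (h : ∀ i ∈ S, ∀ t > 0, ∀ x y, A i t x y = B i t x y) :
    MemGaussClassOn S ζ β₁ β₂ B := by
  refine ⟨fun i hi t ht => ?_, ?_, fun κ hκ => ?_, fun κ hκ => ?_⟩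
  · simpa only [h i hi t ht] using hA.continuous i hi t ht
  · obtain ⟨C, hC, γ, hγ, ρ, hρ, H⟩ := hA.bound
    exact ⟨C, hC, γ, hγ, ρ, hρ, fun i hi t ht x y => h i hi t ht x y ▸ H i hi t ht x y⟩
  · obtain ⟨C, hC, γ, hγ, ρ, hρ, H⟩ := hA.holder_left κ hκ
    exact ⟨C, hC, γ, hγ, ρ, hρ, fun i hi t ht x x' y =>
      h i hi t ht x y ▸ h i hi t ht x' y ▸ H i hi t ht x x' y⟩
  · obtain ⟨C, hC, γ, hγ, ρ, hρ, H⟩ := hA.holder_right κ hκ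
    exact ⟨C, hC, γ, hγ, ρ, hρ, fun i hi t ht x y y' =>
      h i hi t ht x y ▸ h i hi t ht x y' ▸ H i hi t ht x y y'⟩

/-- Kernels with Gaussian bounds of growth `m` belong to the Gaussian classes, after multiplication
by `e^{-ct}` with `c > m`. -/
lemma memGaussClassOn_exp_mul {ι : Type*} {S : Set ι} {L θ m c β : ℝ} (hL : 0 < L) (hmc : m < c)
    {f : ι → ℝ → ℝ → ℝ → ℝ} (hf : ∀ i ∈ S, KC (f i))
    (hbd : ∃ C : ℝ, 0 ≤ C ∧ ∀ i ∈ S, ∀ t > 0, ∀ x y, |f i t x y|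
      ≤ C * (t ^ (θ - 1) * Real.exp (m * t) * gk (L * t) (x - y)))
    (hx : ∀ κ ∈ Ico 0 β, ∃ C : ℝ, 0 ≤ C ∧ ∀ i ∈ S, ∀ t > 0, ∀ x x' y, |f i t x y - f i t x' y|
      ≤ C * (|x - x'| ^ κ * (t ^ (θ - 1 - κ / 2) * Real.exp (m * t)
        * (gk (L * t) (x - y) + gk (L * t) (x' - y)))))
    (hy : ∀ κ ∈ Ico 0 β, ∃ C : ℝ, 0 ≤ C ∧ ∀ i ∈ S, ∀ t > 0, ∀ y y' x, |f i t x y - f i t x y'|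
      ≤ C * (|y - y'| ^ κ * (t ^ (θ - 1 - κ / 2) * Real.exp (m * t)
        * (gk (L * t) (y - x) + gk (L * t) (y' - x))))) :
    MemGaussClassOn S (2 * θ - 2) β β (fun i t x y => Real.exp (-c * t) * f i t x y) := by
  have hγ : 0 < c - m := by linarith
  have hρ : 0 < 1 / (2 * L) := by positivity
  have hexp : ∀ t : ℝ, Real.exp (-c * t) * Real.exp (m * t) = Real.exp (-(c - m) * t) := fun t => by
    rw [← Real.exp_add]; ring_nf
  have hg0 : ∀ ρ ζ t w : ℝ, 0 < t → 0 ≤ gaussKernel ρ ζ t w := fun ρ ζ t w ht => by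
    unfold gaussKernel; positivity
  set D := (√(2 * Real.pi * L))⁻¹ with hD
  have hD0 : 0 < D := by positivity
  have key : ∀ {C r w w' κ t d : ℝ}, 0 ≤ C → 0 < t → 0 ≤ r →
      d ≤ C * (r * (t ^ (θ - 1 - κ / 2) * Real.exp (m * t) * (gk (L * t) w + gk (L * t) w'))) →
      Real.exp (-c * t) * d ≤ (C * D + 1) * Real.exp (-(c - m) * t) * r
        * (gaussKernel (1 / (2 * L)) (2 * θ - 2 - κ) t w
          + gaussKernel (1 / (2 * L)) (2 * θ - 2 - κ) t w') := by
    intro C r w w' κ t d hC ht hr hd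
    have e1 := gk_eq_gaussKernel hL ht (θ - κ / 2) w
    have e2 := gk_eq_gaussKernel hL ht (θ - κ / 2) w'
    rw [show θ - κ / 2 - 1 = θ - 1 - κ / 2 by ring, show 2 * (θ - κ / 2) - 2 = 2 * θ - 2 - κ by ring]
      at e1 e2
    have p1 := hg0 (1 / (2 * L)) (2 * θ - 2 - κ) t w ht
    have p2 := hg0 (1 / (2 * L)) (2 * θ - 2 - κ) t w' ht
    calc _ ≤ Real.exp (-c * t) * (C * (r * (t ^ (θ - 1 - κ / 2) * Real.exp (m * t)
          * (gk (L * t) w + gk (L * t) w')))) := by gcongr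
      _ = C * r * (Real.exp (-c * t) * Real.exp (m * t))
          * (t ^ (θ - 1 - κ / 2) * gk (L * t) w + t ^ (θ - 1 - κ / 2) * gk (L * t) w') := by ring
      _ = (C * D) * Real.exp (-(c - m) * t) * r
        * (gaussKernel (1 / (2 * L)) (2 * θ - 2 - κ) t w
          + gaussKernel (1 / (2 * L)) (2 * θ - 2 - κ) t w') := by rw [hexp, e1, e2]; ring
      _ ≤ _ := by gcongr; linarith
  refine ⟨fun i hi t ht => ?_, ?_, fun κ hκ => ?_, fun κ hκ => ?_⟩
  · refine continuous_const.mul ?_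
    rw [← continuousOn_univ]
    exact ContinuousOn.comp (hf i hi) (f := fun p : ℝ × ℝ => (t, p.1, p.2)) (by fun_prop)
      (fun _ _ => ⟨ht, mem_univ _⟩)
  · obtain ⟨C, hC, H⟩ := hbd
    refine ⟨C * D + 1, by positivity, c - m, hγ, _, hρ, fun i hi t ht x y => ?_⟩
    rw [abs_mul, Real.abs_exp]
    have e1 := gk_eq_gaussKernel hL ht θ (x - y)
    have p1 := hg0 (1 / (2 * L)) (2 * θ - 2) t (x - y) ht
    calc _ ≤ Real.exp (-c * t) * (C * (t ^ (θ - 1) * Real.exp (m * t) * gk (L * t) (x - y))) := by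
          gcongr; exact H i hi t ht x y
      _ = C * (Real.exp (-c * t) * Real.exp (m * t)) * (t ^ (θ - 1) * gk (L * t) (x - y)) := by ring
      _ = (C * D) * Real.exp (-(c - m) * t) * gaussKernel (1 / (2 * L)) (2 * θ - 2) t (x - y) := by
          rw [hexp, e1]; ring
      _ ≤ _ := by gcongr; linarith
  · obtain ⟨C, hC, H⟩ := hx κ hκ
    refine ⟨C * D + 1, by positivity, c - m, hγ, _, hρ, fun i hi t ht x x' y => ?_⟩
    rw [← mul_sub, abs_mul, Real.abs_exp]
    exact key hC ht (by positivity) (H i hi t ht x x' y)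
  · obtain ⟨C, hC, H⟩ := hy κ hκ
    refine ⟨C * D + 1, by positivity, c - m, hγ, _, hρ, fun i hi t ht x y y' => ?_⟩
    rw [← mul_sub, abs_mul, Real.abs_exp]
    refine key hC ht (by positivity) ((H i hi t ht y y' x).trans_eq ?_)
    rw [gk_sub_comm _ y x, gk_sub_comm _ y' x]

lemma memGaussClass_exp_mul {L θ m c β : ℝ} (hβ : 0 < β) (hL : 0 < L) (hmc : m < c)
    {f : ℝ → ℝ → ℝ → ℝ} (hf : KC f) (h : ∀ κ ∈ Ico 0 β, KReg L θ m κ f) :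
    MemGaussClass (2 * θ - 2) β β (fun t x y => Real.exp (-c * t) * f t x y) := by
  refine memGaussClassOn_exp_mul hL hmc (fun _ _ => hf) ?_ (fun κ hκ => ?_) (fun κ hκ => ?_)
  · obtain ⟨C, hC, H⟩ := (h 0 ⟨le_rfl, hβ⟩).bd
    exact ⟨C, hC, fun _ _ => H⟩
  · obtain ⟨C, hC, H⟩ := (h κ hκ).hx
    exact ⟨C, hC, fun _ _ => H⟩
  · obtain ⟨C, hC, H⟩ := (h κ hκ).hy
    exact ⟨C, hC, fun _ _ => H⟩

lemma Fam.holder_bound {δ M d κ : ℝ} (hδ : 0 < δ) (hM : 0 < M) {H : ℝ → ℝ → ℝ → ℝ} (hH : H ∈ Fam d)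
    (hκ : 0 ≤ κ) (hκ1 : κ ≤ 1) : ∃ C : ℝ, 0 ≤ C ∧ ∀ t > 0, ∀ lam ∈ Icc δ M, ∀ w w' : ℝ,
      |H lam t w - H lam t w'| ≤ C * (|w - w'| ^ κ * (t ^ (-d / 2 - κ / 2)
        * (gk (8 * M * t) w + gk (8 * M * t) w'))) := by
  obtain ⟨C, hC, h1⟩ := Fam.bound hδ hM hH 0
  obtain ⟨D, hD, h2⟩ := Fam.diff_bound hδ hM hH 0
  refine ⟨C + D, by positivity, fun t ht lam hl w w' => ?_⟩
  have hs : 0 < √t := Real.sqrt_pos.2 ht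
  have e : |w - w'| ^ κ * (t ^ (-d / 2 - κ / 2) * (gk (8 * M * t) w + gk (8 * M * t) w'))
      = (|w - w'| / √t) ^ κ * (t ^ (-d / 2) * (gk (8 * M * t) w + gk (8 * M * t) w')) := by
    rw [div_sqrt_rpow ht (abs_nonneg _), show -d / 2 - κ / 2 = -d / 2 + -κ / 2 by ring,
      Real.rpow_add ht]
    ring
  rw [e]
  set r := |w - w'| / √t with hr
  have hr0 : 0 ≤ r := by positivity
  have g1 := gk_nonneg (8 * M * t) w
  have g2 := gk_nonneg (8 * M * t) w'
  have p : 0 ≤ t ^ (-d / 2) := by positivity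
  rcases le_total r 1 with h | h
  · have := h2 t ht lam hl lam hl w w' (by rw [abs_sub_comm]; exact (div_le_one hs).1 h)
    rw [zero_mul, Real.exp_zero, one_mul, sub_self, abs_zero, zero_add] at this
    have h3 : r ≤ r ^ κ := by
      rcases eq_or_lt_of_le hr0 with h0 | h0
      · rw [← h0]; positivity
      · have := Real.rpow_le_rpow_of_exponent_ge h0 h hκ1
        rwa [Real.rpow_one] at this
    calc _ ≤ D * (r * (t ^ (-d / 2) * gk (8 * M * t) w)) := this
      _ ≤ (C + D) * (r ^ κ * (t ^ (-d / 2) * (gk (8 * M * t) w + gk (8 * M * t) w'))) := by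
          gcongr <;> linarith
  · have q1 := h1 t ht lam hl w w (by simp)
    have q2 := h1 t ht lam hl w' w' (by simp)
    rw [zero_mul, Real.exp_zero, one_mul] at q1 q2
    have h3 := Real.one_le_rpow h hκ
    calc _ ≤ C * (1 * (t ^ (-d / 2) * (gk (8 * M * t) w + gk (8 * M * t) w'))) := by
          refine (abs_sub _ _).trans ((add_le_add q1 q2).trans_eq (by ring))
      _ ≤ _ := by gcongr; linarith

/-- A translation invariant kernel from the heat family belongs to the Gaussian class, uniformly for
diffusion constants in a compact set. -/
lemma Fam.memGaussClassOn {d c : ℝ} (hc : 0 < c) {H : ℝ → ℝ → ℝ → ℝ} (hH : H ∈ Fam d) {K : Set ℝ}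
    (hK : IsCompact K) (hK0 : K ⊆ Ioi 0) :
    MemGaussClassOn K (-d) 1 1 (fun lam t x y => Real.exp (-c * t) * H lam t (x - y)) := by
  obtain ⟨δ, M, hδ, hM, hKs⟩ : ∃ δ M : ℝ, 0 < δ ∧ 0 < M ∧ K ⊆ Icc δ M := by
    rcases K.eq_empty_or_nonempty with rfl | hne
    · exact ⟨1, 1, one_pos, one_pos, empty_subset _⟩
    · obtain ⟨δ, hδ, h1⟩ := hK.exists_isLeast hne
      obtain ⟨M, hM, h2⟩ := hK.exists_isGreatest hne
      exact ⟨δ, M, hK0 hδ, hK0 hM, fun x hx => ⟨h1 hx, h2 hx⟩⟩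
  have hd : -d = 2 * (1 - d / 2) - 2 := by ring
  rw [hd]
  refine memGaussClassOn_exp_mul (f := fun lam t x y => H lam t (x - y)) (L := 8 * M) (m := 0)
    (by positivity) hc (fun lam hl => ?_) ?_ (fun κ hκ => ?_) (fun κ hκ => ?_)
  · exact Fam.kc_right hH continuous_const fun _ => hK0 hl
  · obtain ⟨C, hC, h1⟩ := Fam.bound hδ hM hH 0
    refine ⟨C, hC, fun lam hl t ht x y => ?_⟩
    have := h1 t ht lam (hKs hl) (x - y) (x - y) (by simp)
    rw [zero_mul, Real.exp_zero, one_mul] at this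
    rw [zero_mul, Real.exp_zero, mul_one, show 1 - d / 2 - 1 = -d / 2 by ring]
    exact this
  · obtain ⟨C, hC, h1⟩ := Fam.holder_bound hδ hM hH hκ.1 hκ.2.le
    refine ⟨C, hC, fun lam hl t ht x x' y => ?_⟩
    have := h1 t ht lam (hKs hl) (x - y) (x' - y)
    rw [zero_mul, Real.exp_zero, mul_one, show 1 - d / 2 - 1 = -d / 2 by ring]
    rwa [sub_sub_sub_cancel_right] at this
  · obtain ⟨C, hC, h1⟩ := Fam.holder_bound hδ hM hH hκ.1 hκ.2.le
    refine ⟨C, hC, fun lam hl t ht y y' x => ?_⟩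
    have := h1 t ht lam (hKs hl) (x - y) (x - y')
    rw [zero_mul, Real.exp_zero, mul_one, show 1 - d / 2 - 1 = -d / 2 by ring, gk_sub_comm _ y x,
      gk_sub_comm _ y' x]
    rwa [sub_sub_sub_cancel_left, abs_sub_comm y' y] at this

/-! ### Expansion in the diffusivity -/

/-- The kernels of the first order expansion of the fundamental solution, without killing. -/
def yker (k : ℕ) : ℝ → ℝ → ℝ → ℝ := (k : ℝ) • famGen 0 1 (k + 1) + famGen 1 2 (k + 3)

lemma yker_mem (k : ℕ) : yker k ∈ Fam (k - 1) := by
  refine Submodule.add_mem _ (Submodule.smul_mem _ _ ?_) ?_ <;>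
  · apply famGen_mem; push_cast; ring

/-- To first order, passing from `Z^{b(y)}` to `Z^{b(x)}` costs `(b(y) - b(x)) ∂_λ Z`, that is
`-b'(x) w ∂_λ Z` with `w = x - y`; added to the correction this gives the kernel. The recurrence
removes the factor `w`, so the result stays in the graded family. -/
lemma yker_eq (k : ℕ) {lam t : ℝ} (hl : 0 < lam) (ht : 0 < t) (w : ℝ) :
    yker k lam t w = corr k lam t w - w * famGen 0 1 (k + 2) lam t w := by
  have h := gkD_rec (u := 2 * lam * t) (by positivity) (k + 1) w
  simp only [yker, corr, famGen, Pi.sub_apply, Pi.neg_apply, Pi.add_apply, Pi.smul_apply, smul_eq_mul]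
  push_cast at h
  linear_combination t * h

lemma yker_neg (k : ℕ) {lam t : ℝ} (hl : 0 < lam) (ht : 0 < t) (w : ℝ) :
    yker k lam t (-w) = (-1) ^ (k + 1) * yker k lam t w := by
  have hu : 2 * lam * t ≠ 0 := by positivity
  simp only [yker, famGen, Pi.add_apply, Pi.smul_apply, smul_eq_mul, gkD_neg _ hu]
  ring

lemma integral_taylor_one {g g' : ℝ → ℝ} (hd : ∀ l > 0, HasDerivAt g (g' l) l)
    (hc : ContinuousOn g' (Ioi 0)) {p q : ℝ} (hp : 0 < p) (hq : 0 < q) :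
    g q - g p = (q - p) * ∫ s in (0 : ℝ)..1, g' (p + s * (q - p)) := by
  have hpos : ∀ s ∈ Icc (0 : ℝ) 1, 0 < p + s * (q - p) := fun s hs => by
    have := (convex_Ioi (0 : ℝ)).add_smul_sub_mem hp hq hs
    simpa using this
  have hi : IntervalIntegrable (fun s => (q - p) * g' (p + s * (q - p))) volume 0 1 := by
    refine ContinuousOn.intervalIntegrable_of_Icc zero_le_one (continuousOn_const.mul ?_)
    exact hc.comp (f := fun s => p + s * (q - p)) (by fun_prop) fun s hs => hpos s hs
  have := intervalIntegral.integral_eq_sub_of_hasDerivAt (f := fun s => g (p + s * (q - p)))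
    (fun s hs => by
      rw [uIcc_of_le zero_le_one] at hs
      have h2 : HasDerivAt (fun s => p + s * (q - p)) (q - p) s := by
        simpa using ((hasDerivAt_id s).mul_const (q - p)).const_add p
      exact ((hd _ (hpos s hs)).comp s h2).congr_deriv (mul_comm _ _)) hi
  rw [intervalIntegral.integral_const_mul] at this
  rw [this]
  simp

lemma integral_taylor_two {g g' g'' : ℝ → ℝ} (hd : ∀ l > 0, HasDerivAt g (g' l) l)
    (hd' : ∀ l > 0, HasDerivAt g' (g'' l) l) (hc : ContinuousOn g'' (Ioi 0)) {p q : ℝ} (hp : 0 < p)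
    (hq : 0 < q) : g q - g p - (q - p) * g' p
      = ((q - p) * (q - p)) * ∫ s in (0 : ℝ)..1, (1 - s) * g'' (p + s * (q - p)) := by
  have hpos : ∀ s ∈ Icc (0 : ℝ) 1, 0 < p + s * (q - p) := fun s hs => by
    have := (convex_Ioi (0 : ℝ)).add_smul_sub_mem hp hq hs
    simpa using this
  have hi : IntervalIntegrable (fun s => ((q - p) * (q - p)) * ((1 - s) * g'' (p + s * (q - p))))
      volume 0 1 := by
    refine ContinuousOn.intervalIntegrable_of_Icc zero_le_one (continuousOn_const.mul
      (ContinuousOn.mul (by fun_prop) ?_))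
    exact hc.comp (f := fun s => p + s * (q - p)) (by fun_prop) fun s hs => hpos s hs
  have := intervalIntegral.integral_eq_sub_of_hasDerivAt
    (f := fun s => (1 - s) * ((q - p) * g' (p + s * (q - p))) + g (p + s * (q - p)))
    (fun s hs => by
      rw [uIcc_of_le zero_le_one] at hs
      have h2 : HasDerivAt (fun s => p + s * (q - p)) (q - p) s := by
        simpa using ((hasDerivAt_id s).mul_const (q - p)).const_add p
      have h3 := (hd _ (hpos s hs)).comp s h2
      have h4 := ((hd' _ (hpos s hs)).comp s h2).const_mul (q - p)
      have h5 := (((hasDerivAt_id s).const_sub 1).mul h4).add h3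
      refine h5.congr_deriv ?_
      simp only [id, Function.comp]
      ring) hi
  rw [intervalIntegral.integral_const_mul] at this
  rw [this]
  simp
  ring

lemma Fam.continuousOn_lam {d : ℝ} {H : ℝ → ℝ → ℝ → ℝ} (hH : H ∈ Fam d) {t : ℝ} (ht : 0 < t)
    (w : ℝ) : ContinuousOn (fun l => H l t w) (Ioi 0) :=
  (Fam.continuousOn hH).comp (f := fun l => (l, t, w)) (by fun_prop)
    fun _ hl => ⟨hl, ht, mem_univ _⟩

/-- Freezing at `y` against freezing at `x`. -/
lemma Fam.kreg_sub {δ M d α Cb κ : ℝ} (hδ : 0 < δ) (hM : 0 < M) {H : ℝ → ℝ → ℝ → ℝ} (hH : H ∈ Fam d)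
    {b : ℝ → ℝ} (hb : ∀ x, b x ∈ Icc δ M) (hα : 0 ≤ α) (hα1 : α ≤ 1) (hCb : 0 ≤ Cb)
    (hbh : ∀ x y, |b x - b y| ≤ Cb * |x - y| ^ α) (hκ : 0 ≤ κ) (hκα : κ ≤ α) :
    KReg (8 * M) (1 - d / 2 + α / 2) 1 κ (fun t x y => H (b y) t (x - y) - H (b x) t (x - y)) := by
  obtain ⟨H', hH', hd⟩ := Fam.exists_deriv_lam hH
  have hb0 : ∀ x, 0 < b x := fun x => hδ.trans_le (hb x).1
  have h1 := (((Fam.biWk_integral hδ hM hH' (φ := fun _ => 1) continuous_const (by simp) hb hα hα1 hCb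
    hbh).mul (biCoef_sub hα hα1 hCb hbh).swap).kreg hκ hκα)
  rw [add_zero] at h1
  refine h1.congr fun t ht x y => ?_
  rw [integral_taylor_one (fun l hl => hd l hl t ht (x - y)) (Fam.continuousOn_lam hH' ht _)
    (hb0 x) (hb0 y)]
  simp only [one_mul]

/-- The second order comparison of the parametrix with the expansion frozen at `x`. -/
lemma kreg_expansion {δ M C κ : ℝ} (hδ : 0 < δ) (hM : 0 < M) {b b' : ℝ → ℝ} (hC : 0 ≤ C)
    (hb : ∀ x, b x ∈ Icc δ M) (hd : ∀ x, HasDerivAt b (b' x) x) (hbC : ∀ x, |b x| ≤ C)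
    (hbl : ∀ x y, |b x - b y| ≤ C * |x - y|) (hb' : ∀ x, |b' x| ≤ C)
    (hb'l : ∀ x y, |b' x - b' y| ≤ C * |x - y|) (hκ : 0 ≤ κ) (hκ1 : κ ≤ 1) (k : ℕ) :
    KReg (8 * M) (2 - (k : ℝ) / 2) 1 κ (fun t x y => pker b b' k t x y
      - famGen 0 0 k (b x) t (x - y) - b' x * yker k (b x) t (x - y)) := by
  have hb0 : ∀ x, 0 < b x := fun x => hδ.trans_le (hb x).1
  have hbl1 : ∀ x y, |b x - b y| ≤ C * |x - y| ^ (1 : ℝ) := by simpa only [Real.rpow_one] using hbl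
  have hbl1' : ∀ x y, |b' x - b' y| ≤ C * |x - y| ^ (1 : ℝ) := by
    simpa only [Real.rpow_one] using hb'l
  have hmem : famGen 0 1 (k + 2) ∈ Fam (k : ℝ) := famGen_mem _ _ _ (by push_cast; ring)
  obtain ⟨H2, hH2, hd2⟩ := Fam.exists_deriv_lam hmem
  obtain ⟨W, hW, hdW⟩ := Fam.exists_deriv_lam (corr_mem k)
  have hd1 : ∀ l > 0, ∀ t > 0, ∀ w,
      HasDerivAt (fun l => famGen 0 0 k l t w) (famGen 0 1 (k + 2) l t w) l := fun l hl t ht w => by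
    simpa using hasDerivAt_famGen_lam 0 0 k hl ht w
  have cs := (biCoef_sub zero_le_one le_rfl hC hbl1).swap
  -- The difference splits into four errors: the second order remainder in the diffusivity (`t1`),
  -- the Taylor remainder of `b` at `x` against `∂_λ ∂^k Z` (`t2`), the replacement of `b'(y)` by
  -- `b'(x)` in the correction (`t3`), and the change of the correction's diffusivity from `b(y)` to
  -- `b(x)` (`t4`). Each gains one full power of `t` over `∂^k Z`; in the last two, half of it comes
  -- from the lower degree of the correction.
  have t1 := ((Fam.biWk_integral hδ hM hH2 (φ := fun s => 1 - s) (by fun_prop) (fun s hs =>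
    abs_le.2 ⟨by linarith [hs.2], by linarith [hs.1]⟩) hb zero_le_one le_rfl hC hbl1).mul
    (cs.mul cs)).kreg hκ hκ1
  have t2 := ((Fam.biWk_left hδ hM hmem hb zero_le_one le_rfl hC hbl1).mul
    (biCoef_taylor hC hd hb'l).swap).kreg hκ hκ1
  have t3 := ((Fam.biWk_right hδ hM (corr_mem k) hb zero_le_one le_rfl hC hbl1).mul
    (biCoef_sub zero_le_one le_rfl hC hbl1').swap).kreg hκ hκ1
  have t4 := ((Fam.biWk_integral hδ hM hW (φ := fun _ => 1) continuous_const (by simp) hb zero_le_one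
    le_rfl hC hbl1).mul (biCoef_deriv_mul_sub hC hbC hbl hb' hb'l)).kreg hκ hκ1
  rw [show 1 - (k : ℝ) / 2 + (1 / 2 + 1 / 2) = 2 - (k : ℝ) / 2 by ring,
    show (1 : ℝ) + (0 + 0) = 1 by norm_num] at t1
  rw [show 1 - (k : ℝ) / 2 + 1 = 2 - (k : ℝ) / 2 by ring, add_zero] at t2
  rw [show 1 - ((k : ℝ) - 1) / 2 + 1 / 2 = 2 - (k : ℝ) / 2 by ring, add_zero] at t3 t4
  refine (((t1.add t2).add t3).add t4).congr fun t ht x y => ?_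
  rw [← integral_taylor_two (fun l hl => hd1 l hl t ht (x - y)) (fun l hl => hd2 l hl t ht (x - y))
    (Fam.continuousOn_lam hH2 ht _) (hb0 x) (hb0 y)]
  have e4 := integral_taylor_one (fun l hl => hdW l hl t ht (x - y)) (Fam.continuousOn_lam hW ht _)
    (hb0 x) (hb0 y)
  simp only [one_mul, mul_assoc]
  rw [← e4, yker_eq k (hb0 x) ht]
  simp only [pker]
  ring

/-! ### Constants controlled by the data -/

/-- The constant sees the coefficient only through `δ`, `M`, `μ` and `C`; this is the bound that
fixes the growth rate and finally `c₀`. The weight `q = 1` pays for `(|w|/√t)^μ`. -/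
lemma exists_volt_bound {δ M μ C : ℝ} (hδ : 0 < δ) (hM : 0 < M) (hμ : 0 ≤ μ) (hμ1 : μ ≤ 1)
    (hC : 0 ≤ C) {H : ℝ → ℝ → ℝ → ℝ} (hH : H ∈ Fam 2) : ∃ A : ℝ, 0 ≤ A ∧ ∀ t > 0,
      ∀ lam ∈ Icc δ M, ∀ w r : ℝ, |r| ≤ C * |w| ^ μ →
        |r * H lam t w| ≤ volt A (μ / 2) t * gk (8 * M * t) w := by
  obtain ⟨D, hD, h1⟩ := Fam.bound hδ hM hH 1
  refine ⟨C * D, by positivity, fun t ht lam hl w r hr => ?_⟩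
  have h2 := h1 t ht lam hl w w (by simp)
  rw [one_mul] at h2
  have h3 : |r| ≤ C * (t ^ (μ / 2) * Real.exp (|w| / √t)) := by
    refine hr.trans ?_
    rw [rpow_eq_mul_div_sqrt ht (abs_nonneg w)]
    have := rpow_le_one_exp (r := |w| / √t) (by positivity) hμ hμ1
    gcongr
  have g := gk_nonneg (8 * M * t) w
  have e : t ^ (μ / 2 - 1) = t ^ (μ / 2) * t ^ (-(2 : ℝ) / 2) := by
    rw [← Real.rpow_add ht]; ring_nf
  rw [abs_mul, volt, e]
  calc _ ≤ C * (t ^ (μ / 2) * Real.exp (|w| / √t)) * |H lam t w| := by gcongr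
    _ = C * t ^ (μ / 2) * (Real.exp (|w| / √t) * |H lam t w|) := by ring
    _ ≤ C * t ^ (μ / 2) * (D * (t ^ (-(2 : ℝ) / 2) * gk (8 * M * t) w)) := by gcongr
    _ = C * D * (t ^ (μ / 2) * t ^ (-(2 : ℝ) / 2) * 1) * gk (8 * M * t) w := by ring
    _ ≤ _ := by
      have : 1 ≤ Real.exp t := Real.one_le_exp ht.le
      gcongr

lemma biCoef_zero {p m κ : ℝ} : BiCoef p m κ (fun _ _ => 0) := by
  have : Coef p m κ (fun _ _ _ => 0) :=
    ⟨0, le_rfl, 0, le_rfl, fun t _ x y => ⟨by simp, fun x' _ => by simp⟩⟩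
  exact ⟨this, this⟩

lemma freezeData_zero {δ M α Cb : ℝ} {b : ℝ → ℝ} (hδ : 0 < δ) (hα : 0 < α) (hα1 : α ≤ 1)
    (hCb : 0 ≤ Cb) (hb : ∀ x, b x ∈ Icc δ M) (hbh : ∀ x y, |b x - b y| ≤ Cb * |x - y| ^ α) :
    FreezeData δ M α Cb α b (fun _ => 0) where
  δ_pos := hδ
  α_pos := hα
  α_le := hα1
  αν := le_rfl
  ν_le := by linarith
  Cb_nonneg := hCb
  mem := hb
  holder := hbh
  corr_left := biCoef_zero
  corr_cont := continuous_const
  coef_one := by simpa only [zero_mul, sub_zero] using biCoef_sub hα.le hα1 hCb hbh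
  coef_two := by simpa only [zero_mul] using biCoef_zero

lemma freezeData_deriv {δ M C : ℝ} {b b' : ℝ → ℝ} (hδ : 0 < δ) (hC : 0 ≤ C)
    (hb : ∀ x, b x ∈ Icc δ M) (hd : ∀ x, HasDerivAt b (b' x) x) (hb'c : Continuous b')
    (hbC : ∀ x, |b x| ≤ C) (hbl : ∀ x y, |b x - b y| ≤ C * |x - y|) (hb' : ∀ x, |b' x| ≤ C)
    (hb'l : ∀ x y, |b' x - b' y| ≤ C * |x - y|) : FreezeData δ M 1 C 2 b b' where
  δ_pos := hδ
  α_pos := one_pos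
  α_le := le_rfl
  αν := by norm_num
  ν_le := le_rfl
  Cb_nonneg := hC
  mem := hb
  holder := by simpa only [Real.rpow_one] using hbl
  corr_left := biCoef_left hC hb' hb'l
  corr_cont := hb'c
  coef_one := by
    rw [show (2 : ℝ) / 2 = 1 by norm_num]
    exact biCoef_taylor hC hd hb'l
  coef_two := by
    rw [show (2 : ℝ) / 2 - 1 / 2 = 1 / 2 by norm_num]
    exact (biCoef_deriv_mul_sub hC hbC hbl hb' hb'l).swap

lemma exists_bound_of_periodic {g : ℝ → ℝ} (hg : Continuous g) (hp : Function.Periodic g 1) :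
    ∃ C : ℝ, ∀ x, |g x| ≤ C := by
  obtain ⟨C, hC⟩ := isCompact_Icc.exists_bound_of_continuousOn (s := Icc (0 : ℝ) 1) hg.continuousOn
  refine ⟨C, fun x => ?_⟩
  obtain ⟨y, hy, e⟩ := hp.exists_mem_Ico₀ one_pos x
  rw [e]
  exact hC y (Ico_subset_Icc_self hy)

lemma periodic_deriv {g : ℝ → ℝ} {p : ℝ} (hp : Function.Periodic g p) :
    Function.Periodic (deriv g) p := by
  intro x
  rw [← deriv_comp_add_const, show (fun x => g (x + p)) = g from funext hp]

lemma abs_sub_le_of_abs_deriv_le {g : ℝ → ℝ} {C : ℝ} (hg : Differentiable ℝ g)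
    (hC : ∀ x, |deriv g x| ≤ C) (x y : ℝ) : |g x - g y| ≤ C * |x - y| :=
  convex_univ.norm_image_sub_le_of_norm_deriv_le (fun x _ => hg x) (fun x _ => hC x)
    (mem_univ y) (mem_univ x)

lemma iteratedDeriv_heatKernel (k : ℕ) (c lam t w : ℝ) :
    iteratedDeriv k (heatKernel c lam t) w = Real.exp (-c * t) * famGen 0 0 k lam t w := by
  rw [show heatKernel c lam t = fun x => Real.exp (-c * t) * gk (2 * lam * t) x from
    funext (heatKernel_eq c lam t), iteratedDeriv_const_mul_field]
  simp [famGen, gkD]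

lemma KC.sub {f g : ℝ → ℝ → ℝ → ℝ} (hf : KC f) (hg : KC g) :
    KC (fun t x y => f t x y - g t x y) := ContinuousOn.sub hf hg

lemma volt_one_bound {L : ℝ} {f : ℝ → ℝ → ℝ → ℝ} (hf : KBd L 1 1 f) :
    ∃ C : ℝ, 0 ≤ C ∧ ∀ C' ≥ C, ∀ t > 0, ∀ x y, |f t x y| ≤ volt C' 1 t * gk (L * t) (x - y) := by
  obtain ⟨C, hC, h⟩ := hf
  refine ⟨C, hC, fun C' hC' t ht x y => (h t ht x y).trans ?_⟩
  have := gk_nonneg (L * t) (x - y)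
  rw [volt, one_mul, ← mul_assoc]
  gcongr

/-- Existence of the fundamental solution and comparison with frozen heat kernels, with growth
constants depending only on the data. -/
theorem exists_fundamentalSolution_holder {δ M μ C : ℝ} (hδ : 0 < δ) (hM : 0 < M) (hμ : 0 < μ)
    (hμ1 : μ ≤ 1) (hC : 0 ≤ C) : ∃ m : ℝ, 1 ≤ m ∧ ∀ b : ℝ → ℝ, (∀ x, b x ∈ Icc δ M) →
      (∀ x y, |b x - b y| ≤ C * |x - y| ^ μ) → ∀ α Cb : ℝ, 0 < α → α ≤ 1 → 0 ≤ Cb →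
      (∀ x y, |b x - b y| ≤ Cb * |x - y| ^ α) →
      ∃ (Q : ℝ → ℝ → ℝ → ℝ) (R : ℕ → ℝ → ℝ → ℝ → ℝ),
        (∀ c, IsFundamentalSolution b c (fun t x y => Real.exp (-c * t) * Q t x y)) ∧
        (∀ c, ∀ k : ℕ, k ≤ 2 → ∀ t > 0, ∀ x y,
          iteratedDeriv k (fun x' => Real.exp (-c * t) * Q t x' y) x
            = Real.exp (-c * t) * (famGen 0 0 k (b y) t (x - y) + R k t x y)) ∧
        ∀ k : ℕ, k ≤ 2 → KC (R k) ∧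
          ∀ κ ∈ Ico 0 α, KReg (8 * M) (1 + α / 2 - (k : ℝ) / 2) m κ (R k) := by
  obtain ⟨A1, hA1, h1⟩ := exists_volt_bound hδ hM hμ.le hμ1 hC FreezeData.mem_two
  obtain ⟨A2, hA2, h2⟩ := exists_volt_bound hδ hM hμ.le hμ1 hC FreezeData.mem_four
  obtain ⟨m, hm, H⟩ := exists_fundamentalSolution (δ := δ) (A := A1 + A2) (θ₀ := μ / 2) hM
    (by positivity) (by positivity) (by linarith)
  refine ⟨m, hm, fun b hb hbμ α Cb hα hα1 hCb hbh => ?_⟩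
  have hmono : ∀ A ≤ A1 + A2, ∀ t > 0, ∀ x z, volt A (μ / 2) t * gk (8 * M * t) (x - z)
      ≤ volt (A1 + A2) (μ / 2) t * gk (8 * M * t) (x - z) := fun A hA t ht x z => by
    have := gk_nonneg (8 * M * t) (x - z)
    unfold volt
    gcongr
  -- Two Hölder exponents are at work: the defect is bounded with `μ`, which determines `m`, while
  -- the remainder is estimated with `α`.
  obtain ⟨Q, R, q1, q2, q3⟩ := H α Cb α b (fun _ => 0) (freezeData_zero hδ hα hα1 hCb hb hbh)
    (fun t ht x z => by
      simp only [defect, zero_mul, sub_zero, add_zero]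
      exact (h1 t ht _ (hb z) _ _ (hbμ x z)).trans (hmono A1 (by linarith) t ht x z))
    (fun t ht x z => by
      simp only [defectD, zero_mul, sub_zero, add_zero]
      exact (h2 t ht _ (hb z) _ _ (hbμ x z)).trans (hmono A2 (by linarith) t ht x z))
  refine ⟨Q, R, q1, fun c k hk t ht x y => ?_, q3⟩
  rw [q2 c k hk t ht x y]
  simp only [pker, zero_mul, add_zero]

/-- The second order expansion of a fundamental solution with smooth coefficient. -/
theorem exists_expansion {δ M C : ℝ} {b b' : ℝ → ℝ} (hδ : 0 < δ) (hM : 0 < M) (hC : 0 ≤ C)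
    (hb : ∀ x, b x ∈ Icc δ M) (hd : ∀ x, HasDerivAt b (b' x) x) (hb'c : Continuous b')
    (hbC : ∀ x, |b x| ≤ C) (hbl : ∀ x y, |b x - b y| ≤ C * |x - y|) (hb' : ∀ x, |b' x| ≤ C)
    (hb'l : ∀ x y, |b' x - b' y| ≤ C * |x - y|) :
    ∃ m : ℝ, 0 ≤ m ∧ ∃ (Q : ℝ → ℝ → ℝ → ℝ) (S : ℕ → ℝ → ℝ → ℝ → ℝ),
      (∀ c, IsFundamentalSolution b c (fun t x y => Real.exp (-c * t) * Q t x y)) ∧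
      (∀ c, ∀ k : ℕ, k ≤ 2 → ∀ t > 0, ∀ x y,
        iteratedDeriv k (fun x' => Real.exp (-c * t) * Q t x' y) x
          = Real.exp (-c * t) * (famGen 0 0 k (b x) t (x - y) + b' x * yker k (b x) t (x - y)
            + S k t x y)) ∧
      ∀ k : ℕ, k ≤ 2 → ∀ κ ∈ Ico (0 : ℝ) 1, KReg (8 * M) (2 - (k : ℝ) / 2) m κ (S k) := by
  have hF := freezeData_deriv hδ hC hb hd hb'c hbC hbl hb' hb'l
  have r1 := (hF.kreg_defect_of_mem FreezeData.mem_two FreezeData.corr_two_mem le_rfl zero_le_one).bd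
  have r2 := (hF.kreg_defect_of_mem FreezeData.mem_four FreezeData.corrD_two_mem le_rfl
    zero_le_one).bd
  rw [show (2 : ℝ) / 2 = 1 by norm_num] at r1 r2
  obtain ⟨A1, hA1, h1⟩ := volt_one_bound r1
  obtain ⟨A2, hA2, h2⟩ := volt_one_bound r2
  -- Here the growth rate depends on the `C²` data through `A1` and `A2`; this dependence is removed
  -- afterwards by gluing.
  obtain ⟨m, hm, H⟩ := exists_fundamentalSolution (δ := δ) (A := A1 + A2) (θ₀ := 1) hM
    (by positivity) one_pos le_rfl
  obtain ⟨Q, R, q1, q2, q3⟩ := H 1 C 2 b b' hF (h1 _ (by linarith)) (h2 _ (by linarith))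
  refine ⟨m, by linarith, Q, fun k t x y => (pker b b' k t x y - famGen 0 0 k (b x) t (x - y)
    - b' x * yker k (b x) t (x - y)) + R k t x y, q1, fun c k hk t ht x y => ?_,
    fun k hk κ hκ => ?_⟩
  · rw [q2 c k hk t ht x y]
    ring
  · have e := (q3 k hk).2 κ hκ
    rw [show 1 + (2 : ℝ) / 2 - (k : ℝ) / 2 = 2 - (k : ℝ) / 2 by ring] at e
    exact ((kreg_expansion hδ hM hC hb hd hbC hbl hb' hb'l hκ.1 hκ.2.le k).mono_m hm).add e

end

/-! ### Assembly of the proposition -/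

theorem mainTheorem9 :
    ∃ Y : ℝ → ℕ → ℝ → ℝ → ℝ → ℝ,
      (∀ c > 0, ∀ k : ℕ, k ≤ 2 →
        (∀ K : Set ℝ, IsCompact K → K ⊆ Ioi 0 →
          MemGaussClassOn K (1 - (k : ℝ)) 1 1 (fun lam t x y => Y c k lam t (x - y))) ∧
        (∀ lam > 0, ∀ t > 0,
          (Even k → Function.Odd (Y c k lam t)) ∧ (Odd k → Function.Even (Y c k lam t)))) ∧
      ∀ (μ M : ℝ≥0), 0 < μ → μ ≤ 1 → ∀ δ : ℝ, 0 < δ → ∃ c₀ > 0, ∀ a v₀ : ℝ → ℝ,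
        ContDiff ℝ 1 a → (∀ r, δ ≤ a r ∧ a r ≤ M ∧ |deriv a r| ≤ M) →
        Function.Periodic v₀ 1 → HolderWith M μ v₀ →
        ∀ b : ℝ → ℝ, b = (fun x => a (v₀ x)) → ∀ c > c₀,
          (∃ Q, IsFundamentalSolution b c Q) ∧
          ∀ Q, IsFundamentalSolution b c Q →
            (∀ α : ℝ≥0, 0 < α → α ≤ 1 → MemHolder α v₀ → ∀ k : ℕ, k ≤ 2 →
              MemGaussClass (α - k) α α (fun t x y =>
                iteratedDeriv k (fun x' => Q t x' y) x
                  - iteratedDeriv k (heatKernel c (b y) t) (x - y)) ∧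
              MemGaussClass (α - k) α α (fun t x y =>
                iteratedDeriv k (fun x' => Q t x' y) x
                  - iteratedDeriv k (heatKernel c (b x) t) (x - y))) ∧
            (ContDiff ℝ 2 a → ContDiff ℝ 2 v₀ → ∀ k : ℕ, k ≤ 2 →
              MemGaussClass (2 - k) 1 1 (fun t x y =>
                iteratedDeriv k (fun x' => Q t x' y) x
                  - iteratedDeriv k (heatKernel c (b x) t) (x - y)
                  - deriv b x * Y c k (b x) t (x - y))) := by
  refine ⟨fun c k lam t w => Real.exp (-c * t) * yker k lam t w, fun c hc k _ =>
    ⟨fun K hK hK0 => ?_, fun lam hl t ht => ⟨fun hk w => ?_, fun hk w => ?_⟩⟩, ?_⟩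
  · rw [show 1 - (k : ℝ) = -((k : ℝ) - 1) by ring]
    exact Fam.memGaussClassOn hc (yker_mem k) hK hK0
  · beta_reduce
    rw [yker_neg k hl ht, hk.add_one.neg_one_pow]
    ring
  · beta_reduce
    rw [yker_neg k hl ht, hk.add_one.neg_one_pow, one_mul]
  intro μ M hμ hμ1 δ hδ
  rcases eq_or_lt_of_le M.coe_nonneg with hM | hM
  · refine ⟨1, one_pos, fun a v₀ _ h => ?_⟩
    have := h 0
    linarith
  have hμ' : (0 : ℝ) < μ := hμ
  -- The constant `M * M` is the Lipschitz bound of `a` times the `μ`-Hölder constant of `v₀`.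
  obtain ⟨m, hm, H⟩ := exists_fundamentalSolution_holder (δ := δ) (M := M) (μ := μ)
    (C := (M : ℝ) * M) hδ hM hμ' hμ1 (by positivity)
  -- Since `m ≥ 1`, the rate `m + 1` also covers the growth rate `2` of the term `b' Y` in the third
  -- part.
  refine ⟨m + 1, by linarith, fun a v₀ ha hab hper hv b hbdef c hc => ?_⟩
  have hL : (0 : ℝ) < 8 * M := by positivity
  have hc0 : 0 ≤ c := by linarith
  have hb : ∀ x, b x ∈ Icc δ (M : ℝ) := fun x => by
    rw [hbdef]; exact ⟨(hab _).1, (hab _).2.1⟩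
  have hb0 : ∀ x, 0 < b x := fun x => hδ.trans_le (hb x).1
  have hlip := abs_sub_le_of_abs_deriv_le (ha.differentiable one_ne_zero) fun r => (hab r).2.2
  have hholder : ∀ (α C : ℝ≥0), HolderWith C α v₀ → ∀ x y,
      |b x - b y| ≤ (M : ℝ) * C * |x - y| ^ (α : ℝ) := by
    intro α C h x y
    have h1 := h.dist_le x y
    rw [Real.dist_eq, Real.dist_eq] at h1
    rw [hbdef, mul_assoc]
    exact (hlip _ _).trans (mul_le_mul_of_nonneg_left h1 M.coe_nonneg)
  have hfrozen := H b hb (hholder μ M hv)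
  -- every fundamental solution agrees with the constructed ones
  have hagree : ∀ Q, IsFundamentalSolution b c Q → ∀ Q' : ℝ → ℝ → ℝ → ℝ,
      IsFundamentalSolution b c (fun t x y => Real.exp (-c * t) * Q' t x y) → ∀ k, ∀ t > 0, ∀ x y,
      iteratedDeriv k (fun x' => Q t x' y) x
        = iteratedDeriv k (fun x' => Real.exp (-c * t) * Q' t x' y) x := by
    intro Q hQ Q' hQ' k t ht x y
    rw [show (fun x' => Q t x' y) = fun x' => Real.exp (-c * t) * Q' t x' y from
      funext fun x' => hQ.unique hc0 (fun x => (hb0 x).le) (fun x => (hb x).2) hQ' ht x' y]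
  refine ⟨?_, fun Q hQ => ⟨fun α hα hα1 ⟨C, hC⟩ k hk => ?_, fun ha2 hv2 k hk => ?_⟩⟩
  · obtain ⟨Q, R, hQ, -⟩ := hfrozen μ ((M : ℝ) * M) hμ' hμ1 (by positivity) (hholder μ M hv)
    exact ⟨_, hQ c⟩
  · have hα' : (0 : ℝ) < α := hα
    have hα1' : (α : ℝ) ≤ 1 := hα1
    have hbα := hholder α C hC
    have hbc := (freezeData_zero hδ hα' hα1' (by positivity) hb hbα).continuous
    obtain ⟨Q', R, hQ', hder, hR⟩ := hfrozen α ((M : ℝ) * C) hα' hα1' (by positivity) hbα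
    have hmem : famGen 0 0 k ∈ Fam (k : ℝ) := famGen_mem _ _ _ (by push_cast; ring)
    obtain ⟨hRc, hRr⟩ := hR k hk
    rw [show (α : ℝ) - k = 2 * (1 + (α : ℝ) / 2 - (k : ℝ) / 2) - 2 by ring]
    constructor
    · refine (memGaussClass_exp_mul hα' hL (by linarith : m < c) hRc hRr).congr
        fun _ _ t ht x y => ?_
      rw [hagree Q hQ Q' (hQ' c) k t ht x y, hder c k hk t ht x y, iteratedDeriv_heatKernel]
      ring
    · refine (memGaussClass_exp_mul hα' hL (by linarith : m < c) (hRc.add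
        (KC.sub (Fam.kc_right hmem hbc hb0) (Fam.kc_left hmem hbc hb0))) fun κ hκ =>
        (hRr κ hκ).add ?_).congr fun _ _ t ht x y => ?_
      · have := (Fam.kreg_sub hδ hM hmem hb hα'.le hα1' (by positivity) hbα hκ.1 hκ.2.le).mono_m hm
        rwa [show 1 - (k : ℝ) / 2 + (α : ℝ) / 2 = 1 + (α : ℝ) / 2 - (k : ℝ) / 2 by ring] at this
      · rw [hagree Q hQ Q' (hQ' c) k t ht x y, hder c k hk t ht x y, iteratedDeriv_heatKernel]
        ring
  · have hb2 : ContDiff ℝ 2 b := by rw [hbdef]; exact ha2.comp hv2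
    have hbp : Function.Periodic b 1 := fun x => by rw [hbdef]; simp only [hper x]
    have hdb : Differentiable ℝ b := hb2.differentiable two_ne_zero
    have hb1 : ContDiff ℝ 1 (deriv b) := by
      have h2 : ContDiff ℝ (1 + 1) b := by norm_num; exact hb2
      exact (contDiff_succ_iff_deriv.1 h2).2.2
    -- Periodicity enters only here: it makes the first two derivatives of `b` bounded. These bounds
    -- do not influence `c₀`.
    obtain ⟨C1, hC1⟩ := exists_bound_of_periodic hb1.continuous (periodic_deriv hbp)
    obtain ⟨C2, hC2⟩ := exists_bound_of_periodic (hb1.continuous_deriv le_rfl)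
      (periodic_deriv (periodic_deriv hbp))
    set C := (M : ℝ) + |C1| + |C2| with hC
    have hCM : (M : ℝ) ≤ C := by have := abs_nonneg C1; have := abs_nonneg C2; linarith
    have hCC1 : C1 ≤ C := by have := le_abs_self C1; have := abs_nonneg C2; linarith
    have hCC2 : C2 ≤ C := by have := abs_nonneg C1; have := le_abs_self C2; linarith
    have hC0 : 0 ≤ C := hM.le.trans hCM
    have hbl := abs_sub_le_of_abs_deriv_le hdb fun x => (hC1 x).trans hCC1
    have hb'l := abs_sub_le_of_abs_deriv_le (hb1.differentiable one_ne_zero)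
      fun x => (hC2 x).trans hCC2
    have hbl1 : ∀ x y, |b x - b y| ≤ C * |x - y| ^ (1 : ℝ) := by simpa only [Real.rpow_one] using hbl
    have hbC : ∀ x, |b x| ≤ C := fun x => by
      rw [abs_of_pos (hb0 x)]; exact (hb x).2.trans hCM
    have hb'C : ∀ x, |deriv b x| ≤ C := fun x => (hC1 x).trans hCC1
    obtain ⟨Q', R, hQ', hder, hR⟩ := hfrozen 1 C one_pos le_rfl hC0 hbl1
    obtain ⟨m', hm', Q'', S, hQ'', hder', hS⟩ := exists_expansion hδ hM hC0 hb
      (fun x => (hdb x).hasDerivAt) hb1.continuous hbC hbl hb'C hb'l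
    have hmem : famGen 0 0 k ∈ Fam (k : ℝ) := famGen_mem _ _ _ (by push_cast; ring)
    obtain ⟨hRc, hRr⟩ := hR k hk
    -- By uniqueness the second order remainder `S` can be rewritten through the first construction,
    -- taken with exponent `1`. In this form its time exponent is worse by one half, but its growth
    -- rate is at most `m + 1`; gluing the two bounds keeps the better exponent and the better
    -- growth.
    set F : ℝ → ℝ → ℝ → ℝ := fun t x y => (R k t x y
      + (famGen 0 0 k (b y) t (x - y) - famGen 0 0 k (b x) t (x - y)))
      - deriv b x * yker k (b x) t (x - y) with hF
    have hFS : ∀ t > 0, ∀ x y, S k t x y = F t x y := by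
      intro t ht x y
      have e1 := hder c k hk t ht x y
      have e2 := hder' c k hk t ht x y
      rw [← hagree Q hQ Q' (hQ' c) k t ht x y] at e1
      rw [← hagree Q hQ Q'' (hQ'' c) k t ht x y, e1] at e2
      have e3 := mul_left_cancel₀ (Real.exp_pos _).ne' e2
      simp only [hF]
      linarith
    have hFc : KC F := KC.sub (hRc.add (KC.sub (Fam.kc_right hmem hdb.continuous hb0)
      (Fam.kc_left hmem hdb.continuous hb0))) ((Fam.kc_left (yker_mem k) hdb.continuous
      hb0).mul_fun (A := fun x _ => deriv b x) (hb1.continuous.comp continuous_fst))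
    have hFr : ∀ κ ∈ Ico (0 : ℝ) 1, KReg (8 * M) (3 / 2 - (k : ℝ) / 2) (m + 1) κ F := by
      intro κ hκ
      have f1 := (hRr κ hκ).mono_m (show m ≤ m + 1 by linarith)
      have f2 := (Fam.kreg_sub hδ hM hmem hb zero_le_one le_rfl hC0 hbl1 hκ.1 hκ.2.le).mono_m
        (show 1 ≤ m + 1 by linarith)
      have f3 := (((Fam.biWk_left hδ hM (yker_mem k) hb zero_le_one le_rfl hC0 hbl1).mul
        (biCoef_left hC0 hb'C hb'l)).kreg hκ.1 hκ.2.le).mono_m (show 1 + 1 ≤ m + 1 by linarith)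
      rw [show 1 + (1 : ℝ) / 2 - (k : ℝ) / 2 = 3 / 2 - (k : ℝ) / 2 by ring] at f1
      rw [show 1 - (k : ℝ) / 2 + 1 / 2 = 3 / 2 - (k : ℝ) / 2 by ring] at f2
      rw [show 1 - ((k : ℝ) - 1) / 2 + 0 = 3 / 2 - (k : ℝ) / 2 by ring] at f3
      exact (f1.add f2).sub f3
    rw [show (2 : ℝ) - k = 2 * (2 - (k : ℝ) / 2) - 2 by ring]
    refine (memGaussClass_exp_mul one_pos hL (by linarith : m + 1 < c) hFc fun κ hκ =>
      ((hS k hk κ hκ).congr hFS).glue hL (hFr κ hκ) (by linarith) (by linarith) hm').congr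
      fun _ _ t ht x y => ?_
    rw [hagree Q hQ Q' (hQ' c) k t ht x y, hder c k hk t ht x y, iteratedDeriv_heatKernel]
    simp only [hF]
    ring
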